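/- Let $\Omega$ be either a bounded domain in $\mathbb R^2$, or a part of the boundary of a bounded domain in $\mathbb R^3$ that is a (piecewise flat) surface, i.e. a two-dimensional manifold. Let $\mathcal T$ be a mesh on $\Omega$: a finite set of flat, compact, non-degenerate triangles with $\overline\Omega=\bigcup_{T\in\mathcal T}T$, such that $T_1\cap T_2$ is empty, a common node or a common edge for all $T_1\ne T_2$ in $\mathcal T$; it is understood that $\overline\Omega\setminus\Omega$ is a union of edges and nodes of $\mathcal T$. On a surface, $\Omega$ being a two-dimensional manifold means: each edge whose relative interior lies in $\Omega$ belongs to exactly two triangles, and any two triangles containing a node $z\in\Omega$ are joined by a chain of triangles containing $z$, consecutive ones sharing an edge at $z$. Let $\mathcal T$ be $\gamma$-shape regular, i.e. $\operatorname{diam}(T)^2\le\gamma|T|$ for all $T\in\mathcal T$ and, if $\Omega$ is a surface in $\mathbb R^3$, at most $\gamma$ elements share a node (in the plane the number of these elements is bounded in terms of $\gamma$ anyway). For each node $z$ let $d_z>0$ be given. For $T\in\mathcal T$ with vertices $z_{[T,1]},z_{[T,2]},z_{[T,3]}$ let $\varphi_{[T,i]}$ be the affine function on $T$ with $\varphi_{[T,i]}(z_{[T,j]})=\delta_{ij}$,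 and define $\mathbf M_T,\Lambda_T\in\mathbb R^{3\times3}$ by $$(\mathbf M_T)_{ij}=\int_T\varphi_{[T,i]}\varphi_{[T,j]}\,dx,\qquad (\Lambda_T)_{ij}=\frac{\operatorname{diam}(T)}{d_{z_{[T,i]}}}\,\delta_{ij}.$$ Suppose that there are constants $C_7,C_8>0$ such that for all $T\in\mathcal T$ and all $\mathbf x\in\mathbb R^3$ $$C_7^{-1}\,\mathbf x^\top\Lambda_T^2\mathbf M_T\Lambda_T^2\mathbf x\le\mathbf x^\top\mathbf M_T\mathbf x\le C_8\,\mathbf x^\top\Lambda_T^2\mathbf M_T\mathbf x .$$ Let $\mathcal S^1(\mathcal T)$ be the space of functions $V:\Omega\to\mathbb R$ that are continuous on $\Omega$ and affine on each $T\in\mathcal T$, and let $\Pi$ be the $L_2(\Omega)$-orthogonal projection onto $\mathcal S^1(\mathcal T)$, i.e. $\Pi u\in\mathcal S^1(\mathcal T)$ and $\int_\Omega V(u-\Pi u)\,dx=0$ for all $V\in\mathcal S^1(\mathcal T)$. Then $\Pi$ is $H^1$-stable: $\Pi u\in H^1(\Omega)$ and $$\|\nabla\Pi u\|_{L_2(\Omega)}\le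 C_2\,\|\nabla u\|_{L_2(\Omega)}\qquad\text{for all }u\in H^1(\Omega),$$ where the constant $C_2>0$ depends only on $\gamma$, $C_7$ and $C_8$. (On a surface, $\nabla$ is the weak tangential gradient and $H^1(\Omega)$ is defined through bi-Lipschitz parametrizations.) -/

import Mathlib

open MeasureTheory
open scoped ContDiff

namespace P1FEM

noncomputable section

/-- The Euclidean space `ℝ^d`. The surface measure on two-dimensional subsets is `μHE[2]`, the
Hausdorff measure normalized so as to agree with the Lebesgue measure on planes; on `E 2` it is the
Lebesgue measure itself. -/
abbrev E (d : ℕ) : Type := EuclideanSpace ℝ (Fin d)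

variable {d : ℕ}

/-- The closed flat triangle with the given set of vertices. -/
def tri (T : Finset (E d)) : Set (E d) := convexHull ℝ (T : Set (E d))

/-- `𝒯` (a finite set of triangles, each given by its three vertices) is a mesh on `Ω`: finitely
many non-degenerate compact flat triangles that cover `closure Ω`, two different ones of which
intersect in the convex hull of their common vertices, that is, in the empty set, in a common node
or in a common edge. -/
structure IsMesh (Ω : Set (E d)) (𝒯 : Finset (Finset (E d))) : Prop where
  card_eq : ∀ T ∈ 𝒯, T.card = 3
  nondegenerate : ∀ T ∈ 𝒯, AffineIndependent ℝ ((↑) : T → E d)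
  cover : closure Ω = ⋃ T ∈ 𝒯, tri T
  inter : ∀ T₁ ∈ 𝒯, ∀ T₂ ∈ 𝒯, T₁ ≠ T₂ →
    tri T₁ ∩ tri T₂ = convexHull ℝ ((T₁ : Set (E d)) ∩ (T₂ : Set (E d)))

/-- `Ω` is polygonal and the mesh resolves its (relative) boundary: `closure Ω \ Ω` is a union of
edges and nodes of the mesh. -/
def ResolvesBoundary (Ω : Set (E d)) (𝒯 : Finset (Finset (E d))) : Prop :=
  ∃ 𝓑 : Set (Finset (E d)), (∀ e ∈ 𝓑, e.card ≤ 2 ∧ ∃ T ∈ 𝒯, e ⊆ T) ∧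
    closure Ω \ Ω = ⋃ e ∈ 𝓑, convexHull ℝ (e : Set (E d))

/-- `A` and `B` share an edge that has `z` as one of its end points. -/
def ShareEdgeAt (z : E d) (A B : Finset (E d)) : Prop :=
  ∃ y, y ≠ z ∧ z ∈ A ∧ y ∈ A ∧ z ∈ B ∧ y ∈ B

/-- The piecewise flat set `Ω` is a surface (a two-dimensional manifold) at each of its points:
an edge whose relative interior lies in `Ω` belongs to exactly two triangles, and the triangles
around a node that lies in `Ω` form one cycle, that is, they can be joined through edges at that
node. (In `ℝ²` this holds for every open `Ω`.) -/
structure IsSurface (Ω : Set (E d)) (𝒯 : Finset (Finset (E d))) : Prop where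
  edge : ∀ a b : E d, a ≠ b → (∃ T ∈ 𝒯, a ∈ T ∧ b ∈ T) → openSegment ℝ a b ⊆ Ω →
    {T | T ∈ 𝒯 ∧ a ∈ T ∧ b ∈ T}.ncard = 2
  node : ∀ z ∈ Ω, ∀ T ∈ 𝒯, ∀ T' ∈ 𝒯, z ∈ T → z ∈ T' →
    Relation.ReflTransGen (fun A B => B ∈ 𝒯 ∧ ShareEdgeAt z A B) T T'

/-- Either `Ω` is a bounded polygonal domain in `ℝ²`, or `Ω` is a part of the boundary of a bounded
domain in `ℝ³` and a piecewise flat surface. -/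
def IsMeshedDomain (Ω : Set (E d)) (𝒯 : Finset (Finset (E d))) : Prop :=
  IsMesh Ω 𝒯 ∧ ResolvesBoundary Ω 𝒯 ∧
    ((d = 2 ∧ IsOpen Ω ∧ IsConnected Ω ∧ Bornology.IsBounded Ω) ∨
     (d = 3 ∧ (∃ D : Set (E d), IsOpen D ∧ IsConnected D ∧ Bornology.IsBounded D ∧ Ω ⊆ frontier D) ∧
      IsSurface Ω 𝒯))

/-- `γ`-shape regularity, `diam(T)² ≤ γ |T|`. On a surface in `ℝ³` it includes that at most `γ`
elements share a node; in the plane the first property bounds this number. -/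
structure IsShapeRegular (γ : ℝ) (𝒯 : Finset (Finset (E d))) : Prop where
  diam_sq_le : ∀ T ∈ 𝒯, Metric.diam (tri T) ^ 2 ≤ γ * (μHE[2]).real (tri T)
  valence_le : d = 3 → ∀ T ∈ 𝒯, ∀ z ∈ T, ({T' | T' ∈ 𝒯 ∧ z ∈ T'}.ncard : ℝ) ≤ γ

open Classical in
/-- The restriction to the triangle `T` of the hat function of the node `z`: the affine function
that is `1` at `z` and `0` at the other vertices of `T`. (For `d = 3` only its values on the plane
of `T` are determined, and only those are used.) -/
def hat (T : Finset (E d)) (z : E d) : E d →ᵃ[ℝ] ℝ :=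
  Classical.epsilon fun f => ∀ y ∈ T, f y = if y = z then 1 else 0

/-- The element mass matrix `M_T`; rows and columns are indexed by the three vertices of `T`. -/
def massMatrix (T : Finset (E d)) : Matrix T T ℝ :=
  Matrix.of fun i j => ∫ x in tri T, hat T i x * hat T j x ∂μHE[2]

open Classical in
/-- The element scaling matrix `Λ_T`, diagonal with the entries `diam(T) / δ_z`, `z` a vertex. -/
def scalingMatrix (δ : E d → ℝ) (T : Finset (E d)) : Matrix T T ℝ :=
  Matrix.diagonal fun z => Metric.diam (tri T) / δ z

open Classical in
/-- The generalized eigenvalue bounds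
`C₇⁻¹ xᵀ Λ_T² M_T Λ_T² x ≤ xᵀ M_T x ≤ C₈ xᵀ Λ_T² M_T x` for all `x`. -/
def MassMatrixBounds (C₇ C₈ : ℝ) (δ : E d → ℝ) (T : Finset (E d)) : Prop :=
  ∀ x : T → ℝ,
    C₇⁻¹ * (x ⬝ᵥ Matrix.mulVec
        (scalingMatrix δ T ^ 2 * massMatrix T * scalingMatrix δ T ^ 2) x)
      ≤ x ⬝ᵥ Matrix.mulVec (massMatrix T) x ∧
    x ⬝ᵥ Matrix.mulVec (massMatrix T) x
      ≤ C₈ * (x ⬝ᵥ Matrix.mulVec (scalingMatrix δ T ^ 2 * massMatrix T) x)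

/-- The P1 finite element space: functions on `Ω` (only their values on `Ω` matter) that are
continuous on `Ω` and affine on each triangle. -/
def S1 (Ω : Set (E d)) (𝒯 : Finset (Finset (E d))) : Set (E d → ℝ) :=
  {V | ContinuousOn V Ω ∧ ∀ T ∈ 𝒯, ∃ A : E d →ᵃ[ℝ] ℝ, ∀ x ∈ tri T ∩ Ω, V x = A x}

/-- `P` is the `L²(Ω)`-orthogonal projection of `u` onto the P1 finite element space. -/
def IsL2Projection (Ω : Set (E d)) (𝒯 : Finset (Finset (E d))) (u P : E d → ℝ) : Prop :=
  P ∈ S1 Ω 𝒯 ∧ ∀ V ∈ S1 Ω 𝒯, ∫ x in Ω, V x * (u x - P x) ∂μHE[2] = 0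

/-- `χ` is a bi-Lipschitz parametrization, over the open set `U ⊆ ℝ²`, of a part of `Ω`. -/
structure IsChart (Ω : Set (E d)) (U : Set (E 2)) (χ : E 2 → E d) : Prop where
  isOpen : IsOpen U
  mapsTo : Set.MapsTo χ U Ω
  biLipschitz : ∃ L : ℝ, ∀ x ∈ U, ∀ y ∈ U,
    dist (χ x) (χ y) ≤ L * dist x y ∧ dist x y ≤ L * dist (χ x) (χ y)

/-- `u ∈ H¹(Ω)` with weak (tangential) gradient `g`: both are square integrable on `Ω`, and in every
bi-Lipschitz parametrization `χ` the field `g` is tangential and `u ∘ χ` has the weak gradient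
`(Dχ)ᵀ (g ∘ χ)`. For open `Ω ⊆ ℝ²` this is the usual `H¹(Ω)` with the usual weak gradient: take
for `χ` the identity, and conversely use the chain rule for bi-Lipschitz changes of variables. -/
structure HasH1Gradient (Ω : Set (E d)) (u : E d → ℝ) (g : E d → E d) : Prop where
  memLp : MemLp u 2 ((μHE[2]).restrict Ω)
  memLp_grad : MemLp g 2 ((μHE[2]).restrict Ω)
  tangential : ∀ U χ, IsChart Ω U χ →
    ∀ᵐ y ∂((volume : Measure (E 2)).restrict U), ∃ v : E 2, g (χ y) = fderiv ℝ χ y v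
  weak : ∀ U χ, IsChart Ω U χ →
    ∀ φ : E 2 → ℝ, ContDiff ℝ ∞ φ → HasCompactSupport φ → tsupport φ ⊆ U → ∀ v : E 2,
      ∫ y in U, u (χ y) * fderiv ℝ φ y v = - ∫ y in U, inner ℝ (g (χ y)) (fderiv ℝ χ y v) * φ y

end

end P1FEM

/-! ### Incidence geometry of the mesh and its skeleton -/

namespace P1FEM

open Set Topology

variable {d : ℕ}

/-! Write `h_T` for the diameter of `T`, let `J` be a quasi-interpolant of `u`, and put `W = Πu -
J`. The heart of the matter is one test function: let `V` have the nodal values `W(z) / d_z²`. Since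
`d_z` belongs to the node and not to the triangle, `V` is again a finite element function. The upper
mass matrix bound reads `h_T⁻² ‖W‖²_T ≤ C₈ ∫_T V W`, and after summation over `T` orthogonality
replaces `∫ V W` by `∫ V (u - J)`. The lower bound reads `h_T⁴ ‖V‖²_T ≤ C₇ ‖W‖²_T`, so Young's
inequality absorbs `V` and leaves `∑ h_T⁻² ‖W‖²_T ≤ C₈² C₇ ∑ h_T⁻² ‖u - J‖²_T`. This is
`IsL2Projection.sum_integral_sub_sq_le`.

It remains to bound `h_T⁻¹ ‖u - J‖_T` by the gradient of `u` on the patches around `T`, and to pass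
from `W` to gradients by an inverse estimate. A nodal value of `J` is the mean of `u` over one
triangle at the node. Two facts control `J`: the Poincaré inequality on a triangle, and a bound for
the difference of the means over two triangles with a common edge inside `Ω`, which is iterated
along a path in the patch. Both come from the same estimate of `∫∫ |w(y) - w(x)|²` over a convex
planar set (`lintegral_lintegral_sub_sq_le`), applied to the reference triangle and to a kite that
is folded onto the two triangles. Only the derivative of the folding map on each half enters the
bound, so the angle between the two triangles does not matter.

Finite element functions are continuous on `Ω` only, so a boundary node may carry several values,
for instance at a slit. Nodal values are therefore indexed by triangle and node, and `J` uses one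
mean for each component of the triangles at a node that are linked through edges inside `Ω`. At a
node in `Ω` there is a single component: by assumption on a surface, by connectedness of a small
circle in the plane.

Finally, a finite element function composed with a chart is locally Lipschitz. Integration by parts
for Lipschitz functions then identifies its weak gradient with the piecewise constant tangential one
(`S1.hasH1Gradient`). -/

theorem isCompact_convexHull_finset (e : Finset (E d)) : IsCompact (convexHull ℝ (e : Set (E d))) :=
  e.finite_toSet.isCompact_convexHull ℝ

theorem isCompact_tri (T : Finset (E d)) : IsCompact (tri T) := isCompact_convexHull_finset T

theorem isClosed_tri (T : Finset (E d)) : IsClosed (tri T) := (isCompact_tri T).isClosed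

theorem convexHull_subset_tri {e T : Finset (E d)} (h : e ⊆ T) :
    convexHull ℝ (e : Set (E d)) ⊆ tri T := convexHull_mono (by exact_mod_cast h)

theorem mem_tri_of_mem {T : Finset (E d)} {z : E d} (h : z ∈ T) : z ∈ tri T :=
  subset_convexHull ℝ _ h

/-- The union of all edges and nodes of the mesh. -/
def skeleton (𝒯 : Finset (Finset (E d))) : Set (E d) :=
  ⋃ T ∈ 𝒯, ⋃ e ∈ T.powerset.filter (·.card ≤ 2), convexHull ℝ (e : Set (E d))

theorem mem_skeleton {𝒯 : Finset (Finset (E d))} {x : E d} :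
    x ∈ skeleton 𝒯 ↔ ∃ T ∈ 𝒯, ∃ e ⊆ T, e.card ≤ 2 ∧ x ∈ convexHull ℝ (e : Set (E d)) := by
  simp only [skeleton, mem_iUnion, Finset.mem_filter, Finset.mem_powerset, exists_prop]
  constructor
  · rintro ⟨T, hT, e, ⟨he, hc⟩, hx⟩
    exact ⟨T, hT, e, he, hc, hx⟩
  · rintro ⟨T, hT, e, he, hc, hx⟩
    exact ⟨T, hT, e, ⟨he, hc⟩, hx⟩

theorem ResolvesBoundary.diff_subset_skeleton {Ω : Set (E d)} {𝒯 : Finset (Finset (E d))}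
    (h : ResolvesBoundary Ω 𝒯) : closure Ω \ Ω ⊆ skeleton 𝒯 := by
  obtain ⟨𝓑, h𝓑, h⟩ := h
  rw [h]
  intro x hx
  simp only [mem_iUnion] at hx
  obtain ⟨e, he, hx⟩ := hx
  obtain ⟨h2, T, hT, heT⟩ := h𝓑 e he
  exact mem_skeleton.2 ⟨T, hT, e, heT, h2, hx⟩

theorem ResolvesBoundary.isClosed {Ω : Set (E d)} {𝒯 : Finset (Finset (E d))}
    (h : ResolvesBoundary Ω 𝒯) : IsClosed (closure Ω \ Ω) := by
  obtain ⟨𝓑, h𝓑, h⟩ := h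
  rw [h]
  have hfin : 𝓑.Finite := by
    refine (𝒯.biUnion fun T => T.powerset).finite_toSet.subset fun e he => ?_
    obtain ⟨-, T, hT, heT⟩ := h𝓑 e he
    simp only [Finset.coe_biUnion, mem_iUnion, Finset.mem_coe]
    exact ⟨T, hT, Finset.mem_powerset.2 heT⟩
  exact hfin.isClosed_biUnion fun e _ => (isCompact_convexHull_finset e).isClosed

namespace IsMesh

variable {Ω : Set (E d)} {𝒯 : Finset (Finset (E d))}

theorem subset_iUnion (hM : IsMesh Ω 𝒯) : Ω ⊆ ⋃ T ∈ 𝒯, tri T := hM.cover ▸ subset_closure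

theorem tri_subset (hM : IsMesh Ω 𝒯) {T : Finset (E d)} (hT : T ∈ 𝒯) : tri T ⊆ closure Ω := by
  rw [hM.cover]
  exact subset_biUnion_of_mem (u := tri) hT

theorem exists_mem_tri (hM : IsMesh Ω 𝒯) {x : E d} (hx : x ∈ Ω) : ∃ T ∈ 𝒯, x ∈ tri T := by
  simpa using hM.subset_iUnion hx

/-- The mesh condition speaks of whole triangles only. It passes to faces because, inside one
non-degenerate triangle, taking convex hulls commutes with intersecting vertex sets; this is used
once in `T`, once in `T'`, and once more for the two resulting faces of the common face. -/
theorem convexHull_inter_convexHull (hM : IsMesh Ω 𝒯) {T T' : Finset (E d)} (hT : T ∈ 𝒯)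
    (hT' : T' ∈ 𝒯) {e f : Finset (E d)} (he : e ⊆ T) (hf : f ⊆ T') :
    convexHull ℝ (e : Set (E d)) ∩ convexHull ℝ (f : Set (E d))
      ⊆ convexHull ℝ ((e : Set (E d)) ∩ f) := by
  classical
  rintro x ⟨hxe, hxf⟩
  by_cases hTT : T = T'
  · subst hTT
    rw [(hM.nondegenerate T hT).convexHull_inter he hf]
    exact ⟨hxe, hxf⟩
  · have hx : x ∈ convexHull ℝ ((T : Set (E d)) ∩ T') :=
      hM.inter T hT T' hT' hTT ▸ ⟨convexHull_subset_tri he hxe, convexHull_subset_tri hf hxf⟩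
    rw [← Finset.coe_inter] at hx
    have h1 : x ∈ convexHull ℝ ((e ∩ (T ∩ T') : Finset (E d)) : Set (E d)) := by
      rw [Finset.coe_inter,
        (hM.nondegenerate T hT).convexHull_inter he Finset.inter_subset_left]
      exact ⟨hxe, hx⟩
    have h2 : x ∈ convexHull ℝ ((f ∩ (T ∩ T') : Finset (E d)) : Set (E d)) := by
      rw [Finset.coe_inter,
        (hM.nondegenerate T' hT').convexHull_inter hf Finset.inter_subset_right]
      exact ⟨hxf, hx⟩
    have h3 : x ∈ convexHull ℝ (((e ∩ (T ∩ T') : Finset (E d)) : Set (E d)) ∩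
        ((f ∩ (T ∩ T') : Finset (E d)) : Set (E d))) := by
      rw [(hM.nondegenerate T hT).convexHull_inter
        (Finset.inter_subset_left.trans he)
        (Finset.inter_subset_right.trans Finset.inter_subset_left)]
      exact ⟨h1, h2⟩
    refine convexHull_mono ?_ h3
    intro y hy
    simp only [Finset.coe_inter, mem_inter_iff, Finset.mem_coe] at hy ⊢
    tauto

theorem eq_of_notMem_skeleton (hM : IsMesh Ω 𝒯) {T T' : Finset (E d)} (hT : T ∈ 𝒯)
    (hT' : T' ∈ 𝒯) {x : E d} (hx : x ∉ skeleton 𝒯) (h : x ∈ tri T) (h' : x ∈ tri T') : T = T' := by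
  classical
  by_contra hne
  have h1 := hM.convexHull_inter_convexHull hT hT' subset_rfl subset_rfl ⟨h, h'⟩
  rw [← Finset.coe_inter] at h1
  refine hx (mem_skeleton.2 ⟨T, hT, T ∩ T', Finset.inter_subset_left, ?_, h1⟩)
  by_contra hc
  have h3 := hM.card_eq T hT
  have h4 := hM.card_eq T' hT'
  have e1 : T ∩ T' = T := Finset.eq_of_subset_of_card_le Finset.inter_subset_left (by omega)
  have e2 : T ∩ T' = T' := Finset.eq_of_subset_of_card_le Finset.inter_subset_right (by omega)
  exact hne (e1.symm.trans e2)

/-- A point of a triangle that lies on the skeleton lies on an edge or node of this triangle. -/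
theorem exists_face_of_mem_skeleton (hM : IsMesh Ω 𝒯) {T : Finset (E d)} (hT : T ∈ 𝒯)
    {x : E d} (hx : x ∈ skeleton 𝒯) (h : x ∈ tri T) :
    ∃ e ⊆ T, e.card ≤ 2 ∧ x ∈ convexHull ℝ (e : Set (E d)) := by
  classical
  obtain ⟨T', hT', e, he, hc, hxe⟩ := mem_skeleton.1 hx
  have h1 := hM.convexHull_inter_convexHull hT hT' subset_rfl he ⟨h, hxe⟩
  rw [← Finset.coe_inter] at h1
  exact ⟨T ∩ e, Finset.inter_subset_left, (Finset.card_le_card Finset.inter_subset_right).trans hc,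
    h1⟩

/-- A point common to two different triangles is a common node or is in the interior of a common
edge. -/
theorem mem_inter_cases (hM : IsMesh Ω 𝒯) {T T' : Finset (E d)} (hT : T ∈ 𝒯)
    (hT' : T' ∈ 𝒯) (hne : T ≠ T') {x : E d} (h : x ∈ tri T) (h' : x ∈ tri T') :
    (x ∈ T ∧ x ∈ T') ∨ ∃ y z, y ≠ z ∧ y ∈ T ∧ z ∈ T ∧ y ∈ T' ∧ z ∈ T' ∧ x ∈ openSegment ℝ y z := by
  classical
  have h1 := hM.convexHull_inter_convexHull hT hT' subset_rfl subset_rfl ⟨h, h'⟩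
  rw [← Finset.coe_inter] at h1
  have hc : (T ∩ T').card ≤ 2 := by
    by_contra hc
    have h3 := hM.card_eq T hT
    have h4 := hM.card_eq T' hT'
    have e1 : T ∩ T' = T := Finset.eq_of_subset_of_card_le Finset.inter_subset_left (by omega)
    have e2 : T ∩ T' = T' := Finset.eq_of_subset_of_card_le Finset.inter_subset_right (by omega)
    exact hne (e1.symm.trans e2)
  have hmem : ∀ y ∈ T ∩ T', y ∈ T ∧ y ∈ T' := fun y hy => Finset.mem_inter.1 hy
  generalize T ∩ T' = F at h1 hc hmem
  interval_cases hF : F.card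
  · rw [Finset.card_eq_zero] at hF
    simp [hF] at h1
  · obtain ⟨y, rfl⟩ := Finset.card_eq_one.1 hF
    simp only [Finset.coe_singleton, convexHull_singleton, mem_singleton_iff] at h1
    subst h1
    exact Or.inl (hmem _ (by simp))
  · obtain ⟨y, z, hyz, rfl⟩ := Finset.card_eq_two.1 hF
    rw [Finset.coe_pair, convexHull_pair] at h1
    have hy := hmem y (by simp)
    have hz := hmem z (by simp)
    by_cases hxy : x = y
    · exact Or.inl (hxy ▸ hy)
    by_cases hxz : x = z
    · exact Or.inl (hxz ▸ hz)
    · exact Or.inr ⟨y, z, hyz, hy.1, hz.1, hy.2, hz.2,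
        mem_openSegment_of_ne_left_right (Ne.symm hxy) (Ne.symm hxz) h1⟩

/-- A boundary piece that meets the relative interior of an edge has both end points of the edge
among its vertices: otherwise the common face would be at most one end point. Hence the boundary
swallows the closed edge as soon as it meets its relative interior. -/
theorem segment_subset_diff (hM : IsMesh Ω 𝒯) (hB : ResolvesBoundary Ω 𝒯) {T : Finset (E d)}
    (hT : T ∈ 𝒯) {y z : E d} (hyz : y ≠ z) (hy : y ∈ T) (hz : z ∈ T) {x : E d}
    (hx : x ∈ openSegment ℝ y z) (hxΩ : x ∉ Ω) : segment ℝ y z ⊆ closure Ω \ Ω := by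
  classical
  obtain ⟨𝓑, h𝓑, h⟩ := hB
  have hsub : ({y, z} : Finset (E d)) ⊆ T := by
    intro w hw
    simp only [Finset.mem_insert, Finset.mem_singleton] at hw
    rcases hw with rfl | rfl <;> assumption
  have hxs : x ∈ convexHull ℝ (({y, z} : Finset (E d)) : Set (E d)) := by
    rw [Finset.coe_pair, convexHull_pair]
    exact openSegment_subset_segment ℝ y z hx
  have hxc : x ∈ closure Ω \ Ω := ⟨hM.tri_subset hT (convexHull_subset_tri hsub hxs), hxΩ⟩
  rw [h] at hxc
  simp only [mem_iUnion] at hxc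
  obtain ⟨e, he, hxe⟩ := hxc
  obtain ⟨-, T', hT', heT'⟩ := h𝓑 e he
  have h1 := hM.convexHull_inter_convexHull hT hT' hsub heT' ⟨hxs, hxe⟩
  have hne : x ≠ y ∧ x ≠ z := by
    constructor
    · rintro rfl
      exact hyz (left_mem_openSegment_iff.1 hx)
    · rintro rfl
      exact hyz (right_mem_openSegment_iff.1 hx)
  have hboth : y ∈ e ∧ z ∈ e := by
    by_contra hcon
    have : ((({y, z} : Finset (E d)) : Set (E d)) ∩ e) ⊆ {y} ∨
        ((({y, z} : Finset (E d)) : Set (E d)) ∩ e) ⊆ {z} := by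
      by_cases hye : y ∈ e
      · left
        rintro w ⟨hw, hwe⟩
        simp only [Finset.coe_pair, mem_insert_iff, mem_singleton_iff] at hw ⊢
        rcases hw with rfl | rfl
        · rfl
        · exact absurd ⟨hye, hwe⟩ hcon
      · right
        rintro w ⟨hw, hwe⟩
        simp only [Finset.coe_pair, mem_insert_iff, mem_singleton_iff] at hw ⊢
        rcases hw with rfl | rfl
        · exact absurd hwe hye
        · rfl
    rcases this with h2 | h2
    · have := convexHull_mono h2 h1
      rw [convexHull_singleton] at this
      exact hne.1 this
    · have := convexHull_mono h2 h1
      rw [convexHull_singleton] at this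
      exact hne.2 this
  rw [h]
  intro w hw
  simp only [mem_iUnion]
  refine ⟨e, he, ?_⟩
  rw [← convexHull_pair] at hw
  refine convexHull_mono ?_ hw
  intro v hv
  simp only [mem_insert_iff, mem_singleton_iff] at hv
  rcases hv with rfl | rfl
  · exact hboth.1
  · exact hboth.2

theorem openSegment_subset_of_mem (hM : IsMesh Ω 𝒯) (hB : ResolvesBoundary Ω 𝒯)
    {T : Finset (E d)} (hT : T ∈ 𝒯) {y z : E d} (hyz : y ≠ z) (hy : y ∈ T) (hz : z ∈ T) {x : E d}
    (hx : x ∈ segment ℝ y z) (hxΩ : x ∈ Ω) : openSegment ℝ y z ⊆ Ω := by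
  intro w hw
  by_contra hwΩ
  exact (hM.segment_subset_diff hB hT hyz hy hz hw hwΩ hx).2 hxΩ

theorem mem_of_mem_tri_of_notMem_skeleton (hM : IsMesh Ω 𝒯) (hB : ResolvesBoundary Ω 𝒯)
    {T : Finset (E d)} (hT : T ∈ 𝒯) {x : E d} (h : x ∈ tri T) (hx : x ∉ skeleton 𝒯) : x ∈ Ω := by
  by_contra hxΩ
  exact hx (hB.diff_subset_skeleton ⟨hM.tri_subset hT h, hxΩ⟩)

end IsMesh

/-! ### Nodal interpolation and the finite element space -/

theorem exists_affineMap_eq {T : Finset (E d)} (hT : AffineIndependent ℝ ((↑) : T → E d))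
    (c : E d → ℝ) : ∃ A : E d →ᵃ[ℝ] ℝ, ∀ z ∈ T, A z = c z := by
  classical
  -- The vertices need not span the ambient space, so they are extended to an affine basis whose
  -- coordinates are defined everywhere.
  obtain ⟨s, hs, hsi, hst⟩ := exists_subset_affineIndependent_affineSpan_eq_top
    (s := (T : Set (E d))) hT
  let b : AffineBasis s ℝ (E d) := ⟨(↑), hsi, by rw [Subtype.range_coe]; exact hst⟩
  have hb : ∀ i : s, b i = i := fun i => rfl
  refine ⟨∑ z ∈ T.attach, c z • b.coord ⟨z, hs z.2⟩, fun z hz => ?_⟩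
  have hsum : ∀ (t : Finset T) (x : E d), (∑ z ∈ t, c z • b.coord ⟨z, hs z.2⟩ : E d →ᵃ[ℝ] ℝ) x =
      ∑ z ∈ t, c z * b.coord ⟨z, hs z.2⟩ x := by
    intro t x
    induction t using Finset.induction_on with
    | empty => simp
    | insert a t ha ih => simp [Finset.sum_insert ha, ih]
  rw [hsum]
  have hcoord : ∀ w : T, b.coord ⟨w, hs w.2⟩ z = if w = ⟨z, hz⟩ then 1 else 0 := by
    intro w
    exact (b.coord_apply ⟨w, hs w.2⟩ ⟨z, hs hz⟩).trans (by simp only [Subtype.ext_iff])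
  simp_rw [hcoord]
  simp

theorem hat_apply {T : Finset (E d)} (hT : AffineIndependent ℝ ((↑) : T → E d)) (z : E d) :
    ∀ y ∈ T, hat T z y = open Classical in if y = z then 1 else 0 := by
  classical
  obtain ⟨A, hA⟩ := exists_affineMap_eq hT (fun y => if y = z then 1 else 0)
  have : ∃ f : E d →ᵃ[ℝ] ℝ, ∀ y ∈ T, f y = if y = z then 1 else 0 := ⟨A, hA⟩
  intro y hy
  have h := Classical.epsilon_spec this y hy
  convert! h

/-- The affine function on the triangle `T` with the given nodal values. -/
noncomputable def interp (T : Finset (E d)) (c : E d → ℝ) : E d →ᵃ[ℝ] ℝ := ∑ z ∈ T, c z • hat T z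

theorem interp_apply (T : Finset (E d)) (c : E d → ℝ) (x : E d) :
    interp T c x = ∑ z ∈ T, c z * hat T z x := by
  classical
  have hsum : ∀ (t : Finset (E d)), (∑ z ∈ t, c z • hat T z : E d →ᵃ[ℝ] ℝ) x =
      ∑ z ∈ t, c z * hat T z x := by
    intro t
    induction t using Finset.induction_on with
    | empty => simp
    | insert a t ha ih => simp [Finset.sum_insert ha, ih]
  exact hsum T

theorem interp_apply_node {T : Finset (E d)} (hT : AffineIndependent ℝ ((↑) : T → E d))
    (c : E d → ℝ) {z : E d} (hz : z ∈ T) : interp T c z = c z := by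
  classical
  rw [interp_apply, Finset.sum_congr rfl fun y _ => by rw [hat_apply hT y z hz],
    Finset.sum_eq_single z]
  · simp
  · intro y _ hy
    simp [hy.symm]
  · exact fun h => absurd hz h

/-- Two affine functions that agree on a set agree on its convex hull. -/
theorem AffineMap_eqOn_convexHull {A B : E d →ᵃ[ℝ] ℝ} {s : Set (E d)} (h : ∀ z ∈ s, A z = B z)
    {x : E d} (hx : x ∈ convexHull ℝ s) : A x = B x := by
  have hc : Convex ℝ {x | A x = B x} := by
    have : {x | A x = B x} = (A - B) ⁻¹' {0} := by
      ext x
      simp [sub_eq_zero]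
    rw [this]
    exact (convex_singleton (0 : ℝ)).affine_preimage _
  exact convexHull_min h hc hx

theorem AffineMap_continuous {F : Type*} [NormedAddCommGroup F] [NormedSpace ℝ F]
    (A : E d →ᵃ[ℝ] F) : Continuous A := A.continuous_of_finiteDimensional

section FiniteElementSpace

variable {Ω : Set (E d)} {𝒯 : Finset (Finset (E d))}

theorem IsMesh.exists_mem_S1_of_eq (hM : IsMesh Ω 𝒯) (A : Finset (E d) → E d →ᵃ[ℝ] ℝ)
    (hA : ∀ T ∈ 𝒯, ∀ T' ∈ 𝒯, ∀ x ∈ Ω, x ∈ tri T → x ∈ tri T' → A T x = A T' x) :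
    ∃ V ∈ S1 Ω 𝒯, ∀ T ∈ 𝒯, ∀ x ∈ tri T ∩ Ω, V x = A T x := by
  classical
  let V : E d → ℝ := fun x => if h : ∃ T ∈ 𝒯, x ∈ tri T then A h.choose x else 0
  have hV : ∀ T ∈ 𝒯, ∀ x ∈ tri T ∩ Ω, V x = A T x := by
    rintro T hT x ⟨hx, hxΩ⟩
    have h : ∃ T ∈ 𝒯, x ∈ tri T := ⟨T, hT, hx⟩
    simp only [V, dif_pos h]
    exact hA _ h.choose_spec.1 T hT x hxΩ h.choose_spec.2 hx
  refine ⟨V, ⟨?_, fun T hT => ⟨A T, hV T hT⟩⟩, hV⟩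
  intro x hx
  have hΩ : Ω = ⋃ T ∈ (𝒯 : Set (Finset (E d))), tri T ∩ Ω := by
    ext y
    simp only [mem_iUnion, mem_inter_iff, Finset.mem_coe, exists_prop]
    constructor
    · intro hy
      obtain ⟨T, hT, h⟩ := hM.exists_mem_tri hy
      exact ⟨T, hT, h, hy⟩
    · rintro ⟨T, hT, h, hy⟩
      exact hy
  rw [ContinuousWithinAt]
  nth_rewrite 1 [hΩ]
  -- Pasting over a finite closed cover: the filter within `Ω` is the supremum of the filters within
  -- the pieces, and a triangle that misses `x` contributes `⊥`.
  rw [nhdsWithin_biUnion 𝒯.finite_toSet, Filter.tendsto_iSup]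
  intro T
  rw [Filter.tendsto_iSup]
  intro hT
  by_cases hxT : x ∈ tri T
  · have : ContinuousWithinAt V (tri T ∩ Ω) x :=
      (AffineMap_continuous (A T)).continuousWithinAt.congr (fun y hy => hV T hT y hy)
        (hV T hT x ⟨hxT, hx⟩)
    exact this
  · have : 𝓝[tri T ∩ Ω] x = ⊥ := by
      rw [← notMem_closure_iff_nhdsWithin_eq_bot]
      intro h
      exact hxT ((isClosed_tri T).closure_subset (closure_mono inter_subset_left h))
    rw [this]
    exact Filter.tendsto_bot

/-- Nodal values, which may depend on the triangle, that are consistent at the nodes in `Ω` and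
along the edges in `Ω` define a finite element function. -/
theorem IsMesh.exists_mem_S1 (hM : IsMesh Ω 𝒯) (hB : ResolvesBoundary Ω 𝒯)
    (c : Finset (E d) → E d → ℝ)
    (hnode : ∀ z ∈ Ω, ∀ T ∈ 𝒯, ∀ T' ∈ 𝒯, z ∈ T → z ∈ T' → c T z = c T' z)
    (hedge : ∀ T ∈ 𝒯, ∀ T' ∈ 𝒯, ∀ y z, y ≠ z → y ∈ T → z ∈ T → y ∈ T' → z ∈ T' →
      openSegment ℝ y z ⊆ Ω → c T y = c T' y) :
    ∃ V ∈ S1 Ω 𝒯, ∀ T ∈ 𝒯, ∀ x ∈ tri T ∩ Ω, V x = interp T (c T) x := by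
  refine hM.exists_mem_S1_of_eq _ fun T hT T' hT' x hx h h' => ?_
  by_cases hne : T = T'
  · rw [hne]
  have key : ∀ z, z ∈ T → z ∈ T' → c T z = c T' z → interp T (c T) z = interp T' (c T') z := by
    intro z hz hz' h
    rw [interp_apply_node (hM.nondegenerate T hT) _ hz,
      interp_apply_node (hM.nondegenerate T' hT') _ hz', h]
  -- A common point in `Ω` is either a node in `Ω` or interior to a common edge. In the second case
  -- the open edge lies in `Ω`, but its end points need not, which is why the edge condition is
  -- separate from the node condition.
  rcases hM.mem_inter_cases hT hT' hne h h' with ⟨h1, h2⟩ | ⟨y, z, hyz, hy, hz, hy', hz', hs⟩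
  · exact key x h1 h2 (hnode x hx T hT T' hT' h1 h2)
  · have hseg := hM.openSegment_subset_of_mem hB hT hyz hy hz (openSegment_subset_segment _ _ _ hs)
      hx
    refine AffineMap_eqOn_convexHull (s := {y, z}) ?_ ?_
    · intro w hw
      simp only [mem_insert_iff, mem_singleton_iff] at hw
      rcases hw with rfl | rfl
      · exact key _ hy hy' (hedge T hT T' hT' _ z hyz hy hz hy' hz' hseg)
      · exact key _ hz hz' (hedge T hT T' hT' _ y hyz.symm hz hy hz' hy'
          (openSegment_symm ℝ y w ▸ hseg))
    · rw [convexHull_pair]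
      exact openSegment_subset_segment _ _ _ hs

/-- The nodal values of a finite element function are consistent. -/
theorem IsMesh.nodal_eq_of_edge {V : E d → ℝ} {A : Finset (E d) → E d →ᵃ[ℝ] ℝ}
    (hA : ∀ T ∈ 𝒯, ∀ x ∈ tri T ∩ Ω, V x = A T x)
    {T T' : Finset (E d)} (hT : T ∈ 𝒯) (hT' : T' ∈ 𝒯) {y z : E d} (hy : y ∈ T) (hz : z ∈ T)
    (hy' : y ∈ T') (hz' : z ∈ T') (h : openSegment ℝ y z ⊆ Ω) : A T y = A T' y := by
  have hseg : ∀ x ∈ openSegment ℝ y z, A T x = A T' x := by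
    intro x hx
    have h1 : x ∈ tri T := (convex_convexHull ℝ _).segment_subset (mem_tri_of_mem hy)
      (mem_tri_of_mem hz) (openSegment_subset_segment _ _ _ hx)
    have h2 : x ∈ tri T' := (convex_convexHull ℝ _).segment_subset (mem_tri_of_mem hy')
      (mem_tri_of_mem hz') (openSegment_subset_segment _ _ _ hx)
    rw [← hA T hT x ⟨h1, h hx⟩, ← hA T' hT' x ⟨h2, h hx⟩]
  have hcl : IsClosed {x | A T x = A T' x} :=
    isClosed_eq (AffineMap_continuous _) (AffineMap_continuous _)
  -- The end point may lie outside `Ω`, where `V` is not prescribed, so it is reached as a limit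
  -- along the open edge.
  have : y ∈ closure (openSegment ℝ y z) := by
    rw [closure_openSegment]
    exact left_mem_segment ℝ y z
  exact closure_minimal hseg hcl this

theorem S1.exists_affine {V : E d → ℝ} (hV : V ∈ S1 Ω 𝒯) :
    ∃ A : Finset (E d) → E d →ᵃ[ℝ] ℝ, ∀ T ∈ 𝒯, ∀ x ∈ tri T ∩ Ω, V x = A T x := by
  classical
  choose! A hA using hV.2
  exact ⟨A, hA⟩

theorem IsMesh.interp_eq {A : E d →ᵃ[ℝ] ℝ} (hM : IsMesh Ω 𝒯) {T : Finset (E d)} (hT : T ∈ 𝒯)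
    {x : E d} (hx : x ∈ tri T) : interp T A x = A x :=
  AffineMap_eqOn_convexHull (fun _ hz => interp_apply_node (hM.nondegenerate T hT) _ hz) hx

end FiniteElementSpace

end P1FEM

/-! ### Affine parametrization of a triangle and its area -/

namespace P1FEM

open Set Topology

variable {d : ℕ}

/-- The linear map `ℝ² → ℝ^d` that maps the standard basis to `p`, `q`. -/
noncomputable def edgeMap (p q : E d) : E 2 →L[ℝ] E d :=
  (EuclideanSpace.proj (0 : Fin 2)).smulRight p + (EuclideanSpace.proj (1 : Fin 2)).smulRight q

@[simp] theorem edgeMap_apply (p q : E d) (y : E 2) : edgeMap p q y = y 0 • p + y 1 • q := by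
  simp [edgeMap]

/-- The affine parametrization of the plane through `a` spanned by `p` and `q`. -/
noncomputable def para (a p q : E d) (y : E 2) : E d := a + edgeMap p q y

theorem para_apply (a p q : E d) (y : E 2) : para a p q y = a + (y 0 • p + y 1 • q) := by
  simp [para]

theorem hasFDerivAt_para (a p q : E d) (y : E 2) : HasFDerivAt (para a p q) (edgeMap p q) y :=
  (edgeMap p q).hasFDerivAt.const_add a

theorem para_sub_para (a p q : E d) (x y : E 2) :
    para a p q x - para a p q y = edgeMap p q (x - y) := by
  rw [map_sub]; simp only [para]; abel

theorem edgeMap_injective {p q : E d} (h : LinearIndependent ℝ ![p, q]) :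
    Function.Injective (edgeMap p q) := by
  rw [injective_iff_map_eq_zero]
  intro y hy
  rw [edgeMap_apply] at hy
  have := (LinearIndependent.pair_iff.1 h) (y 0) (y 1) hy
  ext i
  fin_cases i
  · exact this.1
  · exact this.2

theorem measurableEmbedding_para {p q : E d} (a : E d) (h : LinearIndependent ℝ ![p, q]) :
    MeasurableEmbedding (para a p q) := by
  have h1 : IsClosedEmbedding (edgeMap p q) :=
    LinearMap.isClosedEmbedding_of_injective
      (f := (edgeMap p q : E 2 →ₗ[ℝ] E d)) (LinearMap.ker_eq_bot.2 (edgeMap_injective h))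
  exact ((Homeomorph.addLeft a).isClosedEmbedding.comp h1).measurableEmbedding

/-- The area of the parallelogram spanned by `p` and `q`. -/
noncomputable def parArea (p q : E d) : ℝ := (edgeMap p q : E 2 →ₗ[ℝ] E d).normDet

theorem parArea_nonneg (p q : E d) : 0 ≤ parArea p q := LinearMap.normDet_nonneg _

theorem parArea_sq (p q : E d) :
    parArea p q ^ 2 = ‖p‖ ^ 2 * ‖q‖ ^ 2 - inner ℝ p q ^ 2 := by
  have h := LinearMap.normDet_sq_eq_det_gram (edgeMap p q : E 2 →ₗ[ℝ] E d)
    (EuclideanSpace.basisFun (Fin 2) ℝ)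
  rw [Matrix.det_fin_two] at h
  simp only [Matrix.gram_apply, ContinuousLinearMap.coe_coe, edgeMap_apply,
    EuclideanSpace.basisFun_apply] at h
  simp only [PiLp.single_apply] at h
  simp at h
  rw [parArea, h, real_inner_comm p q]
  ring

theorem parArea_pos {p q : E d} (h : LinearIndependent ℝ ![p, q]) : 0 < parArea p q := by
  refine lt_of_le_of_ne (parArea_nonneg p q) (Ne.symm ?_)
  exact ((LinearMap.normDet_ne_zero_tfae (edgeMap p q : E 2 →ₗ[ℝ] E d)).out 4 0).1
    (edgeMap_injective h)

theorem parArea_le (p q : E d) {r : ℝ} (hp : ‖p‖ ≤ r) (hq : ‖q‖ ≤ r) : parArea p q ≤ r ^ 2 := by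
  have hr : 0 ≤ r := (norm_nonneg p).trans hp
  refine abs_le_of_sq_le_sq' ?_ (by positivity) |>.2
  rw [parArea_sq]
  have h1 : ‖p‖ ^ 2 ≤ r ^ 2 := by gcongr
  have h2 : ‖q‖ ^ 2 ≤ r ^ 2 := by gcongr
  nlinarith [sq_nonneg (inner ℝ p q), mul_le_mul h1 h2 (by positivity) (by positivity)]

theorem norm_sq_E2 (y : E 2) : ‖y‖ ^ 2 = y 0 ^ 2 + y 1 ^ 2 := by
  rw [EuclideanSpace.real_norm_sq_eq, Fin.sum_univ_two]

theorem norm_sq_edgeMap (p q : E d) (y : E 2) :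
    ‖edgeMap p q y‖ ^ 2 =
      y 0 ^ 2 * ‖p‖ ^ 2 + 2 * (y 0 * y 1 * inner ℝ p q) + y 1 ^ 2 * ‖q‖ ^ 2 := by
  rw [edgeMap_apply, norm_add_sq_real, norm_smul, norm_smul, real_inner_smul_left,
    real_inner_smul_right, mul_pow, mul_pow, Real.norm_eq_abs, Real.norm_eq_abs, sq_abs, sq_abs]
  ring

/-- Quantitative injectivity of the edge map. For the Gram matrix `G` of `p, q`, Cayley–Hamilton
gives `tr G · yᵀGy - det G · |y|² = |Gy|² ≥ 0`, and `tr G ≤ 2r²`. The squares handed to `nlinarith`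
are the two components of `Gy`. -/
theorem parArea_mul_norm_le (p q : E d) {r : ℝ} (hp : ‖p‖ ≤ r) (hq : ‖q‖ ≤ r) (y : E 2) :
    parArea p q * ‖y‖ ≤ 2 * r * ‖edgeMap p q y‖ := by
  have hr : 0 ≤ r := (norm_nonneg p).trans hp
  refine abs_le_of_sq_le_sq' ?_ (by positivity) |>.2
  rw [mul_pow, mul_pow, parArea_sq, norm_sq_E2]
  have h1 : ‖p‖ ^ 2 ≤ r ^ 2 := by gcongr
  have h2 : ‖q‖ ^ 2 ≤ r ^ 2 := by gcongr
  have h3 : (‖p‖ ^ 2 * ‖q‖ ^ 2 - inner ℝ p q ^ 2) * (y 0 ^ 2 + y 1 ^ 2) ≤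
      (‖p‖ ^ 2 + ‖q‖ ^ 2) * ‖edgeMap p q y‖ ^ 2 := by
    rw [norm_sq_edgeMap]
    nlinarith [sq_nonneg (y 0 * ‖p‖ ^ 2 + y 1 * inner ℝ p q),
      sq_nonneg (y 0 * inner ℝ p q + y 1 * ‖q‖ ^ 2)]
  nlinarith [mul_le_mul_of_nonneg_right (add_le_add h1 h2) (sq_nonneg ‖edgeMap p q y‖),
    mul_nonneg (sq_nonneg r) (sq_nonneg ‖edgeMap p q y‖)]

theorem abs_coord_le_norm (y : E 2) (i : Fin 2) : |y i| ≤ ‖y‖ := by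
  simpa using PiLp.norm_apply_le y i

theorem norm_edgeMap_le (p q : E d) {r : ℝ} (hp : ‖p‖ ≤ r) (hq : ‖q‖ ≤ r) (y : E 2) :
    ‖edgeMap p q y‖ ≤ 2 * r * ‖y‖ := by
  rw [edgeMap_apply]
  refine (norm_add_le _ _).trans ?_
  rw [norm_smul, norm_smul, Real.norm_eq_abs, Real.norm_eq_abs]
  have h1 := mul_le_mul (abs_coord_le_norm y 0) hp (norm_nonneg _) (norm_nonneg _)
  have h2 := mul_le_mul (abs_coord_le_norm y 1) hq (norm_nonneg _) (norm_nonneg _)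
  linarith

theorem measure_para_image (a p q : E d) (S : Set (E 2)) :
    μHE[2] (para a p q '' S) = ENNReal.ofReal (parArea p q) * volume S := by
  have h : para a p q '' S = (IsometryEquiv.addLeft a) '' ((edgeMap p q : E 2 →ₗ[ℝ] E d) '' S) := by
    rw [image_image]
    rfl
  rw [h, (IsometryEquiv.addLeft a).isometry.euclideanHausdorffMeasure_image]
  have := LinearMap.euclideanHausdorffMeasure_image_eq_normDet_mul_volume
    (edgeMap p q : E 2 →ₗ[ℝ] E d) S
  rw [finrank_euclideanSpace_fin] at this
  exact this

theorem restrict_para_image {p q : E d} (a : E d) (h : LinearIndependent ℝ ![p, q])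
    (S : Set (E 2)) :
    (μHE[2]).restrict (para a p q '' S) =
      ENNReal.ofReal (parArea p q) • (volume.restrict S).map (para a p q) := by
  ext B hB
  rw [Measure.restrict_apply hB, Measure.smul_apply, smul_eq_mul,
    (measurableEmbedding_para a h).map_apply,
    Measure.restrict_apply ((measurableEmbedding_para a h).measurable hB),
    ← measure_para_image a, image_preimage_inter]

theorem setIntegral_para_image {p q : E d} (a : E d) (h : LinearIndependent ℝ ![p, q])
    (S : Set (E 2)) (f : E d → ℝ) :
    ∫ x in para a p q '' S, f x ∂μHE[2] = parArea p q * ∫ y in S, f (para a p q y) := by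
  rw [restrict_para_image a h, integral_smul_measure, (measurableEmbedding_para a h).integral_map,
    ENNReal.toReal_ofReal (parArea_nonneg p q), smul_eq_mul]

theorem memLp_para_image_iff {F : Type*} [NormedAddCommGroup F] {p q : E d} (a : E d)
    (h : LinearIndependent ℝ ![p, q]) (S : Set (E 2)) {f : E d → F} {r : ENNReal} :
    MemLp f r ((μHE[2]).restrict (para a p q '' S)) ↔
      MemLp (f ∘ para a p q) r (volume.restrict S) := by
  rw [restrict_para_image a h]
  have h0 : ENNReal.ofReal (parArea p q) ≠ 0 := by simpa using parArea_pos h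
  constructor
  · intro hf
    have := hf.smul_measure (c := (ENNReal.ofReal (parArea p q))⁻¹) (by simpa using h0)
    rw [smul_smul, ENNReal.inv_mul_cancel h0 (by simp), one_smul] at this
    exact (measurableEmbedding_para a h).memLp_map_measure_iff.1 this
  · intro hf
    exact ((measurableEmbedding_para a h).memLp_map_measure_iff.2 hf).smul_measure (by simp)

/-- The closed reference triangle. -/
def refTri : Set (E 2) := {y | 0 ≤ y 0 ∧ 0 ≤ y 1 ∧ y 0 + y 1 ≤ 1}

/-- The open reference triangle. -/
def refOpen : Set (E 2) := {y | 0 < y 0 ∧ 0 < y 1 ∧ y 0 + y 1 < 1}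

theorem continuous_coord (i : Fin 2) : Continuous fun y : E 2 => y i :=
  (EuclideanSpace.proj (𝕜 := ℝ) i).continuous

theorem isOpen_refOpen : IsOpen refOpen :=
  (isOpen_lt continuous_const (continuous_coord 0)).inter
    ((isOpen_lt continuous_const (continuous_coord 1)).inter
      (isOpen_lt ((continuous_coord 0).add (continuous_coord 1)) continuous_const))

theorem isClosed_refTri : IsClosed refTri :=
  (isClosed_le continuous_const (continuous_coord 0)).inter
    ((isClosed_le continuous_const (continuous_coord 1)).inter
      (isClosed_le ((continuous_coord 0).add (continuous_coord 1)) continuous_const))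

theorem refOpen_subset : refOpen ⊆ refTri := fun _ h => ⟨h.1.le, h.2.1.le, h.2.2.le⟩

theorem norm_le_of_abs_le {y : E 2} {r : ℝ} (h0 : |y 0| ≤ r) (h1 : |y 1| ≤ r) : ‖y‖ ≤ 2 * r := by
  have hr : 0 ≤ r := (abs_nonneg _).trans h0
  refine abs_le_of_sq_le_sq' ?_ (by positivity) |>.2
  rw [norm_sq_E2]
  have := sq_le_sq' (neg_le_of_abs_le h0) (le_of_abs_le h0)
  have := sq_le_sq' (neg_le_of_abs_le h1) (le_of_abs_le h1)
  nlinarith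

theorem refTri_subset_closedBall : refTri ⊆ Metric.closedBall 0 2 := by
  rintro y ⟨h0, h1, h2⟩
  rw [mem_closedBall_zero_iff]
  have := norm_le_of_abs_le (y := y) (r := 1) (by rw [abs_le]; constructor <;> linarith)
    (by rw [abs_le]; constructor <;> linarith)
  linarith

theorem isCompact_refTri : IsCompact refTri :=
  (isCompact_closedBall (0 : E 2) 2).of_isClosed_subset isClosed_refTri refTri_subset_closedBall

theorem volume_refTri_lt_top : volume refTri < ⊤ := isCompact_refTri.measure_lt_top

theorem refOpen_nonempty : refOpen.Nonempty := ⟨!₂[1/4, 1/4], by norm_num [refOpen]⟩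

theorem volume_refOpen_pos : 0 < volume refOpen := isOpen_refOpen.measure_pos _ refOpen_nonempty

theorem volume_level_eq_zero (f : E 2 →L[ℝ] ℝ) (hf : f ≠ 0) (c : ℝ) :
    volume {y | f y = c} = 0 := by
  let s : AffineSubspace ℝ (E 2) :=
    { carrier := {y | f y = c}
      smul_vsub_vadd_mem' := by
        intro t x y z hx hy hz
        simp only [mem_ofPred_eq] at hx hy hz ⊢
        simp [hx, hy, hz] }
  refine Measure.addHaar_affineSubspace volume s ?_
  intro hs
  apply hf
  have hall : ∀ y, f y = c := fun y => by
    have : y ∈ s := hs ▸ AffineSubspace.mem_top ℝ (E 2) y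
    exact this
  have hc : c = 0 := by rw [← hall 0, map_zero]
  ext y
  simp [hall, hc]

theorem refOpen_ae_eq_refTri : refOpen =ᵐ[volume] refTri := by
  refine Filter.EventuallyLE.antisymm refOpen_subset.eventuallyLE ?_
  rw [ae_le_set]
  have h0 := volume_level_eq_zero (EuclideanSpace.proj (0 : Fin 2)) (fun h => by
    simpa using congrArg (fun f => f (EuclideanSpace.single 0 1)) h) 0
  have h1 := volume_level_eq_zero (EuclideanSpace.proj (1 : Fin 2)) (fun h => by
    simpa using congrArg (fun f => f (EuclideanSpace.single 1 1)) h) 0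
  have h2 := volume_level_eq_zero
    (EuclideanSpace.proj (0 : Fin 2) + EuclideanSpace.proj (1 : Fin 2)) (fun h => by
    simpa using congrArg (fun f => f (EuclideanSpace.single 1 1)) h) 1
  refine measure_mono_null ?_ (measure_union_null h0 (measure_union_null h1 h2))
  rintro y ⟨⟨h0, h1, h2⟩, hn⟩
  simp only [mem_union, mem_ofPred_eq, add_apply, PiLp.proj_apply]
  by_contra hc
  push Not at hc
  exact hn ⟨lt_of_le_of_ne h0 (Ne.symm hc.1), lt_of_le_of_ne h1 (Ne.symm hc.2.1),
    lt_of_le_of_ne h2 hc.2.2⟩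

/-- The area of the reference triangle. -/
noncomputable def refArea : ℝ := volume.real refTri

theorem refArea_pos : 0 < refArea :=
  ENNReal.toReal_pos (volume_refOpen_pos.trans_le (measure_mono refOpen_subset)).ne'
    volume_refTri_lt_top.ne

theorem tri_eq_para_image {a b c : E d} (hab : a ≠ b) (hac : a ≠ c) (hbc : b ≠ c) :
    tri {a, b, c} = para a (b - a) (c - a) '' refTri := by
  ext x
  rw [tri, Finset.mem_convexHull']
  constructor
  · rintro ⟨w, h0, h1, h2⟩
    rw [Finset.sum_insert (by simp [hab, hac]), Finset.sum_pair hbc] at h1 h2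
    refine ⟨!₂[w b, w c], ⟨?_, ?_, ?_⟩, ?_⟩
    · exact h0 b (by simp)
    · exact h0 c (by simp)
    · have := h0 a (by simp)
      simp
      linarith
    · rw [para_apply, ← h2]
      have : w a = 1 - w b - w c := by linarith
      simp only [this]
      simp
      module
  · rintro ⟨y, ⟨h0, h1, h2⟩, rfl⟩
    refine ⟨fun z => if z = a then 1 - y 0 - y 1 else if z = b then y 0 else y 1, ?_, ?_, ?_⟩
    · intro z hz
      dsimp only
      split_ifs <;> linarith
    · rw [Finset.sum_insert (by simp [hab, hac]), Finset.sum_pair hbc]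
      simp [hab.symm, hac.symm, hbc.symm]
    · rw [Finset.sum_insert (by simp [hab, hac]), Finset.sum_pair hbc, para_apply]
      simp [hab.symm, hac.symm, hbc.symm]
      module

theorem linearIndependent_edges {T : Finset (E d)} (hT : AffineIndependent ℝ ((↑) : T → E d))
    {a b c : E d} (ha : a ∈ T) (hb : b ∈ T) (hc : c ∈ T) (hab : a ≠ b) (hac : a ≠ c)
    (hbc : b ≠ c) : LinearIndependent ℝ ![b - a, c - a] := by
  have h := hT.comp_embedding (f := ⟨![⟨a, ha⟩, ⟨b, hb⟩, ⟨c, hc⟩], by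
    intro i j hij
    fin_cases i <;> fin_cases j <;> simp_all [Subtype.ext_iff, eq_comm]⟩)
  have h2 := (affineIndependent_iff_linearIndependent_vsub ℝ _ (0 : Fin 3)).1 h
  have h3 := h2.comp (![⟨1, by simp⟩, ⟨2, by simp⟩] : Fin 2 → {x : Fin 3 // x ≠ 0}) (by
    intro i j hij
    fin_cases i <;> fin_cases j <;> simp_all [Subtype.ext_iff])
  convert! h3 using 1
  funext i
  fin_cases i <;> rfl

/-- A set of finite one-dimensional Hausdorff measure, here the length, is null in dimension two. -/
theorem measure_segment_eq_zero (x y : E d) : μHE[2] (segment ℝ x y) = 0 := by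
  refine (Measure.euclideanHausdorffMeasure_zero_or_top (d₁ := 1) (d₂ := 2) (by norm_num) _).resolve_right ?_
  have h : μH[((1 : ℕ) : ℝ)] (segment ℝ x y) = edist x y := by
    rw [Nat.cast_one, hausdorffMeasure_segment]
  rw [Measure.euclideanHausdorffMeasure_def, Measure.smul_apply, h]
  exact ENNReal.mul_ne_top (by simp) (edist_ne_top x y)

theorem measure_convexHull_eq_zero {e : Finset (E d)} (he : e.card ≤ 2) :
    μHE[2] (convexHull ℝ (e : Set (E d))) = 0 := by
  classical
  interval_cases h : e.card
  · rw [Finset.card_eq_zero] at h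
    simp [h]
  · obtain ⟨x, rfl⟩ := Finset.card_eq_one.1 h
    simpa [segment_same] using measure_segment_eq_zero x x
  · obtain ⟨x, y, -, rfl⟩ := Finset.card_eq_two.1 h
    rw [Finset.coe_pair, convexHull_pair]
    exact measure_segment_eq_zero x y

theorem measure_skeleton (𝒯 : Finset (Finset (E d))) : μHE[2] (skeleton 𝒯) = 0 := by
  refine (measure_biUnion_null_iff 𝒯.countable_toSet).2 fun T _ =>
    (measure_biUnion_null_iff (Finset.countable_toSet _)).2 fun e he => ?_
  simp only [Finset.coe_filter, mem_ofPred_eq] at he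
  exact measure_convexHull_eq_zero he.2

end P1FEM

/-! ### Weak derivatives on convex planar sets and Poincaré by differences -/

namespace P1FEM

open Set Topology

/-- `k` is the weak derivative of `w` in direction `h` on the open set `U`. -/
def HasWeakDirDeriv (U : Set (E 2)) (w k : E 2 → ℝ) (h : E 2) : Prop :=
  ∀ φ : E 2 → ℝ, ContDiff ℝ ∞ φ → HasCompactSupport φ → tsupport φ ⊆ U →
    ∫ y in U, w y * fderiv ℝ φ y h = - ∫ y in U, k y * φ y

/-- Makes `(t, x) ↦ k (x + t • h)` jointly integrable for a merely integrable `k`, as needed for the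
exchanges of integrals in `t` and `x`. -/
theorem measurePreserving_shear (h : E 2) :
    MeasurePreserving (fun p : ℝ × E 2 => (p.1, p.2 + p.1 • h))
      ((volume.restrict (Icc (0 : ℝ) 1)).prod volume)
      ((volume.restrict (Icc (0 : ℝ) 1)).prod volume) := by
  refine (MeasurePreserving.id _).skew_product (g := fun t x => x + t • h) ?_ ?_
  · exact (Continuous.measurable (by fun_prop))
  · exact ae_of_all _ fun t => map_add_right_eq_self volume (t • h)

theorem integrable_shear {k : E 2 → ℝ} (hk : Integrable k) (h : E 2) :
    Integrable (fun p : ℝ × E 2 => k (p.2 + p.1 • h))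
      ((volume.restrict (Icc (0 : ℝ) 1)).prod volume) := by
  have h1 : Integrable (fun p : ℝ × E 2 => k p.2)
      ((volume.restrict (Icc (0 : ℝ) 1)).prod volume) := hk.comp_snd _
  exact (measurePreserving_shear h).integrable_comp_of_integrable h1

theorem sub_eq_integral_fderiv {φ : E 2 → ℝ} (hφ : ContDiff ℝ ∞ φ) (x h : E 2) :
    φ (x - h) - φ x = - ∫ t in Icc (0 : ℝ) 1, fderiv ℝ φ (x - t • h) h := by
  have hd : ∀ t ∈ uIcc (0 : ℝ) 1, HasDerivAt (fun t : ℝ => φ (x - t • h))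
      (-(fderiv ℝ φ (x - t • h) h)) t := by
    intro t _
    have h1 : HasDerivAt (fun t : ℝ => x - t • h) (-h) t := by
      simpa using ((hasDerivAt_id t).smul_const h).const_sub x
    have h2 := ((hφ.differentiable (by simp)) (x - t • h)).hasFDerivAt.comp_hasDerivAt t h1
    simp only [map_neg] at h2
    exact h2
  have hc : Continuous fun t : ℝ => -(fderiv ℝ φ (x - t • h) h) := by
    have := hφ.continuous_fderiv (by simp)
    fun_prop
  have := intervalIntegral.integral_eq_sub_of_hasDerivAt hd (hc.intervalIntegrable _ _)
  rw [intervalIntegral.integral_of_le zero_le_one, ← integral_Icc_eq_integral_Ioc,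
    integral_neg] at this
  simp only [one_smul, zero_smul, sub_zero] at this
  exact this.symm

theorem exists_norm_le_of_hasCompactSupport {F : Type*} [NormedAddCommGroup F] {f : E 2 → F}
    (hf : Continuous f) (hs : HasCompactSupport f) : ∃ M, ∀ x, ‖f x‖ ≤ M :=
  hf.bounded_above_of_compact_support hs

/-- The fundamental theorem of calculus by duality. Against a test function `φ` supported in `U ∩ (U
- h)`, the difference moves onto `φ`, where `φ (x - h) - φ x` is minus the integral of the
derivatives at `x - t • h`. The weak derivative applies to each translate of `φ`, and translating
back gives `k (x + t • h)`. -/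
theorem HasWeakDirDeriv.ae_sub_eq {U : Set (E 2)} (hU : IsOpen U) (hc : Convex ℝ U)
    {w k : E 2 → ℝ} {h : E 2} (hw : IntegrableOn w U) (hk : IntegrableOn k U)
    (H : HasWeakDirDeriv U w k h) :
    ∀ᵐ x : E 2, x ∈ U ∩ {x | x + h ∈ U} →
      U.indicator w (x + h) - U.indicator w x =
        ∫ t in Icc (0 : ℝ) 1, U.indicator k (x + t • h) := by
  set w₀ := U.indicator w with hw₀
  set k₀ := U.indicator k with hk₀
  have hw₀i : Integrable w₀ := (integrable_indicator_iff hU.measurableSet).2 hw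
  have hk₀i : Integrable k₀ := (integrable_indicator_iff hU.measurableSet).2 hk
  have hV : IsOpen (U ∩ {x | x + h ∈ U}) :=
    hU.inter (hU.preimage (continuous_id.add continuous_const))
  have hshear := integrable_shear hk₀i h
  have hGi : Integrable fun x => ∫ t in Icc (0 : ℝ) 1, k₀ (x + t • h) :=
    hshear.integral_prod_right
  have key := hV.ae_eq_zero_of_integral_contDiff_smul_eq_zero (μ := volume)
    (f := fun x => (w₀ (x + h) - w₀ x) - ∫ t in Icc (0 : ℝ) 1, k₀ (x + t • h))
    ((((hw₀i.comp_add_right h).sub hw₀i).sub hGi).locallyIntegrable.locallyIntegrableOn _) ?_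
  · filter_upwards [key] with x hx hxV
    exact sub_eq_zero.1 (hx hxV)
  intro φ hφ hφs hφV
  obtain ⟨M, hM⟩ := exists_norm_le_of_hasCompactSupport hφ.continuous hφs
  have hDc : Continuous fun x => fderiv ℝ φ x h := by
    have := hφ.continuous_fderiv (by simp)
    fun_prop
  have hDs : HasCompactSupport fun x => fderiv ℝ φ x h := hφs.fderiv_apply (𝕜 := ℝ) h
  obtain ⟨M', hM'⟩ := exists_norm_le_of_hasCompactSupport hDc hDs
  have hmul : ∀ {f : E 2 → ℝ}, Integrable f → Integrable fun x => φ x * f x := fun hf =>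
    hf.bdd_mul hφ.continuous.aestronglyMeasurable (ae_of_all _ hM)
  have hmulh : ∀ {f : E 2 → ℝ}, Integrable f → Integrable fun x => φ (x - h) * f x := fun hf =>
    hf.bdd_mul (hφ.continuous.comp (continuous_id.sub continuous_const)).aestronglyMeasurable
      (ae_of_all _ fun x => hM _)
  have e1 : ∫ x, φ x * (w₀ (x + h) - w₀ x) = ∫ x, w₀ x * (φ (x - h) - φ x) := by
    have a1 : ∫ x, φ x * w₀ (x + h) = ∫ x, φ (x - h) * w₀ x := by
      rw [← integral_add_right_eq_self (μ := volume) (fun x => φ (x - h) * w₀ x) h]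
      simp
    simp_rw [mul_sub]
    rw [integral_sub (hmul (hw₀i.comp_add_right h)) (hmul hw₀i), a1,
      integral_sub (by simpa [mul_comm] using hmulh hw₀i) (by simpa [mul_comm] using hmul hw₀i)]
    simp_rw [mul_comm (w₀ _)]
  have hFub1 : Integrable (fun p : E 2 × ℝ => w₀ p.1 * fderiv ℝ φ (p.1 - p.2 • h) h)
      (volume.prod (volume.restrict (Icc (0 : ℝ) 1))) := by
    have h1 : Integrable (fun p : E 2 × ℝ => w₀ p.1)
      (volume.prod (volume.restrict (Icc (0 : ℝ) 1))) := hw₀i.comp_fst _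
    refine h1.mul_bdd (c := M') ?_ (ae_of_all _ fun p => hM' _)
    exact (hDc.comp (by fun_prop : Continuous fun p : E 2 × ℝ => p.1 - p.2 • h)).aestronglyMeasurable
  have e2 : ∫ x, w₀ x * (φ (x - h) - φ x) =
      - ∫ t in Icc (0 : ℝ) 1, ∫ x, w₀ x * fderiv ℝ φ (x - t • h) h := by
    rw [← integral_integral_swap hFub1, ← integral_neg]
    congr 1
    ext x
    rw [sub_eq_integral_fderiv hφ, integral_const_mul, mul_neg]
  have e3 : ∀ t ∈ Icc (0 : ℝ) 1, ∫ x, w₀ x * fderiv ℝ φ (x - t • h) h =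
      - ∫ x, φ x * k₀ (x + t • h) := by
    intro t ht
    have hsub : HasCompactSupport fun x => φ (x - t • h) :=
      hφs.comp_homeomorph (Homeomorph.subRight (t • h))
    -- Convexity enters only here: if `x - t • h` and `x - t • h + h` lie in `U`, then so does `x`,
    -- which is between them.
    have hsupp : tsupport (fun x => φ (x - t • h)) ⊆ U := by
      intro x hx
      have hx' : x - t • h ∈ tsupport φ :=
        tsupport_comp_subset_preimage φ (f := fun x => x - t • h) (by fun_prop) hx
      have h1 := hφV hx'
      have := hc h1.1 h1.2 (sub_nonneg.2 ht.2) ht.1 (by ring)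
      convert! this using 1
      module
    have := H (fun x => φ (x - t • h)) (hφ.comp (contDiff_id.sub contDiff_const)) hsub hsupp
    have hfd : ∀ x, fderiv ℝ (fun x => φ (x - t • h)) x h = fderiv ℝ φ (x - t • h) h := by
      intro x
      have := ((hφ.differentiable (by simp)) (x - t • h)).hasFDerivAt.comp x
        ((hasFDerivAt_id x).sub_const (t • h))
      exact congrArg (fun L => L h) this.fderiv
    simp_rw [hfd] at this
    rw [← integral_indicator hU.measurableSet, ← integral_indicator hU.measurableSet] at this
    have i1 : (U.indicator fun y => w y * fderiv ℝ φ (y - t • h) h) =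
        fun y => w₀ y * fderiv ℝ φ (y - t • h) h := by
      ext y
      simp only [hw₀, indicator]
      split_ifs <;> simp
    have i2 : (U.indicator fun y => k y * φ (y - t • h)) =
        fun y => k₀ y * φ (y - t • h) := by
      ext y
      simp only [hk₀, indicator]
      split_ifs <;> simp
    rw [i1, i2] at this
    rw [this, ← integral_add_right_eq_self (μ := volume) (fun x => k₀ x * φ (x - t • h)) (t • h)]
    simp [mul_comm]
  have hFub2 : Integrable (fun p : ℝ × E 2 => φ p.2 * k₀ (p.2 + p.1 • h))
      ((volume.restrict (Icc (0 : ℝ) 1)).prod volume) :=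
    hshear.bdd_mul (hφ.continuous.comp continuous_snd).aestronglyMeasurable
      (ae_of_all _ fun p => hM _)
  have e4 : ∫ t in Icc (0 : ℝ) 1, ∫ x, φ x * k₀ (x + t • h) =
      ∫ x, φ x * ∫ t in Icc (0 : ℝ) 1, k₀ (x + t • h) := by
    rw [integral_integral_swap hFub2]
    congr 1
    ext x
    rw [integral_const_mul]
  simp only [smul_eq_mul]
  simp_rw [mul_sub (φ _) (w₀ _ - w₀ _)]
  have hi := hmul ((hw₀i.comp_add_right h).sub hw₀i)
  simp only [Pi.sub_apply] at hi
  rw [integral_sub hi (hmul hGi), e1, e2, setIntegral_congr_fun measurableSet_Icc e3, integral_neg, neg_neg, e4, sub_self]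

theorem enorm_integral_sq_le {μ : Measure ℝ} [IsProbabilityMeasure μ] {f : ℝ → ℝ}
    (hf : AEStronglyMeasurable f μ) : ‖∫ t, f t ∂μ‖ₑ ^ 2 ≤ ∫⁻ t, ‖f t‖ₑ ^ 2 ∂μ := by
  have h1 : ‖∫ t, f t ∂μ‖ₑ ≤ eLpNorm f 1 μ := by
    rw [eLpNorm_one_eq_lintegral_enorm]
    exact enorm_integral_le_lintegral_enorm f
  have h2 : eLpNorm f 1 μ ≤ eLpNorm f 2 μ := eLpNorm_le_eLpNorm_of_exponent_le (by norm_num) hf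
  have h3 : eLpNorm f 2 μ ^ 2 = ∫⁻ t, ‖f t‖ₑ ^ 2 ∂μ := by
    have := eLpNorm_nnreal_pow_eq_lintegral (f := f) (μ := μ) (p := 2) (by norm_num)
    simpa using this
  rw [← h3]
  gcongr
  exact h1.trans h2

/-- Jensen's inequality in `t`, then translation invariance for each fixed `t`; extending `k` by
zero allows integration over the whole plane, so the constant is one. -/
theorem HasWeakDirDeriv.lintegral_sub_sq_le {U : Set (E 2)} (hU : IsOpen U) (hc : Convex ℝ U)
    {w k : E 2 → ℝ} {h : E 2} (hw : IntegrableOn w U) (hk : IntegrableOn k U)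
    (H : HasWeakDirDeriv U w k h) :
    ∫⁻ x in U ∩ {x | x + h ∈ U}, ‖w (x + h) - w x‖ₑ ^ 2 ≤ ∫⁻ x in U, ‖k x‖ₑ ^ 2 := by
  have hk₀i : Integrable (U.indicator k) := (integrable_indicator_iff hU.measurableSet).2 hk
  have hVm : MeasurableSet (U ∩ {x | x + h ∈ U}) :=
    (hU.inter (hU.preimage (continuous_id.add continuous_const))).measurableSet
  have hshear := integrable_shear hk₀i h
  have : IsProbabilityMeasure (volume.restrict (Icc (0 : ℝ) 1)) := ⟨by simp⟩
  have hae : ∀ᵐ x ∂(volume : Measure (E 2)),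
      AEStronglyMeasurable (fun t : ℝ => U.indicator k (x + t • h))
        (volume.restrict (Icc (0 : ℝ) 1)) := by
    filter_upwards [hshear.prod_left_ae] with x hx using hx.aestronglyMeasurable
  calc ∫⁻ x in U ∩ {x | x + h ∈ U}, ‖w (x + h) - w x‖ₑ ^ 2
      ≤ ∫⁻ x in U ∩ {x | x + h ∈ U}, ∫⁻ t in Icc (0 : ℝ) 1, ‖U.indicator k (x + t • h)‖ₑ ^ 2 := by
        refine setLIntegral_mono_ae' hVm ?_
        filter_upwards [H.ae_sub_eq hU hc hw hk, hae] with x hx hxm hxV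
        have h1 := hx hxV
        have hx2 : x + h ∈ U := hxV.2
        rw [indicator_of_mem hx2, indicator_of_mem hxV.1] at h1
        rw [h1]
        exact enorm_integral_sq_le hxm
    _ ≤ ∫⁻ x, ∫⁻ t in Icc (0 : ℝ) 1, ‖U.indicator k (x + t • h)‖ₑ ^ 2 := setLIntegral_le_lintegral _ _
    _ = ∫⁻ t in Icc (0 : ℝ) 1, ∫⁻ x, ‖U.indicator k (x + t • h)‖ₑ ^ 2 := by
        refine lintegral_lintegral_swap ?_
        exact (hshear.aestronglyMeasurable.prod_swap.enorm.pow_const 2)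
    _ = ∫⁻ t in Icc (0 : ℝ) 1, ∫⁻ x in U, ‖k x‖ₑ ^ 2 := by
        congr 1
        ext t
        rw [lintegral_add_right_eq_self (μ := volume) (fun x => ‖U.indicator k x‖ₑ ^ 2) (t • h),
          ← lintegral_indicator hU.measurableSet]
        congr 1
        ext x
        simp only [indicator]
        split_ifs <;> simp
    _ = ∫⁻ x in U, ‖k x‖ₑ ^ 2 := by simp

/-- The Poincaré inequality on bounded convex sets, in terms of differences. -/
theorem lintegral_lintegral_sub_sq_le {U : Set (E 2)} (hU : IsOpen U) (hc : Convex ℝ U) {R : ℝ}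
    (hR : U ⊆ Metric.closedBall 0 R) {w b : E 2 → ℝ} {k : E 2 → E 2 → ℝ}
    (hw : IntegrableOn w U) (hk : ∀ h, IntegrableOn (k h) U)
    (hkb : ∀ h, ∀ᵐ y ∂(volume.restrict U), |k h y| ≤ ‖h‖ * b y)
    (H : ∀ h, HasWeakDirDeriv U w (k h) h) :
    ∫⁻ x in U, ∫⁻ y in U, ‖w y - w x‖ₑ ^ 2 ≤
      ENNReal.ofReal (2 * R) ^ 2 * volume (Metric.closedBall (0 : E 2) (2 * R)) *
        ∫⁻ y in U, ‖b y‖ₑ ^ 2 := by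
  have hw₀i : Integrable (U.indicator w) := (integrable_indicator_iff hU.measurableSet).2 hw
  set B := ∫⁻ y in U, ‖b y‖ₑ ^ 2 with hB
  let χ : E 2 → ENNReal := U.indicator 1
  have hχ : Measurable χ := measurable_one.indicator hU.measurableSet
  -- The substitution `y = x + h` turns the double integral into an integral over `h` of squared
  -- norms of differences with step `h`.
  have e1 : ∫⁻ x in U, ∫⁻ y in U, ‖w y - w x‖ₑ ^ 2 =
      ∫⁻ x, ∫⁻ h, χ x * χ (x + h) * ‖U.indicator w (x + h) - U.indicator w x‖ₑ ^ 2 := by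
    rw [← lintegral_indicator hU.measurableSet]
    congr 1
    ext x
    rw [lintegral_add_left_eq_self (μ := volume)
      (fun y => χ x * χ y * ‖U.indicator w y - U.indicator w x‖ₑ ^ 2) x]
    by_cases hx : x ∈ U
    · rw [indicator_of_mem hx, ← lintegral_indicator hU.measurableSet]
      congr 1
      ext y
      by_cases hy : y ∈ U <;> simp [χ, hx, hy]
    · simp [χ, hx]
  have hmeas : AEMeasurable (fun p : E 2 × E 2 =>
      χ p.1 * χ (p.1 + p.2) * ‖U.indicator w (p.1 + p.2) - U.indicator w p.1‖ₑ ^ 2)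
      (volume.prod volume) := by
    have hq : Measure.QuasiMeasurePreserving (fun p : E 2 × E 2 => p.1 + p.2)
        (volume.prod volume) volume :=
      Measure.quasiMeasurePreserving_snd.comp
        (measurePreserving_prod_add (volume : Measure (E 2)) volume).quasiMeasurePreserving
    have h1 := hw₀i.aestronglyMeasurable.comp_quasiMeasurePreserving hq
    have h2 : AEStronglyMeasurable (fun p : E 2 × E 2 => U.indicator w p.1) (volume.prod volume) :=
      hw₀i.aestronglyMeasurable.comp_quasiMeasurePreserving Measure.quasiMeasurePreserving_fst
    refine AEMeasurable.mul ?_ ((h1.sub h2).enorm.pow_const 2)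
    exact ((hχ.comp measurable_fst).mul (hχ.comp (measurable_fst.add measurable_snd))).aemeasurable
  rw [e1, lintegral_lintegral_swap hmeas]
  calc ∫⁻ h, ∫⁻ x, χ x * χ (x + h) * ‖U.indicator w (x + h) - U.indicator w x‖ₑ ^ 2
      ≤ ∫⁻ h, (Metric.closedBall (0 : E 2) (2 * R)).indicator
          (fun _ => ENNReal.ofReal (2 * R) ^ 2 * B) h := by
        refine lintegral_mono fun h => ?_
        -- Two points of `U` differ by at most `2 * R`, so only `h` in this ball contribute. The
        -- bound `‖h‖ ≤ 2 * R` and the volume of the ball make up the constant.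
        by_cases hh : h ∈ Metric.closedBall (0 : E 2) (2 * R)
        · rw [indicator_of_mem hh]
          have hVm : MeasurableSet (U ∩ {x | x + h ∈ U}) :=
            (hU.inter (hU.preimage (continuous_id.add continuous_const))).measurableSet
          have : ∫⁻ x, χ x * χ (x + h) * ‖U.indicator w (x + h) - U.indicator w x‖ₑ ^ 2 =
              ∫⁻ x in U ∩ {x | x + h ∈ U}, ‖w (x + h) - w x‖ₑ ^ 2 := by
            rw [← lintegral_indicator hVm]
            congr 1
            ext x
            by_cases hx : x ∈ U <;> by_cases hx' : x + h ∈ U <;> simp [χ, hx, hx', indicator]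
          rw [this]
          refine ((H h).lintegral_sub_sq_le hU hc hw (hk h)).trans ?_
          rw [hB, ← lintegral_const_mul' _ _ (ENNReal.pow_ne_top ENNReal.ofReal_ne_top)]
          refine lintegral_mono_ae ?_
          filter_upwards [hkb h] with y hy
          rw [← mul_pow]
          gcongr
          rw [mem_closedBall_zero_iff] at hh
          rw [Real.enorm_eq_ofReal_abs, Real.enorm_eq_ofReal_abs, ← ENNReal.ofReal_mul
            ((norm_nonneg h).trans hh)]
          refine ENNReal.ofReal_le_ofReal (hy.trans ?_)
          exact (mul_le_mul_of_nonneg_left (le_abs_self _) (norm_nonneg h)).trans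
            (mul_le_mul_of_nonneg_right hh (abs_nonneg _))
        · rw [indicator_of_notMem hh]
          refine le_of_eq ?_
          rw [lintegral_eq_zero_iff' ?_]
          · refine ae_of_all _ fun x => ?_
            by_cases hx : x ∈ U
            · by_cases hx' : x + h ∈ U
              · exfalso
                apply hh
                have h1 := mem_closedBall_zero_iff.1 (hR hx)
                have h2 := mem_closedBall_zero_iff.1 (hR hx')
                rw [mem_closedBall_zero_iff]
                calc ‖h‖ = ‖(x + h) - x‖ := by simp
                  _ ≤ ‖x + h‖ + ‖x‖ := norm_sub_le _ _
                  _ ≤ 2 * R := by linarith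
              · simp [χ, hx']
            · simp [χ, hx]
          · have h1 := (hw₀i.comp_add_right h).aestronglyMeasurable
            refine AEMeasurable.mul ?_ ((h1.sub hw₀i.aestronglyMeasurable).enorm.pow_const 2)
            exact (hχ.mul (hχ.comp (measurable_id.add_const h))).aemeasurable
    _ = ENNReal.ofReal (2 * R) ^ 2 * volume (Metric.closedBall (0 : E 2) (2 * R)) * B := by
        rw [lintegral_indicator Metric.isClosed_closedBall.measurableSet, setLIntegral_const]
        ring

end P1FEM

/-! ### Variance identities and mean values on a triangle -/

namespace P1FEM

open Set Topology

theorem enorm_sq_eq_ofReal (x : ℝ) : ‖x‖ₑ ^ 2 = ENNReal.ofReal (x ^ 2) := by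
  rw [Real.enorm_eq_ofReal_abs, ← ENNReal.ofReal_pow (abs_nonneg x), sq_abs]

section Variance

variable {X : Type*} [MeasurableSpace X] {μ ν : Measure X}

theorem integral_sub_const_sq [IsFiniteMeasure μ] {w : X → ℝ} (h : MemLp w 2 μ) (c : ℝ) :
    ∫ y, (w y - c) ^ 2 ∂μ = ∫ y, w y ^ 2 ∂μ - 2 * c * ∫ y, w y ∂μ + c ^ 2 * μ.real univ := by
  have h1 : Integrable w μ := h.integrable one_le_two
  have h2 : Integrable (fun y => w y ^ 2) μ := h.integrable_sq
  have : ∀ y, (w y - c) ^ 2 = w y ^ 2 - 2 * c * w y + c ^ 2 := fun y => by ring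
  simp_rw [this]
  have hs : Integrable (fun y => w y ^ 2 - 2 * c * w y) μ := h2.sub (h1.const_mul _)
  rw [integral_add hs (integrable_const _), integral_sub h2 (h1.const_mul _),
    integral_const_mul, integral_const, smul_eq_mul, mul_comm (μ.real univ)]

/-- The left side is the double integral of `(w y - w x) ^ 2`, multiplied out. With `μ = ν` it
yields a Poincaré inequality; with two different measures it compares their means. -/
theorem variance_ineq [IsFiniteMeasure μ] [IsFiniteMeasure ν] {w : X → ℝ} (h1 : MemLp w 2 μ)
    (h2 : MemLp w 2 ν) {M : ℝ} (hM : 0 ≤ M)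
    (H : ∫⁻ x, ∫⁻ y, ‖w y - w x‖ₑ ^ 2 ∂ν ∂μ ≤ ENNReal.ofReal M) :
    ν.real univ * ∫ x, w x ^ 2 ∂μ + μ.real univ * ∫ x, w x ^ 2 ∂ν
      - 2 * (∫ x, w x ∂μ) * ∫ x, w x ∂ν ≤ M := by
  have hi1 : Integrable w μ := h1.integrable one_le_two
  have hi2 : Integrable (fun y => w y ^ 2) μ := h1.integrable_sq
  have e1 : ∀ x, ∫⁻ y, ‖w y - w x‖ₑ ^ 2 ∂ν = ENNReal.ofReal
      (∫ y, w y ^ 2 ∂ν - 2 * w x * ∫ y, w y ∂ν + w x ^ 2 * ν.real univ) := by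
    intro x
    rw [← integral_sub_const_sq h2]
    simp_rw [enorm_sq_eq_ofReal]
    have hs : Integrable (fun y => (w y - w x) ^ 2) ν := (h2.sub (memLp_const (w x))).integrable_sq
    rw [ofReal_integral_eq_lintegral_ofReal hs (ae_of_all _ fun y => sq_nonneg _)]
  simp_rw [e1] at H
  have hint : Integrable (fun x => ∫ y, w y ^ 2 ∂ν - 2 * w x * ∫ y, w y ∂ν
      + w x ^ 2 * ν.real univ) μ :=
    ((integrable_const _).sub ((hi1.const_mul 2).mul_const _)).add (hi2.mul_const _)
  rw [← ofReal_integral_eq_lintegral_ofReal hint (ae_of_all _ fun x => ?_),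
    ENNReal.ofReal_le_ofReal_iff hM] at H
  · have hs : Integrable (fun x => ∫ y, w y ^ 2 ∂ν - 2 * w x * ∫ y, w y ∂ν) μ :=
      (integrable_const _).sub ((hi1.const_mul 2).mul_const _)
    rw [integral_add hs (hi2.mul_const _),
      integral_sub (integrable_const _) ((hi1.const_mul 2).mul_const _), integral_const,
      integral_mul_const, integral_mul_const, integral_const_mul, smul_eq_mul] at H
    linarith
  · change 0 ≤ ∫ y, w y ^ 2 ∂ν - 2 * w x * ∫ y, w y ∂ν + w x ^ 2 * ν.real univ
    rw [← integral_sub_const_sq h2]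
    exact integral_nonneg fun y => sq_nonneg _

theorem integral_sub_average_sq [IsFiniteMeasure μ] {w : X → ℝ} (h : MemLp w 2 μ)
    (hμ : 0 < μ.real univ) :
    ∫ y, (w y - (∫ x, w x ∂μ) / μ.real univ) ^ 2 ∂μ =
      ∫ y, w y ^ 2 ∂μ - (∫ x, w x ∂μ) ^ 2 / μ.real univ := by
  rw [integral_sub_const_sq h]
  field_simp
  ring

theorem variance_le [IsFiniteMeasure μ] {w : X → ℝ} (h : MemLp w 2 μ)
    (hμ : 0 < μ.real univ) {M : ℝ} (hM : 0 ≤ M)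
    (H : ∫⁻ x, ∫⁻ y, ‖w y - w x‖ₑ ^ 2 ∂μ ∂μ ≤ ENNReal.ofReal M) :
    μ.real univ * ∫ y, (w y - (∫ x, w x ∂μ) / μ.real univ) ^ 2 ∂μ ≤ M := by
  have h1 := variance_ineq h h hM H
  have h2 : 0 ≤ ∫ y, (w y - (∫ x, w x ∂μ) / μ.real univ) ^ 2 ∂μ :=
    integral_nonneg fun y => sq_nonneg _
  rw [integral_sub_average_sq h hμ] at h2 ⊢
  have h3 : μ.real univ * (∫ y, w y ^ 2 ∂μ - (∫ x, w x ∂μ) ^ 2 / μ.real univ) =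
      μ.real univ * ∫ y, w y ^ 2 ∂μ - (∫ x, w x ∂μ) ^ 2 := by
    field_simp
  have h4 := mul_nonneg hμ.le h2
  rw [h3] at h4 ⊢
  nlinarith

/-- The double integral is the sum of the two variances, each weighted by the mass of the other
measure, and of this product; the variances are nonnegative and can be dropped. -/
theorem average_sub_average_sq_le [IsFiniteMeasure μ] [IsFiniteMeasure ν] {w : X → ℝ}
    (h1 : MemLp w 2 μ) (h2 : MemLp w 2 ν) (hμ : 0 < μ.real univ) (hν : 0 < ν.real univ)
    {M : ℝ} (hM : 0 ≤ M) (H : ∫⁻ x, ∫⁻ y, ‖w y - w x‖ₑ ^ 2 ∂ν ∂μ ≤ ENNReal.ofReal M) :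
    μ.real univ * ν.real univ *
      ((∫ x, w x ∂μ) / μ.real univ - (∫ x, w x ∂ν) / ν.real univ) ^ 2 ≤ M := by
  have h := variance_ineq h1 h2 hM H
  have a1 : 0 ≤ ∫ y, (w y - (∫ x, w x ∂μ) / μ.real univ) ^ 2 ∂μ :=
    integral_nonneg fun y => sq_nonneg _
  have a2 : 0 ≤ ∫ y, (w y - (∫ x, w x ∂ν) / ν.real univ) ^ 2 ∂ν :=
    integral_nonneg fun y => sq_nonneg _
  rw [integral_sub_average_sq h1 hμ] at a1
  rw [integral_sub_average_sq h2 hν] at a2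
  have b1 := mul_nonneg hν.le a1
  have b2 := mul_nonneg hμ.le a2
  have : μ.real univ * ν.real univ *
      ((∫ x, w x ∂μ) / μ.real univ - (∫ x, w x ∂ν) / ν.real univ) ^ 2 =
      ν.real univ * ((∫ x, w x ∂μ) ^ 2 / μ.real univ) +
      μ.real univ * ((∫ x, w x ∂ν) ^ 2 / ν.real univ) - 2 * (∫ x, w x ∂μ) * ∫ x, w x ∂ν := by
    field_simp
    ring
  rw [this]
  linarith

end Variance

variable {d : ℕ}

/-- The constant of the Poincaré inequality on reference domains in the ball of radius `2`. -/
noncomputable def poincareConst : ℝ := 4 ^ 2 * volume.real (Metric.closedBall (0 : E 2) 4)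

theorem poincareConst_nonneg : 0 ≤ poincareConst := by unfold poincareConst; positivity

/-- The weak formulation in the chart says that `⟪g ∘ χ, Dχ h⟫` is the weak derivative of `u ∘ χ` in
direction `h`. Only a pointwise bound `b` for it enters, never the bi-Lipschitz constant of `χ`. -/
theorem HasH1Gradient.chart_lintegral_le {Ω : Set (E d)} {u : E d → ℝ} {g : E d → E d}
    (hu : HasH1Gradient Ω u g) {U : Set (E 2)} {χ : E 2 → E d} (hχ : IsChart Ω U χ)
    (hc : Convex ℝ U) (hR : U ⊆ Metric.closedBall 0 2)
    (hw : MemLp (fun y => u (χ y)) 2 (volume.restrict U))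
    (hg : AEStronglyMeasurable (fun y => g (χ y)) (volume.restrict U)) {b : E 2 → ℝ}
    (hb : MemLp b 2 (volume.restrict U))
    (hkb : ∀ᵐ y ∂(volume.restrict U), ∀ h, |inner ℝ (g (χ y)) (fderiv ℝ χ y h)| ≤ ‖h‖ * b y) :
    ∫⁻ x in U, ∫⁻ y in U, ‖u (χ y) - u (χ x)‖ₑ ^ 2 ≤
      ENNReal.ofReal (poincareConst * ∫ y in U, b y ^ 2) := by
  have hfin : IsFiniteMeasure (volume.restrict U) := ⟨by
    rw [Measure.restrict_apply_univ]
    exact (measure_mono hR).trans_lt (isCompact_closedBall (0 : E 2) 2).measure_lt_top⟩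
  have hbi : Integrable b (volume.restrict U) := hb.integrable one_le_two
  refine (lintegral_lintegral_sub_sq_le hχ.isOpen hc hR (w := fun y => u (χ y)) (b := b)
    (k := fun h y => inner ℝ (g (χ y)) (fderiv ℝ χ y h)) (hw.integrable one_le_two)
    (fun h => ?_) (fun h => ?_) (fun h φ h1 h2 h3 => ?_)).trans (le_of_eq ?_)
  · refine Integrable.mono' (hbi.const_mul ‖h‖) ?_ ?_
    · exact hg.inner (measurable_fderiv_apply_const ℝ χ h).aestronglyMeasurable
    · filter_upwards [hkb] with y hy using hy h
  · filter_upwards [hkb] with y hy using hy h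
  · exact hu.weak U χ hχ φ h1 h2 h3 h
  · have e1 : ∫⁻ y in U, ‖b y‖ₑ ^ 2 = ENNReal.ofReal (∫ y in U, b y ^ 2) := by
      simp_rw [enorm_sq_eq_ofReal]
      rw [ofReal_integral_eq_lintegral_ofReal hb.integrable_sq (ae_of_all _ fun y => sq_nonneg _)]
    have hv : volume (Metric.closedBall (0 : E 2) (2 * 2)) =
        ENNReal.ofReal (volume.real (Metric.closedBall (0 : E 2) 4)) := by
      rw [show (2 : ℝ) * 2 = 4 by norm_num, measureReal_def, ENNReal.ofReal_toReal]
      exact (isCompact_closedBall (0 : E 2) 4).measure_lt_top.ne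
    rw [e1, hv, show (2 : ℝ) * 2 = 4 by norm_num, poincareConst,
      ENNReal.ofReal_mul (by positivity), ENNReal.ofReal_mul (by positivity),
      ENNReal.ofReal_pow (by norm_num)]

section Mesh

variable {Ω : Set (E d)} {𝒯 : Finset (Finset (E d))}

theorem affine_para (A : E d →ᵃ[ℝ] ℝ) (a b c : E d) (y : E 2) :
    A (para a (b - a) (c - a) y) = A a + (y 0 * (A b - A a) + y 1 * (A c - A a)) := by
  rw [para_apply]
  have h1 : A (a + (y 0 • (b - a) + y 1 • (c - a))) =
      A.linear (y 0 • (b - a) + y 1 • (c - a)) + A a := by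
    rw [add_comm, ← vadd_eq_add, A.map_vadd, vadd_eq_add]
  have h2 : ∀ z, A.linear (z - a) = A z - A a := fun z => by
    rw [← vsub_eq_sub z a, A.linearMap_vsub, vsub_eq_sub]
  rw [h1, map_add, map_smul, map_smul, h2, h2, smul_eq_mul, smul_eq_mul]
  ring

/-- An edge or node misses some vertex of the triangle. The hat function of that vertex vanishes on
this face, but the barycentric coordinates of an interior point are all positive. -/
theorem IsMesh.para_notMem_skeleton (hM : IsMesh Ω 𝒯) {a b c : E d} (hT : {a, b, c} ∈ 𝒯)
    (hab : a ≠ b) (hac : a ≠ c) (hbc : b ≠ c) {y : E 2} (hy : y ∈ refOpen) :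
    para a (b - a) (c - a) y ∉ skeleton 𝒯 := by
  intro hx
  have htri : para a (b - a) (c - a) y ∈ tri {a, b, c} := by
    rw [tri_eq_para_image hab hac hbc]
    exact mem_image_of_mem _ (refOpen_subset hy)
  obtain ⟨e, he, hcard, hxe⟩ := hM.exists_face_of_mem_skeleton hT hx htri
  have hlt : e.card < ({a, b, c} : Finset (E d)).card := by rw [hM.card_eq _ hT]; omega
  obtain ⟨v, hv, hve⟩ := Finset.exists_mem_notMem_of_card_lt_card hlt
  have hz : hat {a, b, c} v (para a (b - a) (c - a) y) = 0 := by
    have := AffineMap_eqOn_convexHull (A := hat {a, b, c} v) (B := 0) (s := (e : Set (E d)))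
      (fun z hz => ?_) hxe
    · simpa using this
    · rw [hat_apply (hM.nondegenerate _ hT) v z (he hz), if_neg]
      · rfl
      · rintro rfl
        exact hve hz
  have hh := hat_apply (hM.nondegenerate _ hT) v
  rw [affine_para, hh a (by simp), hh b (by simp), hh c (by simp)] at hz
  obtain ⟨h0, h1, h2⟩ := hy
  simp only [Finset.mem_insert, Finset.mem_singleton] at hv
  rcases hv with rfl | rfl | rfl
  · simp [hab.symm, hac.symm] at hz
    linarith
  · simp [hab, hbc.symm] at hz
    linarith
  · simp [hac, hbc] at hz
    linarith

theorem IsMesh.para_mem (hM : IsMesh Ω 𝒯) (hB : ResolvesBoundary Ω 𝒯) {a b c : E d}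
    (hT : {a, b, c} ∈ 𝒯) (hab : a ≠ b) (hac : a ≠ c) (hbc : b ≠ c) {y : E 2} (hy : y ∈ refOpen) :
    para a (b - a) (c - a) y ∈ Ω := by
  refine hM.mem_of_mem_tri_of_notMem_skeleton hB hT ?_ (hM.para_notMem_skeleton hT hab hac hbc hy)
  rw [tri_eq_para_image hab hac hbc]
  exact mem_image_of_mem _ (refOpen_subset hy)

theorem IsMesh.tri_ae_le (hM : IsMesh Ω 𝒯) (hB : ResolvesBoundary Ω 𝒯) {T : Finset (E d)}
    (hT : T ∈ 𝒯) : tri T ≤ᵐ[μHE[2]] Ω := by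
  rw [ae_le_set]
  refine measure_mono_null ?_ (measure_skeleton 𝒯)
  rintro x ⟨hx, hxΩ⟩
  by_contra h
  exact hxΩ (hM.mem_of_mem_tri_of_notMem_skeleton hB hT hx h)

theorem IsMesh.restrict_tri_le (hM : IsMesh Ω 𝒯) (hB : ResolvesBoundary Ω 𝒯) {T : Finset (E d)}
    (hT : T ∈ 𝒯) : (μHE[2]).restrict (tri T) ≤ (μHE[2]).restrict Ω :=
  Measure.restrict_mono' (hM.tri_ae_le hB hT) le_rfl

theorem setIntegral_tri {a b c : E d} (hab : a ≠ b) (hac : a ≠ c) (hbc : b ≠ c)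
    (hl : LinearIndependent ℝ ![b - a, c - a]) (f : E d → ℝ) :
    ∫ x in tri {a, b, c}, f x ∂μHE[2] =
      parArea (b - a) (c - a) * ∫ y in refOpen, f (para a (b - a) (c - a) y) := by
  rw [tri_eq_para_image hab hac hbc, setIntegral_para_image a hl,
    setIntegral_congr_set refOpen_ae_eq_refTri]

theorem measureReal_tri {a b c : E d} (hab : a ≠ b) (hac : a ≠ c) (hbc : b ≠ c) :
    (μHE[2]).real (tri {a, b, c}) = parArea (b - a) (c - a) * refArea := by
  rw [tri_eq_para_image hab hac hbc, measureReal_def, measure_para_image, ENNReal.toReal_mul,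
    ENNReal.toReal_ofReal (parArea_nonneg _ _)]
  rfl

theorem measureReal_refOpen : volume.real refOpen = refArea :=
  measureReal_congr refOpen_ae_eq_refTri

theorem memLp_tri_comp {F : Type*} [NormedAddCommGroup F] {a b c : E d} (hab : a ≠ b)
    (hac : a ≠ c) (hbc : b ≠ c) (hl : LinearIndependent ℝ ![b - a, c - a]) {f : E d → F}
    (hf : MemLp f 2 ((μHE[2]).restrict (tri {a, b, c}))) :
    MemLp (fun y => f (para a (b - a) (c - a) y)) 2 (volume.restrict refOpen) := by
  rw [tri_eq_para_image hab hac hbc, memLp_para_image_iff a hl] at hf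
  exact hf.mono_measure (Measure.restrict_mono refOpen_subset le_rfl)

/-- The mean value of `u` on the triangle `T`. -/
noncomputable def triAvg (T : Finset (E d)) (u : E d → ℝ) : ℝ :=
  (∫ x in tri T, u x ∂μHE[2]) / (μHE[2]).real (tri T)

theorem triAvg_eq {a b c : E d} (hab : a ≠ b) (hac : a ≠ c) (hbc : b ≠ c)
    (hl : LinearIndependent ℝ ![b - a, c - a]) (u : E d → ℝ) :
    triAvg {a, b, c} u = (∫ y in refOpen, u (para a (b - a) (c - a) y)) / refArea := by
  rw [triAvg, setIntegral_tri hab hac hbc hl, measureReal_tri hab hac hbc]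
  have := parArea_pos hl
  have := refArea_pos
  field_simp

theorem convex_refOpen : Convex ℝ refOpen := by
  rintro x ⟨x0, x1, x2⟩ y ⟨y0, y1, y2⟩ s t hs ht hst
  have key : ∀ u v : ℝ, 0 < u → 0 < v → 0 < s * u + t * v := by
    intro u v hu hv
    rcases hs.eq_or_lt with h | h
    · have : t = 1 := by linarith
      subst this; rw [← h]; simpa
    · exact add_pos_of_pos_of_nonneg (mul_pos h hu) (mul_nonneg ht hv.le)
  refine ⟨?_, ?_, ?_⟩
  · simpa using key _ _ x0 y0
  · simpa using key _ _ x1 y1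
  · have := key (1 - x 0 - x 1) (1 - y 0 - y 1) (by linarith) (by linarith)
    simp
    nlinarith

theorem IsMesh.linearIndependent (hM : IsMesh Ω 𝒯) {a b c : E d} (hT : {a, b, c} ∈ 𝒯)
    (hab : a ≠ b) (hac : a ≠ c) (hbc : b ≠ c) : LinearIndependent ℝ ![b - a, c - a] :=
  linearIndependent_edges (hM.nondegenerate _ hT) (by simp) (by simp) (by simp) hab hac hbc

theorem isChart_para (hM : IsMesh Ω 𝒯) (hB : ResolvesBoundary Ω 𝒯) {a b c : E d}
    (hT : {a, b, c} ∈ 𝒯) (hab : a ≠ b) (hac : a ≠ c) (hbc : b ≠ c) :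
    IsChart Ω refOpen (para a (b - a) (c - a)) := by
  refine ⟨isOpen_refOpen, fun y hy => hM.para_mem hB hT hab hac hbc hy, ?_⟩
  have hl := hM.linearIndependent hT hab hac hbc
  set r := max ‖b - a‖ ‖c - a‖
  have hD := parArea_pos hl
  refine ⟨max (2 * r) (2 * r / parArea (b - a) (c - a)), fun x _ y _ => ⟨?_, ?_⟩⟩
  · rw [dist_eq_norm, dist_eq_norm, para_sub_para]
    refine (norm_edgeMap_le _ _ (le_max_left _ _) (le_max_right _ _) _).trans ?_
    gcongr
    exact le_max_left _ _
  · rw [dist_eq_norm, dist_eq_norm, para_sub_para]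
    have := parArea_mul_norm_le (b - a) (c - a) (r := r) (le_max_left _ _) (le_max_right _ _) (x - y)
    refine le_trans ?_ (mul_le_mul_of_nonneg_right (le_max_right _ _) (norm_nonneg _))
    rw [div_mul_eq_mul_div, le_div_iff₀ hD]
    linarith

theorem abs_inner_edgeMap_le (p q : E d) {r : ℝ} (hp : ‖p‖ ≤ r) (hq : ‖q‖ ≤ r) (v : E d) (h : E 2) :
    |inner ℝ v (edgeMap p q h)| ≤ ‖h‖ * (2 * r * ‖v‖) := by
  refine (abs_real_inner_le_norm _ _).trans ?_
  calc ‖v‖ * ‖edgeMap p q h‖ ≤ ‖v‖ * (2 * r * ‖h‖) := by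
        gcongr
        exact norm_edgeMap_le p q hp hq h
    _ = _ := by ring

/-- The Poincaré inequality on a triangle of the mesh. -/
theorem HasH1Gradient.integral_sub_triAvg_sq_le (hM : IsMesh Ω 𝒯) (hB : ResolvesBoundary Ω 𝒯)
    {u : E d → ℝ} {g : E d → E d} (hu : HasH1Gradient Ω u g) {a b c : E d}
    (hT : {a, b, c} ∈ 𝒯) (hab : a ≠ b) (hac : a ≠ c) (hbc : b ≠ c) {r : ℝ} (hp : ‖b - a‖ ≤ r)
    (hq : ‖c - a‖ ≤ r) :
    refArea * ∫ x in tri {a, b, c}, (u x - triAvg {a, b, c} u) ^ 2 ∂μHE[2] ≤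
      4 * poincareConst * r ^ 2 * ∫ x in tri {a, b, c}, ‖g x‖ ^ 2 ∂μHE[2] := by
  have hl := hM.linearIndependent hT hab hac hbc
  have hw := memLp_tri_comp hab hac hbc hl (hu.memLp.mono_measure (hM.restrict_tri_le hB hT))
  have hg := memLp_tri_comp hab hac hbc hl (hu.memLp_grad.mono_measure (hM.restrict_tri_le hB hT))
  have hfin : IsFiniteMeasure ((volume : Measure (E 2)).restrict refOpen) := ⟨by
    rw [Measure.restrict_apply_univ]
    exact (measure_mono refOpen_subset).trans_lt volume_refTri_lt_top⟩
  have h1 := hu.chart_lintegral_le (isChart_para hM hB hT hab hac hbc) convex_refOpen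
    (refOpen_subset.trans refTri_subset_closedBall) hw hg.aestronglyMeasurable
    (b := fun y => 2 * r * ‖g (para a (b - a) (c - a) y)‖) (hg.norm.const_mul (2 * r))
    (ae_of_all _ fun y h => by
      rw [(hasFDerivAt_para _ _ _ y).fderiv]
      exact abs_inner_edgeMap_le _ _ hp hq _ h)
  have hv : ((volume : Measure (E 2)).restrict refOpen).real univ = refArea := by
    rw [measureReal_restrict_apply_univ, measureReal_refOpen]
  have h2 := variance_le hw (by rw [hv]; exact refArea_pos)
    (mul_nonneg poincareConst_nonneg (integral_nonneg fun y => sq_nonneg _)) h1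
  rw [hv, ← triAvg_eq hab hac hbc hl] at h2
  rw [setIntegral_tri hab hac hbc hl, setIntegral_tri hab hac hbc hl]
  simp_rw [mul_pow, integral_const_mul] at h2
  have hD := parArea_pos hl
  nlinarith [mul_le_mul_of_nonneg_left h2 hD.le]

end Mesh

end P1FEM

/-! ### The kite: two triangles with a common edge -/

namespace P1FEM

open Set Topology

variable {d : ℕ}

/-- The reflection of the open reference triangle. -/
def refFlip : Set (E 2) := {y | 0 < y 0 ∧ y 1 < 0 ∧ y 0 - y 1 < 1}

/-- The union of the open reference triangle, its reflection and their common open edge. -/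
def kite : Set (E 2) := {y | 0 < y 0 ∧ y 0 + y 1 < 1 ∧ y 0 - y 1 < 1}

theorem isOpen_refFlip : IsOpen refFlip :=
  (isOpen_lt continuous_const (continuous_coord 0)).inter
    ((isOpen_lt (continuous_coord 1) continuous_const).inter
      (isOpen_lt ((continuous_coord 0).sub (continuous_coord 1)) continuous_const))

theorem isOpen_kite : IsOpen kite :=
  (isOpen_lt continuous_const (continuous_coord 0)).inter
    ((isOpen_lt ((continuous_coord 0).add (continuous_coord 1)) continuous_const).inter
      (isOpen_lt ((continuous_coord 0).sub (continuous_coord 1)) continuous_const))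

theorem refOpen_subset_kite : refOpen ⊆ kite := fun _ h => ⟨h.1, h.2.2, by linarith [h.2.1, h.2.2]⟩

theorem refFlip_subset_kite : refFlip ⊆ kite := fun _ h => ⟨h.1, by linarith [h.2.1, h.2.2], h.2.2⟩

theorem kite_subset_closedBall : kite ⊆ Metric.closedBall 0 2 := by
  rintro y ⟨h0, h1, h2⟩
  rw [mem_closedBall_zero_iff]
  have := norm_le_of_abs_le (y := y) (r := 1) (by rw [abs_le]; constructor <;> linarith)
    (by rw [abs_le]; constructor <;> linarith)
  linarith

theorem convex_kite : Convex ℝ kite := by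
  rintro x ⟨x0, x1, x2⟩ y ⟨y0, y1, y2⟩ s t hs ht hst
  have key : ∀ u v : ℝ, 0 < u → 0 < v → 0 < s * u + t * v := by
    intro u v hu hv
    rcases hs.eq_or_lt with h | h
    · have : t = 1 := by linarith
      subst this; rw [← h]; simpa
    · exact add_pos_of_pos_of_nonneg (mul_pos h hu) (mul_nonneg ht hv.le)
  refine ⟨?_, ?_, ?_⟩
  · simpa using key _ _ x0 y0
  · have := key (1 - x 0 - x 1) (1 - y 0 - y 1) (by linarith) (by linarith)
    simp
    nlinarith
  · have := key (1 - x 0 + x 1) (1 - y 0 + y 1) (by linarith) (by linarith)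
    simp
    nlinarith

theorem kite_ae_eq : (refOpen ∪ refFlip : Set (E 2)) =ᵐ[volume] kite := by
  refine Filter.EventuallyLE.antisymm
    (union_subset refOpen_subset_kite refFlip_subset_kite).eventuallyLE ?_
  rw [ae_le_set]
  have h1 := volume_level_eq_zero (EuclideanSpace.proj (1 : Fin 2)) (fun h => by
    simpa using congrArg (fun f => f (EuclideanSpace.single 1 1)) h) 0
  refine measure_mono_null ?_ h1
  rintro y ⟨⟨h0, h1, h2⟩, hn⟩
  simp only [mem_ofPred_eq, PiLp.proj_apply]
  by_contra hc
  apply hn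
  rcases lt_or_gt_of_ne hc with h | h
  · exact Or.inr ⟨h0, h, h2⟩
  · exact Or.inl ⟨h0, h, h1⟩

theorem disjoint_refOpen_refFlip : Disjoint refOpen refFlip := by
  rw [Set.disjoint_left]
  rintro y ⟨-, h, -⟩ ⟨-, h', -⟩
  linarith

theorem memLp_kite {F : Type*} [NormedAddCommGroup F] {f f₁ f₂ : E 2 → F}
    (h₁ : MemLp f₁ 2 (volume.restrict refOpen)) (h₂ : MemLp f₂ 2 (volume.restrict refFlip))
    (e₁ : EqOn f f₁ refOpen) (e₂ : EqOn f f₂ refFlip) : MemLp f 2 (volume.restrict kite) := by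
  rw [← Measure.restrict_congr_set kite_ae_eq]
  have h3 := ((memLp_indicator_iff_restrict isOpen_refOpen.measurableSet).2 h₁).add
    ((memLp_indicator_iff_restrict isOpen_refFlip.measurableSet).2 h₂)
  refine (memLp_congr_ae ?_).1 (h3.restrict (refOpen ∪ refFlip))
  refine (ae_restrict_iff' (isOpen_refOpen.union isOpen_refFlip).measurableSet).2
    (ae_of_all _ fun y hy => ?_)
  rcases hy with hy | hy
  · have := Set.disjoint_left.1 disjoint_refOpen_refFlip hy
    simp [hy, this, e₁ hy]
  · have := Set.disjoint_right.1 disjoint_refOpen_refFlip hy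
    simp [hy, this, e₂ hy]

theorem setIntegral_kite {f : E 2 → ℝ} (h : IntegrableOn f kite) :
    ∫ y in kite, f y = (∫ y in refOpen, f y) + ∫ y in refFlip, f y := by
  rw [← setIntegral_congr_set kite_ae_eq, setIntegral_union disjoint_refOpen_refFlip
    isOpen_refFlip.measurableSet (h.mono_set refOpen_subset_kite)
    (h.mono_set refFlip_subset_kite)]

theorem para_neg_image (a p q : E d) :
    para a p (-q) '' refFlip = para a p q '' refOpen := by
  ext x
  constructor
  · rintro ⟨y, ⟨h0, h1, h2⟩, rfl⟩
    refine ⟨!₂[y 0, -y 1], ⟨by simpa using h0, by simpa using h1, ?_⟩, ?_⟩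
    · simp
      linarith
    simp [para_apply]
  · rintro ⟨y, ⟨h0, h1, h2⟩, rfl⟩
    refine ⟨!₂[y 0, -y 1], ⟨by simpa using h0, by simpa using h1, ?_⟩, ?_⟩
    · simp
      linarith
    simp [para_apply]

theorem parArea_neg (p q : E d) : parArea p (-q) = parArea p q := by
  rw [← sq_eq_sq₀ (parArea_nonneg _ _) (parArea_nonneg _ _), parArea_sq, parArea_sq, norm_neg,
    inner_neg_right, neg_sq]

theorem linearIndependent_neg {p q : E d} (h : LinearIndependent ℝ ![p, q]) :
    LinearIndependent ℝ ![p, -q] := by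
  rw [LinearIndependent.pair_iff] at h ⊢
  intro s t hst
  have := h s (-t) (by rw [← hst]; simp)
  simpa using this

theorem measureReal_refFlip : volume.real refFlip = refArea := by
  have h1 : (0 : ℝ) < parArea (EuclideanSpace.single 0 1 : E 2) (EuclideanSpace.single 1 1) := by
    apply parArea_pos
    rw [LinearIndependent.pair_iff]
    intro s t h
    have e0 := congrArg (fun v : E 2 => v 0) h
    have e1 := congrArg (fun v : E 2 => v 1) h
    simp at e0 e1
    exact ⟨e0, e1⟩
  have h2 := measure_para_image (0 : E 2) (EuclideanSpace.single 0 1) (-EuclideanSpace.single 1 1)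
    refFlip
  rw [para_neg_image, measure_para_image, parArea_neg,
    ENNReal.mul_right_inj (by simpa using h1) ENNReal.ofReal_ne_top] at h2
  rw [measureReal_def, ← h2, ← measureReal_def, measureReal_refOpen]

theorem setIntegral_tri_flip {a b c : E d} (hab : a ≠ b) (hac : a ≠ c) (hbc : b ≠ c)
    (hl : LinearIndependent ℝ ![b - a, c - a]) (f : E d → ℝ) :
    ∫ x in tri {a, b, c}, f x ∂μHE[2] =
      parArea (b - a) (c - a) * ∫ y in refFlip, f (para a (b - a) (-(c - a)) y) := by
  rw [setIntegral_tri hab hac hbc hl, ← setIntegral_para_image a hl, ← para_neg_image,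
    setIntegral_para_image a (linearIndependent_neg hl), parArea_neg]

theorem memLp_tri_comp_flip {F : Type*} [NormedAddCommGroup F] {a b c : E d} (hab : a ≠ b)
    (hac : a ≠ c) (hbc : b ≠ c) (hl : LinearIndependent ℝ ![b - a, c - a]) {f : E d → F}
    (hf : MemLp f 2 ((μHE[2]).restrict (tri {a, b, c}))) :
    MemLp (fun y => f (para a (b - a) (-(c - a)) y)) 2 (volume.restrict refFlip) := by
  refine (memLp_para_image_iff a (linearIndependent_neg hl) _).1 ?_
  rw [para_neg_image]
  refine hf.mono_measure (Measure.restrict_mono ?_ le_rfl)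
  rw [tri_eq_para_image hab hac hbc]
  exact image_mono refOpen_subset

theorem triAvg_eq_flip {a b c : E d} (hab : a ≠ b) (hac : a ≠ c) (hbc : b ≠ c)
    (hl : LinearIndependent ℝ ![b - a, c - a]) (u : E d → ℝ) :
    triAvg {a, b, c} u = (∫ y in refFlip, u (para a (b - a) (-(c - a)) y)) / refArea := by
  rw [triAvg, setIntegral_tri_flip hab hac hbc hl, measureReal_tri hab hac hbc]
  have := parArea_pos hl
  have := refArea_pos
  field_simp

/-- The piecewise affine map from the kite onto two triangles with a common edge. -/
noncomputable def kiteMap (a p q q' : E d) (y : E 2) : E d :=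
  if 0 ≤ y 1 then para a p q y else para a p (-q') y

theorem kiteMap_of_nonneg {a p q q' : E d} {y : E 2} (h : 0 ≤ y 1) :
    kiteMap a p q q' y = para a p q y := if_pos h

theorem kiteMap_of_neg {a p q q' : E d} {y : E 2} (h : y 1 < 0) :
    kiteMap a p q q' y = para a p (-q') y := if_neg h.not_ge

theorem hasFDerivAt_kiteMap_of_pos {a p q q' : E d} {y : E 2} (h : 0 < y 1) :
    HasFDerivAt (kiteMap a p q q') (edgeMap p q) y := by
  refine (hasFDerivAt_para a p q y).congr_of_eventuallyEq ?_
  filter_upwards [(isOpen_lt continuous_const (continuous_coord 1)).mem_nhds h] with z hz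
  exact kiteMap_of_nonneg (le_of_lt hz)

theorem hasFDerivAt_kiteMap_of_neg {a p q q' : E d} {y : E 2} (h : y 1 < 0) :
    HasFDerivAt (kiteMap a p q q') (edgeMap p (-q')) y := by
  refine (hasFDerivAt_para a p (-q') y).congr_of_eventuallyEq ?_
  filter_upwards [(isOpen_lt (continuous_coord 1) continuous_const).mem_nhds h] with z hz
  exact kiteMap_of_neg hz

/-- Two triangles with exactly an edge in common are transversal. -/
theorem IsMesh.transversal {Ω : Set (E d)} {𝒯 : Finset (Finset (E d))} (hM : IsMesh Ω 𝒯)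
    {a b c c' : E d} (hT : {a, b, c} ∈ 𝒯) (hT' : {a, b, c'} ∈ 𝒯) (hab : a ≠ b) (hac : a ≠ c)
    (hbc : b ≠ c) (hac' : a ≠ c') (hbc' : b ≠ c') (hcc : c ≠ c') {σ t t' : ℝ} (ht : 0 ≤ t)
    (ht' : 0 ≤ t') (h : σ • (b - a) + t • (c - a) - t' • (c' - a) = 0) :
    σ = 0 ∧ t = 0 ∧ t' = 0 := by
  have hl := LinearIndependent.pair_iff.1 (hM.linearIndependent hT hab hac hbc)
  have hl' := LinearIndependent.pair_iff.1 (hM.linearIndependent hT' hab hac' hbc')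
  by_cases h0 : t = 0
  · have := hl' σ (-t') (by rw [← h, h0]; module)
    exact ⟨this.1, h0, by simpa using this.2⟩
  exfalso
  have htpos : 0 < t := lt_of_le_of_ne ht (Ne.symm h0)
  -- The point reached from the midpoint of the common edge by `ε` times `σ • (b - a) + t • (c - a)
  -- = t' • (c' - a)` lies in both triangles for small `ε`. The mesh condition then puts it on the
  -- edge, which contradicts `t > 0`.
  set ε : ℝ := 1 / (4 * (|σ| + t + t' + 1)) with hε
  have hS : 0 < |σ| + t + t' + 1 := by positivity
  have hεpos : 0 < ε := by positivity
  have hε1 : ε * (|σ| + t + t') ≤ 1 / 4 := by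
    rw [hε, div_mul_eq_mul_div, div_le_div_iff₀ (by positivity) (by norm_num)]
    nlinarith
  have hσ1 := le_abs_self σ
  have hσ2 := neg_abs_le σ
  have b1 : ε * σ ≤ ε * |σ| := by gcongr
  have b2 : -(ε * |σ|) ≤ ε * σ := by nlinarith
  have b3 : 0 ≤ ε * |σ| := by positivity
  have b4 : 0 < ε * t := by positivity
  have b5 : 0 ≤ ε * t' := by positivity
  have hx1 : para a (b - a) (c - a) !₂[1 / 2 + ε * σ, ε * t] ∈ tri {a, b, c} := by
    rw [tri_eq_para_image hab hac hbc]
    refine mem_image_of_mem _ ⟨?_, ?_, ?_⟩ <;> simp <;> linarith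
  have hx2 : para a (b - a) (c - a) !₂[1 / 2 + ε * σ, ε * t] ∈ tri {a, b, c'} := by
    rw [tri_eq_para_image hab hac' hbc']
    refine ⟨!₂[1 / 2, ε * t'], ⟨?_, ?_, ?_⟩, ?_⟩
    · simp
    · simpa using b5
    · simp; linarith
    · rw [para_apply, para_apply]
      have : t' • (c' - a) = σ • (b - a) + t • (c - a) := (sub_eq_zero.1 h).symm
      simp only [Matrix.cons_val_zero, Matrix.cons_val_one]
      rw [mul_smul ε t', this]
      module
  have hne : ({a, b, c} : Finset (E d)) ≠ {a, b, c'} := by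
    intro he
    have : c ∈ ({a, b, c'} : Finset (E d)) := he ▸ (by simp)
    simp [hac.symm, hbc.symm, hcc] at this
  have hx : para a (b - a) (c - a) !₂[1 / 2 + ε * σ, ε * t] ∈ tri {a, b, c} ∩ tri {a, b, c'} :=
    ⟨hx1, hx2⟩
  rw [hM.inter _ hT _ hT' hne] at hx
  have hsub : ((({a, b, c} : Finset (E d)) : Set (E d)) ∩ (({a, b, c'} : Finset (E d)) : Set (E d)))
      ⊆ {a, b} := by
    rintro z ⟨hz, hz'⟩
    simp only [Finset.coe_insert, Finset.coe_singleton, mem_insert_iff, mem_singleton_iff]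
      at hz hz' ⊢
    rcases hz with h | h | h
    · exact Or.inl h
    · exact Or.inr h
    · subst h
      rcases hz' with h | h | h
      · exact Or.inl h
      · exact Or.inr h
      · exact absurd h hcc
  have hx3 := convexHull_mono hsub hx
  rw [convexHull_pair, segment_eq_image'] at hx3
  obtain ⟨s, -, hs⟩ := hx3
  simp only [para_apply, Matrix.cons_val_zero, Matrix.cons_val_one] at hs
  have := hl (1 / 2 + ε * σ - s) (ε * t) (by
    have h2 := add_left_cancel hs
    rw [sub_smul, h2]
    module)
  linarith [this.2]

/-- By homogeneity it suffices to minimize over the compact set `|σ| + t + t' = 1`, where the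
hypothesis excludes the value zero. -/
theorem exists_transversality_const {p q q' : E d}
    (h : ∀ σ t t' : ℝ, 0 ≤ t → 0 ≤ t' → σ • p + t • q - t' • q' = 0 → σ = 0 ∧ t = 0 ∧ t' = 0) :
    ∃ κ : ℝ, 0 < κ ∧ ∀ σ t t' : ℝ, 0 ≤ t → 0 ≤ t' →
      κ * (|σ| + t + t') ≤ ‖σ • p + t • q - t' • q'‖ := by
  let K : Set (ℝ × ℝ × ℝ) := {x | 0 ≤ x.2.1 ∧ 0 ≤ x.2.2 ∧ |x.1| + x.2.1 + x.2.2 = 1}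
  have hKc : IsCompact K := by
    refine (isCompact_Icc.prod (isCompact_Icc.prod isCompact_Icc) :
      IsCompact (Icc (-1 : ℝ) 1 ×ˢ (Icc (-1 : ℝ) 1 ×ˢ Icc (-1 : ℝ) 1))).of_isClosed_subset ?_ ?_
    · have c1 : Continuous fun x : ℝ × ℝ × ℝ => x.2.1 := by fun_prop
      have c2 : Continuous fun x : ℝ × ℝ × ℝ => x.2.2 := by fun_prop
      have c3 : Continuous fun x : ℝ × ℝ × ℝ => |x.1| + x.2.1 + x.2.2 := by fun_prop
      exact (isClosed_le continuous_const c1).inter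
        ((isClosed_le continuous_const c2).inter (isClosed_eq c3 continuous_const))
    · rintro ⟨σ, t, t'⟩ ⟨h1, h2, h3⟩
      simp only at h1 h2 h3
      have h4 := abs_nonneg σ
      have h5 : |σ| ≤ 1 := by linarith
      rw [abs_le] at h5
      refine ⟨⟨h5.1, h5.2⟩, ⟨?_, ?_⟩, ⟨?_, ?_⟩⟩ <;> dsimp only <;> linarith
  have hKn : K.Nonempty := ⟨(1, 0, 0), by simp [K]⟩
  obtain ⟨⟨σ₀, t₀, t₀'⟩, hx, hmin⟩ := hKc.exists_isMinOn hKn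
    (f := fun x : ℝ × ℝ × ℝ => ‖x.1 • p + x.2.1 • q - x.2.2 • q'‖) (by fun_prop)
  refine ⟨‖σ₀ • p + t₀ • q - t₀' • q'‖, ?_, ?_⟩
  · rw [norm_pos_iff]
    intro h0
    obtain ⟨h1, h2, h3⟩ := h _ _ _ hx.1 hx.2.1 h0
    have := hx.2.2
    simp only at h1 h2 h3 this
    simp [h1, h2, h3] at this
  · intro σ t t' ht ht'
    have h0 := abs_nonneg σ
    rcases (by positivity : 0 ≤ |σ| + t + t').eq_or_lt with hs | hs
    · rw [← hs, mul_zero]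
      positivity
    · have hm : ((σ / (|σ| + t + t'), t / (|σ| + t + t'), t' / (|σ| + t + t')) : ℝ × ℝ × ℝ) ∈ K := by
        refine ⟨by positivity, by positivity, ?_⟩
        simp only [abs_div, abs_of_pos hs]
        field_simp
      have := hmin hm
      simp only [mem_ofPred_eq] at this
      have e : (σ / (|σ| + t + t')) • p + (t / (|σ| + t + t')) • q - (t' / (|σ| + t + t')) • q' =
          (|σ| + t + t')⁻¹ • (σ • p + t • q - t' • q') := by
        simp only [div_eq_inv_mul]
        module
      rw [e, norm_smul, Real.norm_of_nonneg (by positivity), ← div_eq_inv_mul,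
        le_div_iff₀ hs] at this
      exact this

theorem norm_le_abs_add_abs (y : E 2) : ‖y‖ ≤ |y 0| + |y 1| := by
  refine abs_le_of_sq_le_sq' ?_ (by positivity) |>.2
  rw [norm_sq_E2]
  nlinarith [sq_abs (y 0), sq_abs (y 1), abs_nonneg (y 0), abs_nonneg (y 1)]

/-- Whichever halves the two points lie in, the difference of the values is `σ • p + t • q - t' •
q'`, possibly with `q` and `q'` exchanged, where `t, t' ≥ 0`, `|σ|` is the distance of the first
coordinates and `t + t'` that of the second ones. Only the existence of `L` matters, so it may
degenerate with the angle between the triangles. -/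
theorem kiteMap_biLipschitz {a p q q' : E d}
    (h : ∀ σ t t' : ℝ, 0 ≤ t → 0 ≤ t' → σ • p + t • q - t' • q' = 0 → σ = 0 ∧ t = 0 ∧ t' = 0)
    (h' : ∀ σ t t' : ℝ, 0 ≤ t → 0 ≤ t' → σ • p + t • q' - t' • q = 0 → σ = 0 ∧ t = 0 ∧ t' = 0) :
    ∃ L : ℝ, ∀ x y : E 2, dist (kiteMap a p q q' x) (kiteMap a p q q' y) ≤ L * dist x y ∧
      dist x y ≤ L * dist (kiteMap a p q q' x) (kiteMap a p q q' y) := by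
  obtain ⟨κ₁, hκ₁, H₁⟩ := exists_transversality_const h
  obtain ⟨κ₂, hκ₂, H₂⟩ := exists_transversality_const h'
  set κ := min κ₁ κ₂
  have hκ : 0 < κ := lt_min hκ₁ hκ₂
  set r := ‖p‖ + ‖q‖ + ‖q'‖ with hr
  have hr0 : 0 ≤ r := by positivity
  set L := max (2 * r) κ⁻¹
  have hL0 : 0 ≤ L := le_max_of_le_left (by positivity)
  -- a representation of differences suffices
  have key : ∀ (v : E d) (x y : E 2) (σ t t' : ℝ), 0 ≤ t → 0 ≤ t' → |σ| = |(x - y) 0| →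
      t + t' = |(x - y) 1| → (v = σ • p + t • q - t' • q' ∨ v = σ • p + t • q' - t' • q) →
      ‖v‖ ≤ L * ‖x - y‖ ∧ ‖x - y‖ ≤ L * ‖v‖ := by
    intro v x y σ t t' ht ht' hσ htt hv
    have h0 := abs_coord_le_norm (x - y) 0
    have h1 := abs_coord_le_norm (x - y) 1
    have hκv : κ * (|σ| + t + t') ≤ ‖v‖ := by
      rcases hv with rfl | rfl
      · exact (mul_le_mul_of_nonneg_right (min_le_left _ _) (by positivity)).trans (H₁ σ t t' ht ht')
      · exact (mul_le_mul_of_nonneg_right (min_le_right _ _) (by positivity)).trans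
          (H₂ σ t t' ht ht')
    have hvr : ‖v‖ ≤ r * (|σ| + t + t') := by
      have aux : ∀ q q' : E d, ‖σ • p + t • q - t' • q'‖ ≤ |σ| * ‖p‖ + t * ‖q‖ + t' * ‖q'‖ := by
        intro q q'
        refine (norm_sub_le _ _).trans (add_le_add ((norm_add_le _ _).trans (add_le_add ?_ ?_)) ?_)
        · rw [norm_smul, Real.norm_eq_abs]
        · rw [norm_smul, Real.norm_of_nonneg ht]
        · rw [norm_smul, Real.norm_of_nonneg ht']
      have := norm_nonneg p
      have := norm_nonneg q
      have := norm_nonneg q'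
      have := abs_nonneg σ
      rcases hv with rfl | rfl
      · refine (aux q q').trans ?_
        rw [hr]
        nlinarith [mul_nonneg ht (norm_nonneg p), mul_nonneg ht' (norm_nonneg p),
          mul_nonneg ht (norm_nonneg q'), mul_nonneg ht' (norm_nonneg q),
          mul_nonneg (abs_nonneg σ) (norm_nonneg q), mul_nonneg (abs_nonneg σ) (norm_nonneg q')]
      · refine (aux q' q).trans ?_
        rw [hr]
        nlinarith [mul_nonneg ht (norm_nonneg p), mul_nonneg ht' (norm_nonneg p),
          mul_nonneg ht (norm_nonneg q), mul_nonneg ht' (norm_nonneg q'),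
          mul_nonneg (abs_nonneg σ) (norm_nonneg q), mul_nonneg (abs_nonneg σ) (norm_nonneg q')]
    have hsum : |σ| + t + t' = |(x - y) 0| + |(x - y) 1| := by rw [hσ, add_assoc, htt]
    rw [hsum] at hκv hvr
    constructor
    · calc ‖v‖ ≤ r * (|(x - y) 0| + |(x - y) 1|) := hvr
        _ ≤ r * (‖x - y‖ + ‖x - y‖) := by gcongr
        _ = 2 * r * ‖x - y‖ := by ring
        _ ≤ L * ‖x - y‖ := by gcongr; exact le_max_left _ _
    · calc ‖x - y‖ ≤ |(x - y) 0| + |(x - y) 1| := norm_le_abs_add_abs _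
        _ ≤ κ⁻¹ * ‖v‖ := by rw [← div_eq_inv_mul, le_div_iff₀ hκ]; linarith
        _ ≤ L * ‖v‖ := by gcongr; exact le_max_right _ _
  refine ⟨L, fun x y => ?_⟩
  rw [dist_eq_norm, dist_eq_norm]
  have c0 : (x - y) 0 = x 0 - y 0 := rfl
  have c1 : (x - y) 1 = x 1 - y 1 := rfl
  rcases le_or_gt 0 (x 1) with hx | hx <;> rcases le_or_gt 0 (y 1) with hy | hy
  · rw [kiteMap_of_nonneg hx, kiteMap_of_nonneg hy, para_sub_para, edgeMap_apply]
    rcases le_total 0 ((x - y) 1) with h1 | h1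
    · exact key _ x y ((x - y) 0) ((x - y) 1) 0 h1 le_rfl rfl (by rw [abs_of_nonneg h1, add_zero])
        (Or.inl (by module))
    · exact key _ x y ((x - y) 0) 0 (-(x - y) 1) le_rfl (by linarith) rfl
        (by rw [abs_of_nonpos h1, zero_add]) (Or.inr (by module))
  · rw [kiteMap_of_nonneg hx, kiteMap_of_neg hy]
    refine key _ x y ((x - y) 0) (x 1) (-y 1) hx (by linarith) rfl ?_ (Or.inl ?_)
    · rw [c1, abs_of_nonneg (by linarith)]; ring
    · rw [para_apply, para_apply, c0]; module
  · rw [kiteMap_of_neg hx, kiteMap_of_nonneg hy]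
    refine key _ x y ((x - y) 0) (-x 1) (y 1) (by linarith) hy rfl ?_ (Or.inr ?_)
    · rw [c1, abs_of_nonpos (by linarith)]; ring
    · rw [para_apply, para_apply, c0]; module
  · rw [kiteMap_of_neg hx, kiteMap_of_neg hy, para_sub_para, edgeMap_apply]
    rcases le_total 0 ((x - y) 1) with h1 | h1
    · exact key _ x y ((x - y) 0) 0 ((x - y) 1) le_rfl h1 rfl (by rw [abs_of_nonneg h1, zero_add])
        (Or.inl (by module))
    · exact key _ x y ((x - y) 0) (-(x - y) 1) 0 (by linarith) le_rfl rfl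
        (by rw [abs_of_nonpos h1, add_zero]) (Or.inr (by module))

section Mesh

variable {Ω : Set (E d)} {𝒯 : Finset (Finset (E d))}

/-- This chart lets the weak gradient see across the edge. It is what links the values of `u` on the
two triangles. -/
theorem isChart_kiteMap (hM : IsMesh Ω 𝒯) (hB : ResolvesBoundary Ω 𝒯)
    {a b c c' : E d} (hT : {a, b, c} ∈ 𝒯) (hT' : {a, b, c'} ∈ 𝒯) (hab : a ≠ b) (hac : a ≠ c)
    (hbc : b ≠ c) (hac' : a ≠ c') (hbc' : b ≠ c') (hcc : c ≠ c') (hΩ : openSegment ℝ a b ⊆ Ω) :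
    IsChart Ω kite (kiteMap a (b - a) (c - a) (c' - a)) := by
  refine ⟨isOpen_kite, ?_, ?_⟩
  · rintro y ⟨h0, h1, h2⟩
    rcases lt_trichotomy (y 1) 0 with h | h | h
    · rw [kiteMap_of_neg h]
      have : para a (b - a) (-(c' - a)) y ∈ para a (b - a) (-(c' - a)) '' refFlip :=
        mem_image_of_mem _ ⟨h0, h, h2⟩
      rw [para_neg_image] at this
      obtain ⟨z, hz, hzy⟩ := this
      rw [← hzy]
      exact hM.para_mem hB hT' hab hac' hbc' hz
    · rw [kiteMap_of_nonneg h.ge, para_apply]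
      apply hΩ
      rw [openSegment_eq_image']
      exact ⟨y 0, ⟨h0, by linarith⟩, by simp [h]⟩
    · rw [kiteMap_of_nonneg h.le]
      exact hM.para_mem hB hT hab hac hbc ⟨h0, h, h1⟩
  · obtain ⟨L, hL⟩ := kiteMap_biLipschitz (a := a) (p := b - a) (q := c - a) (q' := c' - a)
      (fun σ t t' h1 h2 h3 => hM.transversal hT hT' hab hac hbc hac' hbc' hcc h1 h2 h3)
      (fun σ t t' h1 h2 h3 => hM.transversal hT' hT hab hac' hbc' hac hbc hcc.symm h1 h2 h3)
    exact ⟨L, fun x _ y _ => hL x y⟩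

/-- The mean values of an `H¹` function on two triangles with a common edge inside `Ω`. -/
theorem HasH1Gradient.triAvg_sub_triAvg_sq_le (hM : IsMesh Ω 𝒯) (hB : ResolvesBoundary Ω 𝒯)
    {u : E d → ℝ} {g : E d → E d} (hu : HasH1Gradient Ω u g)
    {a b c c' : E d} (hT : {a, b, c} ∈ 𝒯) (hT' : {a, b, c'} ∈ 𝒯) (hab : a ≠ b) (hac : a ≠ c)
    (hbc : b ≠ c) (hac' : a ≠ c') (hbc' : b ≠ c') (hcc : c ≠ c') (hΩ : openSegment ℝ a b ⊆ Ω)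
    {r r' : ℝ} (hp : ‖b - a‖ ≤ r) (hq : ‖c - a‖ ≤ r) (hp' : ‖b - a‖ ≤ r') (hq' : ‖c' - a‖ ≤ r') :
    refArea ^ 2 * (triAvg {a, b, c} u - triAvg {a, b, c'} u) ^ 2 ≤
      4 * poincareConst *
        (r ^ 2 / parArea (b - a) (c - a) * ∫ x in tri {a, b, c}, ‖g x‖ ^ 2 ∂μHE[2] +
          r' ^ 2 / parArea (b - a) (c' - a) * ∫ x in tri {a, b, c'}, ‖g x‖ ^ 2 ∂μHE[2]) := by
  have hl := hM.linearIndependent hT hab hac hbc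
  have hl' := hM.linearIndependent hT' hab hac' hbc'
  have hw := memLp_tri_comp hab hac hbc hl (hu.memLp.mono_measure (hM.restrict_tri_le hB hT))
  have hg := memLp_tri_comp hab hac hbc hl (hu.memLp_grad.mono_measure (hM.restrict_tri_le hB hT))
  have hw' := memLp_tri_comp_flip hab hac' hbc' hl'
    (hu.memLp.mono_measure (hM.restrict_tri_le hB hT'))
  have hg' := memLp_tri_comp_flip hab hac' hbc' hl'
    (hu.memLp_grad.mono_measure (hM.restrict_tri_le hB hT'))
  set χ := kiteMap a (b - a) (c - a) (c' - a) with hχ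
  have e1 : EqOn χ (para a (b - a) (c - a)) refOpen := fun y hy => kiteMap_of_nonneg hy.2.1.le
  have e2 : EqOn χ (para a (b - a) (-(c' - a))) refFlip := fun y hy => kiteMap_of_neg hy.2.1
  have hwk : MemLp (fun y => u (χ y)) 2 (volume.restrict kite) :=
    memLp_kite hw hw' (fun y hy => congrArg u (e1 hy)) (fun y hy => congrArg u (e2 hy))
  have hgk : MemLp (fun y => g (χ y)) 2 (volume.restrict kite) :=
    memLp_kite hg hg' (fun y hy => congrArg g (e1 hy)) (fun y hy => congrArg g (e2 hy))
  -- Each half has its own diameter bound, so that each triangle is weighted by its own ratio of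
  -- squared diameter to area, whatever the sizes of the two triangles.
  let b' : E 2 → ℝ := fun y => 2 * (if 0 ≤ y 1 then r else r') * ‖g (χ y)‖
  have eb1 : EqOn b' (fun y => 2 * r * ‖g (para a (b - a) (c - a) y)‖) refOpen := by
    intro y hy
    simp only [b', if_pos hy.2.1.le, e1 hy]
  have eb2 : EqOn b' (fun y => 2 * r' * ‖g (para a (b - a) (-(c' - a)) y)‖) refFlip := by
    intro y hy
    simp only [b', if_neg hy.2.1.not_ge, e2 hy]
  have hbk : MemLp b' 2 (volume.restrict kite) :=
    memLp_kite (hg.norm.const_mul (2 * r)) (hg'.norm.const_mul (2 * r')) eb1 eb2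
  have H := hu.chart_lintegral_le (isChart_kiteMap hM hB hT hT' hab hac hbc hac' hbc' hcc hΩ)
    convex_kite kite_subset_closedBall hwk hgk.aestronglyMeasurable hbk (by
      rw [← Measure.restrict_congr_set kite_ae_eq]
      refine (ae_restrict_iff' (isOpen_refOpen.union isOpen_refFlip).measurableSet).2
        (ae_of_all _ fun y hy h => ?_)
      rcases hy with hy | hy
      · rw [(hasFDerivAt_kiteMap_of_pos hy.2.1).fderiv]
        simp only [b', if_pos hy.2.1.le]
        exact abs_inner_edgeMap_le _ _ hp hq _ h
      · rw [(hasFDerivAt_kiteMap_of_neg hy.2.1).fderiv]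
        simp only [b', if_neg hy.2.1.not_ge]
        exact abs_inner_edgeMap_le _ _ hp' (by rwa [norm_neg]) _ h)
  -- Keeping `x` in one half and `y` in the other only decreases the double integral, and this part
  -- already controls the difference of the two means.
  have H2 : ∫⁻ x in refOpen, ∫⁻ y in refFlip, ‖u (χ y) - u (χ x)‖ₑ ^ 2 ≤
      ENNReal.ofReal (poincareConst * ∫ y in kite, b' y ^ 2) := by
    refine le_trans ?_ H
    refine (lintegral_mono fun x => lintegral_mono_set refFlip_subset_kite).trans ?_
    exact lintegral_mono_set refOpen_subset_kite
  have hfin : IsFiniteMeasure ((volume : Measure (E 2)).restrict kite) := ⟨by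
    rw [Measure.restrict_apply_univ]
    exact (measure_mono kite_subset_closedBall).trans_lt
      (isCompact_closedBall (0 : E 2) 2).measure_lt_top⟩
  have hfin1 : IsFiniteMeasure ((volume : Measure (E 2)).restrict refOpen) :=
    isFiniteMeasure_of_le _ (Measure.restrict_mono refOpen_subset_kite le_rfl)
  have hfin2 : IsFiniteMeasure ((volume : Measure (E 2)).restrict refFlip) :=
    isFiniteMeasure_of_le _ (Measure.restrict_mono refFlip_subset_kite le_rfl)
  have hv1 : ((volume : Measure (E 2)).restrict refOpen).real univ = refArea := by
    rw [measureReal_restrict_apply_univ, measureReal_refOpen]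
  have hv2 : ((volume : Measure (E 2)).restrict refFlip).real univ = refArea := by
    rw [measureReal_restrict_apply_univ, measureReal_refFlip]
  have H3 := average_sub_average_sq_le
    (hwk.mono_measure (Measure.restrict_mono refOpen_subset_kite le_rfl))
    (hwk.mono_measure (Measure.restrict_mono refFlip_subset_kite le_rfl))
    (by rw [hv1]; exact refArea_pos) (by rw [hv2]; exact refArea_pos)
    (mul_nonneg poincareConst_nonneg (integral_nonneg fun y => sq_nonneg _)) H2
  rw [hv1, hv2] at H3
  have i1 : ∫ y in refOpen, u (χ y) = ∫ y in refOpen, u (para a (b - a) (c - a) y) :=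
    setIntegral_congr_fun isOpen_refOpen.measurableSet fun y hy => congrArg u (e1 hy)
  have i2 : ∫ y in refFlip, u (χ y) = ∫ y in refFlip, u (para a (b - a) (-(c' - a)) y) :=
    setIntegral_congr_fun isOpen_refFlip.measurableSet fun y hy => congrArg u (e2 hy)
  rw [i1, i2, ← triAvg_eq hab hac hbc hl, ← triAvg_eq_flip hab hac' hbc' hl'] at H3
  rw [setIntegral_kite hbk.integrable_sq,
    setIntegral_congr_fun isOpen_refOpen.measurableSet fun y hy => congrArg (· ^ 2) (eb1 hy),
    setIntegral_congr_fun isOpen_refFlip.measurableSet fun y hy => congrArg (· ^ 2) (eb2 hy)] at H3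
  simp only [mul_pow, integral_const_mul] at H3
  rw [setIntegral_tri hab hac hbc hl, setIntegral_tri_flip hab hac' hbc' hl']
  have hD := parArea_pos hl
  have hD' := parArea_pos hl'
  refine (le_of_eq ?_).trans (H3.trans (le_of_eq ?_))
  · ring
  · field_simp
    ring

end Mesh

end P1FEM

/-! ### Triangles around a node and the quasi-interpolant -/

namespace P1FEM

open Set Topology

variable {d : ℕ} {Ω : Set (E d)} {𝒯 : Finset (Finset (E d))}

theorem IsMesh.mem_of_mem_tri (hM : IsMesh Ω 𝒯) {S T : Finset (E d)} (hS : S ∈ 𝒯) (hT : T ∈ 𝒯)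
    {z : E d} (hz : z ∈ T) (h : z ∈ tri S) : z ∈ S := by
  have h1 := hM.convexHull_inter_convexHull hT hS (e := {z}) (by simpa using hz) subset_rfl
    ⟨by simp, h⟩
  by_contra hzS
  have : (({z} : Finset (E d)) : Set (E d)) ∩ S = ∅ := by
    ext w
    simp only [Finset.coe_singleton, mem_inter_iff, mem_singleton_iff, Finset.mem_coe,
      mem_empty_iff_false, iff_false, not_and]
    rintro rfl
    exact hzS
  rw [this] at h1
  simp at h1

theorem IsMesh.shareEdgeAt (hM : IsMesh Ω 𝒯) {S T : Finset (E d)} (hS : S ∈ 𝒯) (hT : T ∈ 𝒯)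
    (hne : S ≠ T) {x z : E d} (hxS : x ∈ tri S) (hxT : x ∈ tri T) (hxz : x ≠ z) (hzS : z ∈ S)
    (hzT : z ∈ T) : ShareEdgeAt z S T := by
  rcases hM.mem_inter_cases hS hT hne hxS hxT with ⟨h1, h2⟩ | ⟨y, w, hyw, h1, h2, h3, h4, -⟩
  · exact ⟨x, hxz, hzS, h1, hzT, h2⟩
  · by_cases hy : y = z
    · exact ⟨w, fun h => hyw (hy.trans h.symm), hzS, h2, hzT, h4⟩
    · exact ⟨y, hy, hzS, h1, hzT, h3⟩

theorem IsMesh.exists_mem_ne (hM : IsMesh Ω 𝒯) {T : Finset (E d)} (hT : T ∈ 𝒯) (z : E d) :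
    ∃ y ∈ T, y ≠ z :=
  Finset.exists_mem_ne (by rw [hM.card_eq T hT]; norm_num) z

/-- In the plane, the triangles around an interior node are connected through edges. -/
theorem IsMesh.reflTransGen_of_isOpen {Ω : Set (E 2)} {𝒯 : Finset (Finset (E 2))}
    (hM : IsMesh Ω 𝒯) (hΩ : IsOpen Ω) {z : E 2} (hz : z ∈ Ω) {T T' : Finset (E 2)} (hT : T ∈ 𝒯)
    (hT' : T' ∈ 𝒯) (hzT : z ∈ T) (hzT' : z ∈ T') :
    Relation.ReflTransGen (fun A B => B ∈ 𝒯 ∧ ShareEdgeAt z A B) T T' := by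
  classical
  set R := Relation.ReflTransGen (fun A B => B ∈ 𝒯 ∧ ShareEdgeAt z A B) T with hR
  by_contra hcon
  -- The circle is chosen so small that it lies in `Ω`, avoids all triangles not containing `z`, and
  -- surrounds no other vertex, so that each triangle at `z` meets it. Being connected, it cannot be
  -- split between the reached and the unreached triangles at `z`, both closed families; a common
  -- point differs from `z` and so forces a shared edge at `z`.
  let K : Set (E 2) := ⋃ S ∈ 𝒯.filter (z ∉ ·), tri S
  have hK : IsClosed K := isClosed_biUnion_finset fun S _ => isClosed_tri S
  have hzK : z ∉ K := by
    simp only [K, mem_iUnion, not_exists, Finset.mem_filter]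
    intro S hS h
    exact hS.2 (hM.mem_of_mem_tri hS.1 hT hzT h)
  let V : Finset (E 2) := (𝒯.biUnion id).erase z
  have hO : IsOpen (Ω ∩ Kᶜ ∩ (V : Set (E 2))ᶜ) :=
    (hΩ.inter hK.isOpen_compl).inter V.finite_toSet.isClosed.isOpen_compl
  obtain ⟨ρ, hρ, hball⟩ := Metric.isOpen_iff.1 hO z ⟨⟨hz, hzK⟩, by simp [V]⟩
  set r := ρ / 2 with hr
  have hr0 : 0 < r := by positivity
  have hsph : Metric.sphere z r ⊆ Ω ∩ Kᶜ := by
    intro x hx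
    refine (hball ?_).1
    rw [Metric.mem_sphere] at hx
    rw [Metric.mem_ball, hx]
    linarith
  have hmeet : ∀ S ∈ 𝒯, z ∈ S → (Metric.sphere z r ∩ tri S).Nonempty := by
    intro S hS hzS
    obtain ⟨y, hy, hyz⟩ := hM.exists_mem_ne hS z
    have hyr : r ≤ ‖y - z‖ := by
      by_contra hlt
      have : y ∈ Metric.ball z ρ := by
        rw [Metric.mem_ball, dist_eq_norm]
        linarith
      refine (hball this).2 ?_
      simp only [V, Finset.coe_erase, Finset.coe_biUnion, mem_sdiff, mem_iUnion, id]
      exact ⟨⟨S, hS, hy⟩, hyz⟩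
    have hpos : 0 < ‖y - z‖ := norm_pos_iff.2 (sub_ne_zero.2 hyz)
    refine ⟨z + (r / ‖y - z‖) • (y - z), ?_, ?_⟩
    · rw [Metric.mem_sphere, dist_eq_norm, add_sub_cancel_left, norm_smul,
        Real.norm_of_nonneg (by positivity)]
      field_simp
    · refine (convex_convexHull ℝ _).segment_subset (mem_tri_of_mem hzS) (mem_tri_of_mem hy) ?_
      rw [segment_eq_image']
      exact ⟨r / ‖y - z‖, ⟨by positivity, (div_le_one hpos).2 hyr⟩, rfl⟩
  have hrank : 1 < Module.rank ℝ (E 2) := by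
    rw [← Module.finrank_eq_rank, finrank_euclideanSpace_fin]
    norm_num
  obtain ⟨x, hxs, hx1, hx2⟩ := (isPreconnected_closed_iff.1 (isPreconnected_sphere hrank z r))
    (⋃ S ∈ 𝒯.filter (fun S => z ∈ S ∧ R S), tri S) (⋃ S ∈ 𝒯.filter (fun S => z ∈ S ∧ ¬ R S), tri S)
    (isClosed_biUnion_finset fun S _ => isClosed_tri S)
    (isClosed_biUnion_finset fun S _ => isClosed_tri S)
    (by
      intro x hx
      obtain ⟨hxΩ, hxK⟩ := hsph hx
      obtain ⟨S, hS, hxS⟩ := hM.exists_mem_tri hxΩ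
      have hzS : z ∈ S := by
        by_contra h
        apply hxK
        simp only [K, mem_iUnion, Finset.mem_filter]
        exact ⟨S, ⟨hS, h⟩, hxS⟩
      by_cases hRS : R S
      · left
        simp only [mem_iUnion, Finset.mem_filter]
        exact ⟨S, ⟨hS, hzS, hRS⟩, hxS⟩
      · right
        simp only [mem_iUnion, Finset.mem_filter]
        exact ⟨S, ⟨hS, hzS, hRS⟩, hxS⟩)
    (by
      obtain ⟨x, hx, hxT⟩ := hmeet T hT hzT
      refine ⟨x, hx, ?_⟩
      simp only [mem_iUnion, Finset.mem_filter]
      exact ⟨T, ⟨hT, hzT, Relation.ReflTransGen.refl⟩, hxT⟩)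
    (by
      obtain ⟨x, hx, hxT⟩ := hmeet T' hT' hzT'
      refine ⟨x, hx, ?_⟩
      simp only [mem_iUnion, Finset.mem_filter]
      exact ⟨T', ⟨hT', hzT', hcon⟩, hxT⟩)
  simp only [mem_iUnion, Finset.mem_filter] at hx1 hx2
  obtain ⟨S, ⟨hS, hzS, hRS⟩, hxS⟩ := hx1
  obtain ⟨S', ⟨hS', hzS', hRS'⟩, hxS'⟩ := hx2
  refine hRS' (hRS.tail ⟨hS', hM.shareEdgeAt hS hS' ?_ hxS hxS' ?_ hzS hzS'⟩)
  · rintro rfl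
    exact hRS' hRS
  · rintro rfl
    simp at hxs
    exact hr0.ne hxs

theorem IsMeshedDomain.reflTransGen (h : IsMeshedDomain Ω 𝒯) {z : E d} (hz : z ∈ Ω)
    {T T' : Finset (E d)} (hT : T ∈ 𝒯) (hT' : T' ∈ 𝒯) (hzT : z ∈ T) (hzT' : z ∈ T') :
    Relation.ReflTransGen (fun A B => B ∈ 𝒯 ∧ ShareEdgeAt z A B) T T' := by
  obtain ⟨hM, hB, ⟨rfl, hO, -, -⟩ | ⟨rfl, -, hS⟩⟩ := h
  · exact hM.reflTransGen_of_isOpen hO hz hT hT' hzT hzT'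
  · exact hS.node z hz T hT T' hT' hzT hzT'

theorem dist_le_diam_tri {T : Finset (E d)} {y z : E d} (hy : y ∈ T) (hz : z ∈ T) :
    ‖y - z‖ ≤ Metric.diam (tri T) := by
  rw [← dist_eq_norm]
  exact Metric.dist_le_diam_of_mem (isCompact_tri T).isBounded (mem_tri_of_mem hy)
    (mem_tri_of_mem hz)

theorem IsMesh.diam_pos (hM : IsMesh Ω 𝒯) {T : Finset (E d)} (hT : T ∈ 𝒯) :
    0 < Metric.diam (tri T) := by
  obtain ⟨z, hz⟩ : T.Nonempty := Finset.card_pos.1 (by rw [hM.card_eq T hT]; norm_num)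
  obtain ⟨y, hy, hyz⟩ := hM.exists_mem_ne hT z
  exact (norm_pos_iff.2 (sub_ne_zero.2 hyz)).trans_le (dist_le_diam_tri hy hz)

theorem IsMesh.gamma_pos (hM : IsMesh Ω 𝒯) {γ : ℝ} (hS : IsShapeRegular γ 𝒯) {T : Finset (E d)}
    (hT : T ∈ 𝒯) : 0 < γ := by
  have h1 := hS.diam_sq_le T hT
  have h2 : 0 < Metric.diam (tri T) ^ 2 := by have := hM.diam_pos hT; positivity
  by_contra h
  have h3 : 0 ≤ (μHE[2]).real (tri T) := measureReal_nonneg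
  nlinarith

open Classical in
/-- The triangles of the mesh that contain the node `z`. -/
noncomputable def patch (𝒯 : Finset (Finset (E d))) (z : E d) : Finset (Finset (E d)) :=
  𝒯.filter (z ∈ ·)

theorem mem_patch {z : E d} {T : Finset (E d)} : T ∈ patch 𝒯 z ↔ T ∈ 𝒯 ∧ z ∈ T := by
  simp [patch]

/-- An area count: every triangle at `z` is shrunk towards `z` to the smallest diameter `r` in the
patch. The copies stay in their triangles, hence overlap in null sets only, lie in the ball of
radius `r`, and each has area at least `r ^ 2 / γ`. -/
theorem IsMesh.card_patch_le_planar {Ω : Set (E 2)} {𝒯 : Finset (Finset (E 2))} {γ : ℝ}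
    (hM : IsMesh Ω 𝒯) (hS : IsShapeRegular γ 𝒯) {T : Finset (E 2)} (hT : T ∈ 𝒯) {z : E 2}
    (hz : z ∈ T) :
    ((patch 𝒯 z).card : ℝ) ≤ γ * volume.real (Metric.closedBall (0 : E 2) 1) := by
  have hγ := hM.gamma_pos hS hT
  have hne : (patch 𝒯 z).Nonempty := ⟨T, mem_patch.2 ⟨hT, hz⟩⟩
  obtain ⟨T₀, hT₀, hmin⟩ := (patch 𝒯 z).exists_min_image (fun S => Metric.diam (tri S)) hne
  set r := Metric.diam (tri T₀) with hr
  have hr0 : 0 < r := hM.diam_pos (mem_patch.1 hT₀).1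
  let f : Finset (E 2) → Set (E 2) := fun S =>
    AffineMap.homothety z (r / Metric.diam (tri S)) '' tri S
  have hfS : ∀ S ∈ patch 𝒯 z, f S ⊆ tri S ∧ f S ⊆ Metric.closedBall z r := by
    intro S hS'
    obtain ⟨hS1, hzS⟩ := mem_patch.1 hS'
    have hd := hM.diam_pos hS1
    constructor
    · rintro _ ⟨x, hx, rfl⟩
      rw [AffineMap.homothety_eq_lineMap]
      exact (convex_convexHull ℝ _).lineMap_mem (mem_tri_of_mem hzS) hx
        ⟨by positivity, (div_le_one hd).2 (hmin S hS')⟩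
    · rintro _ ⟨x, hx, rfl⟩
      rw [Metric.mem_closedBall, dist_comm, dist_center_homothety, Real.norm_of_nonneg (by positivity)]
      have := Metric.dist_le_diam_of_mem (isCompact_tri S).isBounded (mem_tri_of_mem hzS) hx
      rw [div_mul_eq_mul_div, div_le_iff₀ hd]
      gcongr
  have hfm : ∀ S ∈ patch 𝒯 z, IsClosed (f S) := by
    intro S _
    refine ((isCompact_tri S).image ?_).isClosed
    exact AffineMap.continuous_of_finiteDimensional _
  have hfv : ∀ S ∈ patch 𝒯 z, ENNReal.ofReal (r ^ 2 / γ) ≤ μHE[2] (f S) := by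
    intro S hS'
    obtain ⟨hS1, hzS⟩ := mem_patch.1 hS'
    have hd := hM.diam_pos hS1
    have hfin : μHE[2] (tri S) ≠ ⊤ := by
      rw [EuclideanSpace.euclideanHausdorffMeasure_eq_volume]
      exact (isCompact_tri S).measure_lt_top.ne
    rw [euclideanHausdorffMeasure_homothety_image 2 z (by positivity : r / Metric.diam (tri S) ≠ 0),
      ENNReal.smul_def, smul_eq_mul, ← ENNReal.ofReal_toReal hfin, ENNReal.coe_pow,
      ← enorm_eq_nnnorm, enorm_sq_eq_ofReal, ← ENNReal.ofReal_mul (by positivity)]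
    apply ENNReal.ofReal_le_ofReal
    have h1 := hS.diam_sq_le S hS1
    rw [measureReal_def] at h1
    rw [div_pow, div_mul_eq_mul_div, div_le_div_iff₀ hγ (by positivity)]
    nlinarith [mul_le_mul_of_nonneg_left h1 (sq_nonneg r)]
  have hsum : ∑ S ∈ patch 𝒯 z, μHE[2] (f S) = μHE[2] (⋃ S ∈ patch 𝒯 z, f S) := by
    refine (measure_biUnion_finset₀ ?_ fun S hS' => (hfm S hS').measurableSet.nullMeasurableSet).symm
    intro S hS' S' hS'' hne'
    refine measure_mono_null ?_ (measure_skeleton 𝒯)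
    rintro x ⟨hx, hx'⟩
    by_contra hxs
    exact hne' (hM.eq_of_notMem_skeleton (mem_patch.1 hS').1 (mem_patch.1 hS'').1 hxs
      ((hfS S hS').1 hx) ((hfS S' hS'').1 hx'))
  have hle : ((patch 𝒯 z).card : ENNReal) * ENNReal.ofReal (r ^ 2 / γ) ≤
      volume (Metric.closedBall z r) := by
    calc _ = ∑ S ∈ patch 𝒯 z, ENNReal.ofReal (r ^ 2 / γ) := by simp
      _ ≤ ∑ S ∈ patch 𝒯 z, μHE[2] (f S) := Finset.sum_le_sum hfv
      _ = μHE[2] (⋃ S ∈ patch 𝒯 z, f S) := hsum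
      _ ≤ μHE[2] (Metric.closedBall z r) :=
        measure_mono (iUnion₂_subset fun S hS' => (hfS S hS').2)
      _ = _ := by rw [EuclideanSpace.euclideanHausdorffMeasure_eq_volume]
  rw [Measure.addHaar_closedBall' volume z hr0.le, finrank_euclideanSpace_fin] at hle
  have hV : volume (Metric.closedBall (0 : E 2) 1) ≠ ⊤ :=
    (isCompact_closedBall (0 : E 2) 1).measure_lt_top.ne
  have := ENNReal.toReal_mono (ENNReal.mul_ne_top ENNReal.ofReal_ne_top hV) hle
  rw [ENNReal.toReal_mul, ENNReal.toReal_mul, ENNReal.toReal_ofReal (by positivity),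
    ENNReal.toReal_ofReal (by positivity), ENNReal.toReal_natCast, ← measureReal_def,
    mul_div_assoc', div_le_iff₀ hγ] at this
  have hr2 : 0 < r ^ 2 := by positivity
  nlinarith

/-- A bound for the number of triangles at a node, in terms of the shape regularity. -/
noncomputable def valence (γ : ℝ) : ℝ := |γ| * (1 + volume.real (Metric.closedBall (0 : E 2) 1))

theorem IsMeshedDomain.card_patch_le {γ : ℝ} (h : IsMeshedDomain Ω 𝒯)
    (hS : IsShapeRegular γ 𝒯) {T : Finset (E d)} (hT : T ∈ 𝒯) {z : E d} (hz : z ∈ T) :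
    ((patch 𝒯 z).card : ℝ) ≤ valence γ := by
  have hV : 0 ≤ volume.real (Metric.closedBall (0 : E 2) 1) := measureReal_nonneg
  have hγ := le_abs_self γ
  have hγ' := abs_nonneg γ
  obtain ⟨hM, hB, ⟨rfl, hO, -, -⟩ | ⟨rfl, -, -⟩⟩ := h
  · refine (hM.card_patch_le_planar hS hT hz).trans ?_
    unfold valence
    nlinarith
  · have h1 := hS.valence_le rfl T hT z hz
    have h2 : {T' | T' ∈ 𝒯 ∧ z ∈ T'}.ncard = (patch 𝒯 z).card := by
      rw [← Set.ncard_coe_finset]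
      congr 1
      ext S
      simp [mem_patch]
    rw [h2] at h1
    refine h1.trans ?_
    unfold valence
    nlinarith

/-- Adjacency of triangles through an edge at `z` that runs inside `Ω`. -/
def edgeGraph (Ω : Set (E d)) (𝒯 : Finset (Finset (E d))) (z : E d) :
    SimpleGraph (Finset (E d)) where
  Adj A B := A ≠ B ∧ A ∈ 𝒯 ∧ B ∈ 𝒯 ∧ z ∈ A ∧ z ∈ B ∧
    ∃ y, y ≠ z ∧ y ∈ A ∧ y ∈ B ∧ openSegment ℝ z y ⊆ Ω
  symm := ⟨fun _ _ ⟨h1, h2, h3, h4, h5, y, h6, h7, h8, h9⟩ =>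
    ⟨h1.symm, h3, h2, h5, h4, y, h6, h8, h7, h9⟩⟩
  loopless := ⟨fun _ h => h.1 rfl⟩

/-- A shared edge that ends at a node of `Ω` has its relative interior in `Ω`, because the boundary
contains edges only together with their end points. Thus every step of the chain is an adjacency. -/
theorem IsMeshedDomain.reachable (h : IsMeshedDomain Ω 𝒯) {z : E d} (hz : z ∈ Ω)
    {T T' : Finset (E d)} (hT : T ∈ 𝒯) (hT' : T' ∈ 𝒯) (hzT : z ∈ T) (hzT' : z ∈ T') :
    (edgeGraph Ω 𝒯 z).Reachable T T' := by
  have h1 := h.reflTransGen hz hT hT' hzT hzT'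
  have : ∀ S, Relation.ReflTransGen (fun A B => B ∈ 𝒯 ∧ ShareEdgeAt z A B) T S →
      S ∈ 𝒯 ∧ (edgeGraph Ω 𝒯 z).Reachable T S := by
    intro S hS
    induction hS with
    | refl => exact ⟨hT, SimpleGraph.Reachable.refl _⟩
    | @tail A B _ hst ih =>
      obtain ⟨hB, y, hyz, hzA, hyA, hzB, hyB⟩ := hst
      refine ⟨hB, ?_⟩
      by_cases hAB : A = B
      · exact hAB ▸ ih.2
      · refine ih.2.trans (SimpleGraph.Adj.reachable ?_)
        exact ⟨hAB, ih.1, hB, hzA, hzB, y, hyz, hyA, hyB,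
          h.1.openSegment_subset_of_mem h.2.1 hB hyz.symm hzB hyB (left_mem_segment _ _ _) hz⟩
  exact (this _ h1).2

theorem IsMesh.exists_third (hM : IsMesh Ω 𝒯) {T : Finset (E d)} (hT : T ∈ 𝒯) {a b : E d}
    (ha : a ∈ T) (hb : b ∈ T) (hab : a ≠ b) : ∃ c, a ≠ c ∧ b ≠ c ∧ T = {a, b, c} := by
  have h3 := hM.card_eq T hT
  have h1 : ((T.erase a).erase b).card = 1 := by
    rw [Finset.card_erase_of_mem (Finset.mem_erase.2 ⟨hab.symm, hb⟩), Finset.card_erase_of_mem ha, h3]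
  obtain ⟨c, hc⟩ := Finset.card_eq_one.1 h1
  have hcm : c ∈ (T.erase a).erase b := by rw [hc]; simp
  simp only [Finset.mem_erase] at hcm
  refine ⟨c, hcm.2.1.symm, hcm.1.symm, ?_⟩
  rw [← Finset.insert_erase ha, ← Finset.insert_erase (Finset.mem_erase.2 ⟨hab.symm, hb⟩), hc]

theorem IsMesh.exists_vertices (hM : IsMesh Ω 𝒯) {T : Finset (E d)} (hT : T ∈ 𝒯) :
    ∃ a b c, a ≠ b ∧ a ≠ c ∧ b ≠ c ∧ T = {a, b, c} :=
  Finset.card_eq_three.1 (hM.card_eq T hT)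

/-- The squared `L²` norm of the vector field `g` on the triangle `T`. -/
noncomputable def gradSq (g : E d → E d) (T : Finset (E d)) : ℝ := ∫ x in tri T, ‖g x‖ ^ 2 ∂μHE[2]

theorem gradSq_nonneg (g : E d → E d) (T : Finset (E d)) : 0 ≤ gradSq g T :=
  integral_nonneg fun _ => by positivity

/-- The kite estimate with the squared diameter over `parArea` bounded by `γ * refArea`; no power of
the mesh width survives. The absolute value keeps the constant nonnegative for every real `γ`. -/
noncomputable def jumpConst (γ : ℝ) : ℝ := 4 * poincareConst * |γ| / refArea

theorem jumpConst_nonneg (γ : ℝ) : 0 ≤ jumpConst γ := by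
  have := poincareConst_nonneg
  have := refArea_pos
  unfold jumpConst
  positivity

theorem HasH1Gradient.triAvg_sub_sq_le_of_adj {γ : ℝ} (hM : IsMesh Ω 𝒯)
    (hB : ResolvesBoundary Ω 𝒯) (hS : IsShapeRegular γ 𝒯) {u : E d → ℝ} {g : E d → E d}
    (hu : HasH1Gradient Ω u g) {z : E d} {A B : Finset (E d)} (h : (edgeGraph Ω 𝒯 z).Adj A B) :
    (triAvg A u - triAvg B u) ^ 2 ≤ jumpConst γ * ∑ S ∈ patch 𝒯 z, gradSq g S := by
  obtain ⟨hAB, hA, hB', hzA, hzB, y, hyz, hyA, hyB, hseg⟩ := h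
  have hγ := hM.gamma_pos hS hA
  have hsum : gradSq g A + gradSq g B ≤ ∑ S ∈ patch 𝒯 z, gradSq g S := by
    rw [← Finset.sum_pair hAB]
    refine Finset.sum_le_sum_of_subset_of_nonneg ?_ fun S _ _ => gradSq_nonneg g S
    intro S hS
    simp only [Finset.mem_insert, Finset.mem_singleton] at hS
    rcases hS with rfl | rfl
    · exact mem_patch.2 ⟨hA, hzA⟩
    · exact mem_patch.2 ⟨hB', hzB⟩
  refine le_trans ?_ (mul_le_mul_of_nonneg_left hsum (jumpConst_nonneg γ))
  have hratio : ∀ c, z ≠ c → y ≠ c → {z, y, c} ∈ 𝒯 →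
      Metric.diam (tri {z, y, c}) ^ 2 / parArea (y - z) (c - z) ≤ γ * refArea := by
    intro c hzc hyc hT
    have hD := parArea_pos (hM.linearIndependent hT hyz.symm hzc hyc)
    have h1 := hS.diam_sq_le _ hT
    rw [measureReal_tri hyz.symm hzc hyc] at h1
    rw [div_le_iff₀ hD]
    linarith
  obtain ⟨c, hzc, hyc, rfl⟩ := hM.exists_third hA hzA hyA hyz.symm
  obtain ⟨c', hzc', hyc', rfl⟩ := hM.exists_third hB' hzB hyB hyz.symm
  have hcc : c ≠ c' := by
    rintro rfl
    exact hAB rfl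
  have h1 := hu.triAvg_sub_triAvg_sq_le hM hB hA hB' hyz.symm hzc hyc hzc' hyc' hcc hseg
    (dist_le_diam_tri hyA hzA) (dist_le_diam_tri (by simp) hzA)
    (dist_le_diam_tri hyB hzB) (dist_le_diam_tri (by simp) hzB)
  have h2 := mul_le_mul_of_nonneg_right (hratio c hzc hyc hA) (gradSq_nonneg g {z, y, c})
  have h3 := mul_le_mul_of_nonneg_right (hratio c' hzc' hyc' hB') (gradSq_nonneg g {z, y, c'})
  have hK := poincareConst_nonneg
  have hv := refArea_pos
  have h4 : refArea ^ 2 * (triAvg {z, y, c} u - triAvg {z, y, c'} u) ^ 2 ≤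
      4 * poincareConst * (γ * refArea * gradSq g {z, y, c} + γ * refArea * gradSq g {z, y, c'}) :=
    h1.trans (mul_le_mul_of_nonneg_left (add_le_add h2 h3) (by positivity))
  rw [jumpConst, abs_of_pos hγ, div_mul_eq_mul_div, le_div_iff₀ hv]
  nlinarith

theorem mem_of_walk {z : E d} {A B : Finset (E d)} (w : (edgeGraph Ω 𝒯 z).Walk A B)
    (hA : A ∈ patch 𝒯 z) : ∀ S ∈ w.support, S ∈ patch 𝒯 z := by
  induction w with
  | nil => simpa using hA
  | cons h w ih =>
    intro S hS
    rw [SimpleGraph.Walk.support_cons, List.mem_cons] at hS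
    rcases hS with rfl | hS
    · exact hA
    · exact ih (mem_patch.2 ⟨h.2.2.1, h.2.2.2.2.1⟩) S hS

theorem abs_sub_le_of_walk {z : E d} {A B : Finset (E d)} (w : (edgeGraph Ω 𝒯 z).Walk A B)
    {f : Finset (E d) → ℝ} {m : ℝ} (h : ∀ S S', (edgeGraph Ω 𝒯 z).Adj S S' → |f S - f S'| ≤ m) :
    |f A - f B| ≤ w.length * m := by
  induction w with
  | nil => simp
  | cons hadj w ih =>
    rw [SimpleGraph.Walk.length_cons]
    push_cast
    have := abs_sub_le (f _) (f _) (f _) |>.trans (add_le_add (h _ _ hadj) ih)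
    linarith

/-- A path stays in the patch and visits no triangle twice, so at most `valence γ` jumps add up. -/
theorem HasH1Gradient.triAvg_sub_sq_le_of_reachable {γ : ℝ} (hD : IsMeshedDomain Ω 𝒯)
    (hS : IsShapeRegular γ 𝒯) {u : E d → ℝ} {g : E d → E d}
    (hu : HasH1Gradient Ω u g) {z : E d} {A B : Finset (E d)} (hA : A ∈ patch 𝒯 z)
    (h : (edgeGraph Ω 𝒯 z).Reachable A B) :
    (triAvg A u - triAvg B u) ^ 2 ≤
      valence γ ^ 2 * (jumpConst γ * ∑ S ∈ patch 𝒯 z, gradSq g S) := by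
  classical
  obtain ⟨w⟩ := h
  set p := w.toPath with hp
  set M := jumpConst γ * ∑ S ∈ patch 𝒯 z, gradSq g S with hMdef
  have hM0 : 0 ≤ M := mul_nonneg (jumpConst_nonneg γ) (Finset.sum_nonneg fun S _ => gradSq_nonneg g S)
  have h1 := abs_sub_le_of_walk (p : (edgeGraph Ω 𝒯 z).Walk A B) (f := fun S => triAvg S u)
    (m := Real.sqrt M) (fun S S' hadj =>
      Real.abs_le_sqrt (hu.triAvg_sub_sq_le_of_adj hD.1 hD.2.1 hS hadj))
  have hlen : ((p : (edgeGraph Ω 𝒯 z).Walk A B).length : ℝ) ≤ valence γ := by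
    refine le_trans ?_ (hD.card_patch_le hS (mem_patch.1 hA).1 (mem_patch.1 hA).2)
    have hsub : (p : (edgeGraph Ω 𝒯 z).Walk A B).support.toFinset ⊆ patch 𝒯 z := fun S hS' =>
      mem_of_walk _ hA S (List.mem_toFinset.1 hS')
    have hc := Finset.card_le_card hsub
    rw [List.toFinset_card_of_nodup p.2.support_nodup, SimpleGraph.Walk.length_support] at hc
    exact_mod_cast (Nat.le_succ _).trans hc
  have h2 : |triAvg A u - triAvg B u| ≤ valence γ * Real.sqrt M :=
    h1.trans (mul_le_mul_of_nonneg_right hlen (Real.sqrt_nonneg _))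
  have h3 := pow_le_pow_left₀ (abs_nonneg _) h2 2
  rwa [sq_abs, mul_pow, Real.sq_sqrt hM0] at h3

/-- The nodal values of the quasi-interpolant of `u`. -/
noncomputable def quasiNodal (Ω : Set (E d)) (𝒯 : Finset (Finset (E d))) (u : E d → ℝ)
    (T : Finset (E d)) (z : E d) : ℝ :=
  triAvg ((edgeGraph Ω 𝒯 z).connectedComponentMk T).out u

theorem quasiNodal_eq_of_reachable {u : E d → ℝ} {z : E d} {T T' : Finset (E d)}
    (h : (edgeGraph Ω 𝒯 z).Reachable T T') : quasiNodal Ω 𝒯 u T z = quasiNodal Ω 𝒯 u T' z := by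
  rw [quasiNodal, quasiNodal, SimpleGraph.ConnectedComponent.sound h]

theorem reachable_out (z : E d) (T : Finset (E d)) :
    (edgeGraph Ω 𝒯 z).Reachable T ((edgeGraph Ω 𝒯 z).connectedComponentMk T).out :=
  SimpleGraph.ConnectedComponent.exact (Quot.out_eq _).symm

/-- Two triangles that share the node inside `Ω`, or an edge running inside `Ω`, lie in the same
component and therefore use the mean over the same representative. -/
theorem IsMeshedDomain.exists_quasiInterpolant (hD : IsMeshedDomain Ω 𝒯) (u : E d → ℝ) :
    ∃ J ∈ S1 Ω 𝒯, ∀ T ∈ 𝒯, ∀ x ∈ tri T ∩ Ω, J x = interp T (quasiNodal Ω 𝒯 u T) x := by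
  refine hD.1.exists_mem_S1 hD.2.1 _ ?_ ?_
  · intro z hz T hT T' hT' hzT hzT'
    exact quasiNodal_eq_of_reachable (hD.reachable hz hT hT' hzT hzT')
  · intro T hT T' hT' y z hyz hyT hzT hyT' hzT' hseg
    by_cases hne : T = T'
    · rw [hne]
    · refine quasiNodal_eq_of_reachable (SimpleGraph.Adj.reachable ?_)
      exact ⟨hne, hT, hT', hyT, hyT', z, hyz.symm, hzT, hzT', hseg⟩

theorem HasH1Gradient.quasiNodal_sub_sq_le {γ : ℝ} (hD : IsMeshedDomain Ω 𝒯)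
    (hS : IsShapeRegular γ 𝒯) {u : E d → ℝ} {g : E d → E d}
    (hu : HasH1Gradient Ω u g) {z : E d} {T : Finset (E d)} (hT : T ∈ 𝒯) (hz : z ∈ T) :
    (quasiNodal Ω 𝒯 u T z - triAvg T u) ^ 2 ≤
      valence γ ^ 2 * (jumpConst γ * ∑ S ∈ patch 𝒯 z, gradSq g S) := by
  rw [← neg_sub, neg_sq]
  exact hu.triAvg_sub_sq_le_of_reachable hD hS (mem_patch.2 ⟨hT, hz⟩) (reachable_out z T)

/-! ### Integration over the mesh and existence of the projection -/

theorem ResolvesBoundary.measurableSet (hB : ResolvesBoundary Ω 𝒯) : MeasurableSet Ω := by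
  have : Ω = closure Ω \ (closure Ω \ Ω) := by
    rw [sdiff_sdiff_right_self]
    exact (inf_eq_right.2 subset_closure).symm
  rw [this]
  exact isClosed_closure.measurableSet.diff hB.isClosed.measurableSet

theorem IsMesh.measure_tri_ne_top (hM : IsMesh Ω 𝒯) {T : Finset (E d)} (hT : T ∈ 𝒯) :
    μHE[2] (tri T) ≠ ⊤ := by
  obtain ⟨a, b, c, hab, hac, hbc, rfl⟩ := hM.exists_vertices hT
  rw [tri_eq_para_image hab hac hbc, measure_para_image]
  exact ENNReal.mul_ne_top ENNReal.ofReal_ne_top volume_refTri_lt_top.ne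

theorem IsMesh.isFiniteMeasure_tri (hM : IsMesh Ω 𝒯) {T : Finset (E d)} (hT : T ∈ 𝒯) :
    IsFiniteMeasure ((μHE[2]).restrict (tri T)) :=
  ⟨by rw [Measure.restrict_apply_univ]; exact (hM.measure_tri_ne_top hT).lt_top⟩

theorem IsMesh.isFiniteMeasure (hM : IsMesh Ω 𝒯) : IsFiniteMeasure ((μHE[2]).restrict Ω) := by
  refine ⟨?_⟩
  rw [Measure.restrict_apply_univ]
  refine (measure_mono hM.subset_iUnion).trans_lt ?_
  refine (measure_biUnion_finset_le _ _).trans_lt ?_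
  exact ENNReal.sum_lt_top.2 fun T hT => (hM.measure_tri_ne_top hT).lt_top

theorem IsMesh.restrict_eq_sum (hM : IsMesh Ω 𝒯) (hB : ResolvesBoundary Ω 𝒯) :
    (μHE[2]).restrict Ω = ∑ T : 𝒯, (μHE[2]).restrict (tri (T : Finset (E d))) := by
  have h1 : Ω =ᵐ[μHE[2]] ⋃ T : 𝒯, tri (T : Finset (E d)) := by
    refine Filter.EventuallyLE.antisymm ?_ ?_
    · refine LE.le.eventuallyLE fun x hx => ?_
      obtain ⟨T, hT, h⟩ := hM.exists_mem_tri hx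
      exact mem_iUnion.2 ⟨⟨T, hT⟩, h⟩
    · rw [ae_le_set, iUnion_sdiff]
      exact measure_iUnion_null fun T => ae_le_set.1 (hM.tri_ae_le hB T.2)
  rw [Measure.restrict_congr_set h1, Measure.restrict_iUnion_ae, Measure.sum_fintype]
  · intro T T' hne
    refine measure_mono_null ?_ (measure_skeleton 𝒯)
    rintro x ⟨hx, hx'⟩
    by_contra hxs
    exact hne (Subtype.ext (hM.eq_of_notMem_skeleton T.2 T'.2 hxs hx hx'))
  · exact fun T => (isClosed_tri _).measurableSet.nullMeasurableSet

theorem IsMesh.setIntegral_eq_sum (hM : IsMesh Ω 𝒯) (hB : ResolvesBoundary Ω 𝒯) {f : E d → ℝ}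
    (hf : Integrable f ((μHE[2]).restrict Ω)) :
    ∫ x in Ω, f x ∂μHE[2] = ∑ T ∈ 𝒯, ∫ x in tri T, f x ∂μHE[2] := by
  rw [hM.restrict_eq_sum hB, integral_finsetSum_measure, ← Finset.sum_coe_sort 𝒯
    (fun T => ∫ x in tri T, f x ∂μHE[2])]
  exact fun T _ => hf.mono_measure (hM.restrict_tri_le hB T.2)

theorem IsMesh.ae_notMem_skeleton (hB : ResolvesBoundary Ω 𝒯) :
    ∀ᵐ x ∂((μHE[2]).restrict Ω), x ∈ Ω ∧ x ∉ skeleton 𝒯 := by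
  rw [ae_restrict_iff' hB.measurableSet]
  filter_upwards [measure_eq_zero_iff_ae_notMem.1 (measure_skeleton 𝒯)] with x hx hxΩ
  exact ⟨hxΩ, hx⟩

theorem IsMesh.ae_tri (hM : IsMesh Ω 𝒯) (hB : ResolvesBoundary Ω 𝒯) {T : Finset (E d)}
    (hT : T ∈ 𝒯) : ∀ᵐ x ∂((μHE[2]).restrict (tri T)), x ∈ tri T ∩ Ω := by
  rw [ae_restrict_iff' (isClosed_tri T).measurableSet]
  filter_upwards [measure_eq_zero_iff_ae_notMem.1 (measure_skeleton 𝒯)] with x hx hxT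
  exact ⟨hxT, hM.mem_of_mem_tri_of_notMem_skeleton hB hT hxT hx⟩

theorem IsMesh.sum_indicator_eq {F : Type*} [AddCommMonoid F] (hM : IsMesh Ω 𝒯)
    (f : Finset (E d) → E d → F) {T : Finset (E d)} (hT : T ∈ 𝒯) {x : E d} (hx : x ∈ tri T)
    (hxs : x ∉ skeleton 𝒯) : (∑ S ∈ 𝒯, (tri S).indicator (f S) x) = f T x := by
  rw [Finset.sum_eq_single T, indicator_of_mem hx]
  · intro S hS hne
    refine indicator_of_notMem (fun h => hne ?_) _
    exact hM.eq_of_notMem_skeleton hS hT hxs h hx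
  · exact fun h => absurd hT h

theorem memLp_affine (hM : IsMesh Ω 𝒯) {T : Finset (E d)} (hT : T ∈ 𝒯) (A : E d →ᵃ[ℝ] ℝ)
    {p : ENNReal} : MemLp A p ((μHE[2]).restrict (tri T)) := by
  have := hM.isFiniteMeasure_tri hT
  obtain ⟨C, hC⟩ := (isCompact_tri T).exists_bound_of_continuousOn (AffineMap_continuous A).continuousOn
  refine MemLp.of_bound (AffineMap_continuous A).aestronglyMeasurable C ?_
  exact (ae_restrict_iff' (isClosed_tri T).measurableSet).2 (ae_of_all _ fun x hx => hC x hx)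

theorem S1.ae_eq_sum (hM : IsMesh Ω 𝒯) (hB : ResolvesBoundary Ω 𝒯) {V : E d → ℝ}
    {A : Finset (E d) → E d →ᵃ[ℝ] ℝ} (hA : ∀ T ∈ 𝒯, ∀ x ∈ tri T ∩ Ω, V x = A T x) :
    V =ᵐ[(μHE[2]).restrict Ω] ∑ T ∈ 𝒯, (tri T).indicator (A T) := by
  filter_upwards [IsMesh.ae_notMem_skeleton hB] with x hx
  obtain ⟨T, hT, hxT⟩ := hM.exists_mem_tri hx.1
  rw [Finset.sum_apply, hM.sum_indicator_eq (fun T => A T) hT hxT hx.2, hA T hT x ⟨hxT, hx.1⟩]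

theorem memLp_indicator_affine (hM : IsMesh Ω 𝒯) {T : Finset (E d)} (hT : T ∈ 𝒯)
    (A : E d →ᵃ[ℝ] ℝ) {p : ENNReal} :
    MemLp ((tri T).indicator A) p ((μHE[2]).restrict Ω) :=
  ((memLp_indicator_iff_restrict (isClosed_tri T).measurableSet).2
    (memLp_affine hM hT A)).mono_measure Measure.restrict_le_self

theorem S1.memLp (hM : IsMesh Ω 𝒯) (hB : ResolvesBoundary Ω 𝒯) {V : E d → ℝ}
    (hV : V ∈ S1 Ω 𝒯) {p : ENNReal} : MemLp V p ((μHE[2]).restrict Ω) := by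
  obtain ⟨A, hA⟩ := S1.exists_affine hV
  refine (memLp_congr_ae (S1.ae_eq_sum hM hB hA)).2 ?_
  exact memLp_finsetSum' _ fun T hT => memLp_indicator_affine hM hT (A T)

theorem S1.zero_mem : (0 : E d → ℝ) ∈ S1 Ω 𝒯 :=
  ⟨continuousOn_const, fun _ _ => ⟨0, fun _ _ => rfl⟩⟩

theorem S1.add_mem {V W : E d → ℝ} (hV : V ∈ S1 Ω 𝒯) (hW : W ∈ S1 Ω 𝒯) : V + W ∈ S1 Ω 𝒯 := by
  refine ⟨hV.1.add hW.1, fun T hT => ?_⟩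
  obtain ⟨A, hA⟩ := hV.2 T hT
  obtain ⟨B, hB⟩ := hW.2 T hT
  exact ⟨A + B, fun x hx => by simp [hA x hx, hB x hx]⟩

theorem S1.smul_mem {V : E d → ℝ} (c : ℝ) (hV : V ∈ S1 Ω 𝒯) : c • V ∈ S1 Ω 𝒯 := by
  refine ⟨hV.1.const_smul c, fun T hT => ?_⟩
  obtain ⟨A, hA⟩ := hV.2 T hT
  exact ⟨c • A, fun x hx => by simp [hA x hx]⟩

theorem toLp_finset_sum_mem {X ι : Type*} [MeasurableSpace X] {μ : Measure X}
    (P : Submodule ℝ (Lp ℝ 2 μ)) (s : Finset ι) (f : ι → X → ℝ)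
    (hf : ∀ i ∈ s, ∃ h : MemLp (f i) 2 μ, h.toLp (f i) ∈ P) :
    ∃ h : MemLp (∑ i ∈ s, f i) 2 μ, h.toLp (∑ i ∈ s, f i) ∈ P := by
  classical
  induction s using Finset.induction_on with
  | empty =>
    rw [Finset.sum_empty]
    exact ⟨MemLp.zero, by rw [MemLp.toLp_zero]; exact P.zero_mem⟩
  | insert a s ha ih =>
    obtain ⟨h1, h1'⟩ := hf a (Finset.mem_insert_self a s)
    obtain ⟨h2, h2'⟩ := ih fun i hi => hf i (Finset.mem_insert_of_mem hi)
    rw [Finset.sum_insert ha]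
    exact ⟨h1.add h2, by rw [MemLp.toLp_add h1 h2]; exact P.add_mem h1' h2'⟩

/-- In `L²` the finite element space lies in the span of the finitely many elementwise hat
functions, cut off outside their triangles. It is thus finite-dimensional and admits an orthogonal
projection. -/
theorem exists_isL2Projection (hM : IsMesh Ω 𝒯) (hB : ResolvesBoundary Ω 𝒯) {u : E d → ℝ}
    (hu : MemLp u 2 ((μHE[2]).restrict Ω)) : ∃ P, IsL2Projection Ω 𝒯 u P := by
  classical
  set μ := (μHE[2]).restrict Ω with hμ
  let S : Submodule ℝ (Lp ℝ 2 μ) :=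
    { carrier := {f | ∃ V ∈ S1 Ω 𝒯, V =ᵐ[μ] f}
      zero_mem' := ⟨0, S1.zero_mem, (Lp.coeFn_zero ℝ 2 μ).symm⟩
      add_mem' := by
        rintro f g ⟨V, hV, hVf⟩ ⟨W, hW, hWg⟩
        exact ⟨V + W, S1.add_mem hV hW, (hVf.add hWg).trans (Lp.coeFn_add f g).symm⟩
      smul_mem' := by
        rintro c f ⟨V, hV, hVf⟩
        exact ⟨c • V, S1.smul_mem c hV, (hVf.const_smul c).trans (Lp.coeFn_smul c f).symm⟩ }
  let e : (𝒯 × (𝒯.biUnion id : Finset (E d))) → Lp ℝ 2 μ := fun i =>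
    (memLp_indicator_affine (p := 2) hM i.1.2 (hat i.1 i.2)).toLp _
  let P : Submodule ℝ (Lp ℝ 2 μ) := Submodule.span ℝ (range e)
  have hP : FiniteDimensional ℝ P := FiniteDimensional.span_of_finite ℝ (finite_range e)
  have hSP : S ≤ P := by
    rintro f ⟨V, hV, hVf⟩
    obtain ⟨A, hA⟩ := S1.exists_affine hV
    have h1 : V =ᵐ[μ] ∑ T ∈ 𝒯, (tri T).indicator (interp T (A T)) := by
      refine S1.ae_eq_sum hM hB fun T hT x hx => ?_
      rw [hM.interp_eq hT hx.1, hA T hT x hx]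
    obtain ⟨h, hmem⟩ := toLp_finset_sum_mem P 𝒯 (fun T => (tri T).indicator (interp T (A T)))
      (fun T hT => by
        have : (tri T).indicator (interp T (A T)) =
            ∑ z ∈ T, A T z • (tri T).indicator (hat T z) := by
          ext x
          rw [Finset.sum_apply]
          by_cases hx : x ∈ tri T
          · simp [hx, interp_apply]
          · simp [hx]
        rw [this]
        refine toLp_finset_sum_mem P T _ fun z hz => ?_
        have hm : MemLp ((tri T).indicator (hat T z)) 2 μ := memLp_indicator_affine hM hT (hat T z)
        refine ⟨hm.const_smul _, ?_⟩
        rw [MemLp.toLp_const_smul _ hm]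
        refine P.smul_mem _ (Submodule.subset_span ?_)
        exact ⟨(⟨T, hT⟩, ⟨z, Finset.mem_biUnion.2 ⟨T, hT, hz⟩⟩), rfl⟩)
    have : f = h.toLp _ := by
      apply Lp.ext
      exact (hVf.symm.trans h1).trans h.coeFn_toLp.symm
    rw [this]
    exact hmem
  have hS : FiniteDimensional ℝ S := Submodule.finiteDimensional_of_le hSP
  obtain ⟨V, hV, hVe⟩ := S.starProjection_apply_mem (hu.toLp u)
  refine ⟨V, hV, fun W hW => ?_⟩
  have hWm : MemLp W 2 μ := S1.memLp hM hB hW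
  have hWS : hWm.toLp W ∈ S := ⟨W, hW, hWm.coeFn_toLp.symm⟩
  have h := S.starProjection_inner_eq_zero (hu.toLp u) (hWm.toLp W) hWS
  rw [L2.inner_def] at h
  rw [← h]
  refine integral_congr_ae ?_
  filter_upwards [hVe, hWm.coeFn_toLp, hu.coeFn_toLp,
    Lp.coeFn_sub (hu.toLp u) (S.starProjection (hu.toLp u))] with x h1 h2 h3 h4
  rw [h4, Pi.sub_apply, h2, h3, ← h1]
  simp

end P1FEM

/-! ### Finite element functions belong to the space of weakly differentiable functions -/

namespace P1FEM

open Set Topology Filter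

/-- A continuous function on an interval that is Lipschitz on each set of a finite closed cover. -/
theorem abs_sub_le_of_closed_cover {ι : Type*} [DecidableEq ι] {f : ℝ → ℝ} {F : ι → Set ℝ}
    {b K : ℝ} (s : Finset ι) : ∀ a ≤ b, ContinuousOn f (Icc a b) →
      (∀ i ∈ s, IsClosed (F i ∩ Icc a b)) → Icc a b ⊆ ⋃ i ∈ s, F i →
      (∀ i ∈ s, ∀ x ∈ F i ∩ Icc a b, ∀ y ∈ F i ∩ Icc a b, |f x - f y| ≤ K * |x - y|) →
      |f b - f a| ≤ K * (b - a) := by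
  induction hn : s.card generalizing s with
  | zero =>
    intro a hab _ _ hcov _
    rw [Finset.card_eq_zero] at hn
    have := hcov (left_mem_Icc.2 hab)
    simp [hn] at this
  | succ n ih =>
    intro a hab hf hcl hcov hL
    have ha := hcov (left_mem_Icc.2 hab)
    simp only [mem_iUnion] at ha
    obtain ⟨i, hi, hai⟩ := ha
    have hcomp : IsCompact (F i ∩ Icc a b) :=
      isCompact_Icc.of_isClosed_subset (hcl i hi) inter_subset_right
    have hne : (F i ∩ Icc a b).Nonempty := ⟨a, hai, left_mem_Icc.2 hab⟩
    -- Go from `a` to the last point `t₁` of `F i` in one step. Beyond `t₁` the set `F i` is not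
    -- needed, so the induction applies on `Icc t b` for every `t > t₁`, and continuity allows `t →
    -- t₁`.
    obtain ⟨t₁, ht₁, hmax⟩ := hcomp.exists_isGreatest hne
    have h1 := hL i hi t₁ ht₁ a ⟨hai, left_mem_Icc.2 hab⟩
    rw [abs_of_nonneg (sub_nonneg.2 ht₁.2.1)] at h1
    rcases ht₁.2.2.eq_or_lt with h | hlt
    · rwa [h] at h1
    have h2 : ∀ t ∈ Ioc t₁ b, |f b - f t| ≤ K * (b - t) := by
      intro t ht
      have hsub : Icc t b ⊆ Icc a b := Icc_subset_Icc (ht₁.2.1.trans ht.1.le) le_rfl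
      refine ih (s.erase i) (by rw [Finset.card_erase_of_mem hi, hn]; rfl) t ht.2 (hf.mono hsub)
        ?_ ?_ ?_
      · intro j hj
        have : F j ∩ Icc t b = (F j ∩ Icc a b) ∩ Icc t b := by
          rw [inter_assoc, inter_eq_right.2 hsub]
        rw [this]
        exact (hcl j (Finset.mem_of_mem_erase hj)).inter isClosed_Icc
      · intro x hx
        have := hcov (hsub hx)
        simp only [mem_iUnion] at this ⊢
        obtain ⟨j, hj, hxj⟩ := this
        refine ⟨j, Finset.mem_erase.2 ⟨?_, hj⟩, hxj⟩
        rintro rfl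
        exact absurd (hmax ⟨hxj, hsub hx⟩) (not_le.2 (ht.1.trans_le hx.1))
      · intro j hj x hx y hy
        exact hL j (Finset.mem_of_mem_erase hj) x ⟨hx.1, hsub hx.2⟩ y ⟨hy.1, hsub hy.2⟩
    have hcont : Tendsto f (𝓝[Ioc t₁ b] t₁) (𝓝 (f t₁)) :=
      (hf t₁ ht₁.2).mono (fun x hx => ⟨ht₁.2.1.trans hx.1.le, hx.2⟩)
    have hbot : (𝓝[Ioc t₁ b] t₁).NeBot := by
      rw [nhdsWithin_Ioc_eq_nhdsGT hlt]
      infer_instance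
    have h3 : |f b - f t₁| ≤ K * (b - t₁) := by
      refine le_of_tendsto_of_tendsto (tendsto_const_nhds.sub hcont).abs
        (g := fun t => K * (b - t)) ?_ (eventually_mem_nhdsWithin.mono h2)
      refine ((continuous_const.mul (continuous_const.sub continuous_id)).tendsto t₁).mono_left
        nhdsWithin_le_nhds
    have h4 := abs_sub_le (f b) (f t₁) (f a)
    linarith

variable {d : ℕ} {Ω : Set (E d)} {𝒯 : Finset (Finset (E d))}

namespace IsChart

variable {U : Set (E 2)} {χ : E 2 → E d}

theorem exists_pos (h : IsChart Ω U χ) : ∃ L : ℝ, 0 < L ∧ ∀ x ∈ U, ∀ y ∈ U,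
    dist (χ x) (χ y) ≤ L * dist x y ∧ dist x y ≤ L * dist (χ x) (χ y) := by
  obtain ⟨L, hL⟩ := h.biLipschitz
  refine ⟨max L 1, by positivity, fun x hx y hy => ⟨?_, ?_⟩⟩
  · exact (hL x hx y hy).1.trans (mul_le_mul_of_nonneg_right (le_max_left _ _) dist_nonneg)
  · exact (hL x hx y hy).2.trans (mul_le_mul_of_nonneg_right (le_max_left _ _) dist_nonneg)

theorem exists_lipschitzOnWith (h : IsChart Ω U χ) : ∃ C, LipschitzOnWith C χ U := by
  obtain ⟨L, hL0, hL⟩ := h.exists_pos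
  exact ⟨L.toNNReal, LipschitzOnWith.of_dist_le_mul fun x hx y hy => by
    rw [Real.coe_toNNReal _ hL0.le]; exact (hL x hx y hy).1⟩

theorem continuousOn (h : IsChart Ω U χ) : ContinuousOn χ U := by
  obtain ⟨C, hC⟩ := h.exists_lipschitzOnWith
  exact hC.continuousOn

theorem ae_differentiableAt (h : IsChart Ω U χ) :
    ∀ᵐ y : E 2, y ∈ U → DifferentiableAt ℝ χ y := by
  obtain ⟨C, hC⟩ := h.exists_lipschitzOnWith
  filter_upwards [hC.ae_differentiableWithinAt_of_mem (μ := volume)] with y hy hyU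
  exact (hy hyU).differentiableAt (h.isOpen.mem_nhds hyU)

/-- The inverse of `χ` is Lipschitz, so it maps sets of vanishing two-dimensional Hausdorff measure
to null sets. -/
theorem ae_notMem_skeleton (h : IsChart Ω U χ) (𝒯 : Finset (Finset (E d))) :
    ∀ᵐ y : E 2, y ∈ U → χ y ∉ skeleton 𝒯 := by
  obtain ⟨L, hL0, hL⟩ := h.exists_pos
  have hanti : AntilipschitzWith L.toNNReal (fun y : U => χ y) :=
    AntilipschitzWith.of_le_mul_dist fun x y => by
      rw [Real.coe_toNNReal _ hL0.le]; exact (hL x x.2 y y.2).2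
  have hsk : μH[(2 : ℕ)] (skeleton 𝒯) = 0 := by
    have h1 := measure_skeleton 𝒯
    rw [Measure.euclideanHausdorffMeasure_def, Measure.smul_apply, ENNReal.smul_def, smul_eq_mul,
      mul_eq_zero] at h1
    refine h1.resolve_left ?_
    simpa using Measure.addHaarScalarFactor_volume_hausdorffMeasure_ne_zero 2
  have h2 := hanti.hausdorffMeasure_preimage_le (d := (2 : ℕ)) (by positivity) (skeleton 𝒯)
  rw [hsk, mul_zero, nonpos_iff_eq_zero] at h2
  have h3 := (isometry_subtype_coe (s := U)).hausdorffMeasure_image (d := (2 : ℕ))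
    (Or.inl (by positivity)) ((fun y : U => χ y) ⁻¹' skeleton 𝒯)
  rw [h2] at h3
  have h4 : volume ((↑) '' ((fun y : U => χ y) ⁻¹' skeleton 𝒯) : Set (E 2)) = 0 := by
    rw [← EuclideanSpace.euclideanHausdorffMeasure_eq_volume,
      Measure.euclideanHausdorffMeasure_def, Measure.smul_apply, h3, smul_zero]
  filter_upwards [measure_eq_zero_iff_ae_notMem.1 h4] with y hy hyU hys
  exact hy ⟨⟨y, hyU⟩, hys, rfl⟩

end IsChart

theorem sub_mem_vectorSpan {T : Finset (E d)} {x y : E d} (hx : x ∈ tri T) (hy : y ∈ tri T) :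
    x - y ∈ vectorSpan ℝ (T : Set (E d)) := by
  rw [← direction_affineSpan, ← vsub_eq_sub]
  exact AffineSubspace.vsub_mem_direction (convexHull_subset_affineSpan _ hx)
    (convexHull_subset_affineSpan _ hy)

/-- The tangential gradient on the plane of `T` of an affine function. -/
noncomputable def tangGrad (T : Finset (E d)) (A : E d →ᵃ[ℝ] ℝ) : E d :=
  (vectorSpan ℝ (T : Set (E d))).starProjection
    ((InnerProductSpace.toDual ℝ (E d)).symm (LinearMap.toContinuousLinearMap A.linear))

theorem tangGrad_mem (T : Finset (E d)) (A : E d →ᵃ[ℝ] ℝ) :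
    tangGrad T A ∈ vectorSpan ℝ (T : Set (E d)) := Submodule.starProjection_apply_mem _ _

theorem inner_tangGrad (T : Finset (E d)) (A : E d →ᵃ[ℝ] ℝ) {v : E d}
    (hv : v ∈ vectorSpan ℝ (T : Set (E d))) : inner ℝ (tangGrad T A) v = A.linear v := by
  have h := (vectorSpan ℝ (T : Set (E d))).starProjection_inner_eq_zero
    ((InnerProductSpace.toDual ℝ (E d)).symm (LinearMap.toContinuousLinearMap A.linear)) v hv
  rw [inner_sub_left, InnerProductSpace.toDual_symm_apply, sub_eq_zero] at h
  rw [tangGrad, ← h]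
  rfl

/-- The piecewise constant tangential gradient of a piecewise affine function. -/
noncomputable def meshGrad (𝒯 : Finset (Finset (E d))) (A : Finset (E d) → E d →ᵃ[ℝ] ℝ)
    (x : E d) : E d :=
  ∑ T ∈ 𝒯, (tri T).indicator (fun _ => tangGrad T (A T)) x

theorem IsMesh.meshGrad_eq (hM : IsMesh Ω 𝒯) (A : Finset (E d) → E d →ᵃ[ℝ] ℝ) {T : Finset (E d)}
    (hT : T ∈ 𝒯) {x : E d} (hx : x ∈ tri T) (hxs : x ∉ skeleton 𝒯) :
    meshGrad 𝒯 A x = tangGrad T (A T) :=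
  hM.sum_indicator_eq (fun T _ => tangGrad T (A T)) hT hx hxs

theorem IsMesh.memLp_meshGrad (hM : IsMesh Ω 𝒯) (A : Finset (E d) → E d →ᵃ[ℝ] ℝ) :
    MemLp (meshGrad 𝒯 A) 2 ((μHE[2]).restrict Ω) := by
  have := hM.isFiniteMeasure
  refine memLp_finsetSum _ fun T _ => ?_
  exact (memLp_const _).indicator (isClosed_tri T).measurableSet

section Chart

variable {U : Set (E 2)} {χ : E 2 → E d}

theorem IsMesh.eventually_mem_tri (hM : IsMesh Ω 𝒯) (hχ : IsChart Ω U χ) {y : E 2} (hy : y ∈ U)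
    (hys : χ y ∉ skeleton 𝒯) {T : Finset (E d)} (hT : T ∈ 𝒯) (hyT : χ y ∈ tri T) :
    ∀ᶠ z in 𝓝 y, z ∈ U ∧ χ z ∈ tri T := by
  classical
  have hcl : IsClosed (⋃ S ∈ 𝒯.erase T, tri S) := isClosed_biUnion_finset fun S _ => isClosed_tri S
  have hnot : χ y ∈ (⋃ S ∈ 𝒯.erase T, tri S)ᶜ := by
    simp only [mem_compl_iff, mem_iUnion, not_exists, Finset.mem_erase]
    rintro S ⟨hne, hS⟩ h
    exact hne (hM.eq_of_notMem_skeleton hS hT hys h hyT)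
  have hU := hχ.isOpen.mem_nhds hy
  have hc : ContinuousAt χ y := hχ.continuousOn.continuousAt hU
  filter_upwards [hU, hc (hcl.isOpen_compl.mem_nhds hnot)] with z hz hzn
  refine ⟨hz, ?_⟩
  obtain ⟨S, hS, hzS⟩ := hM.exists_mem_tri (hχ.mapsTo hz)
  by_cases hST : S = T
  · exact hST ▸ hzS
  · exfalso
    apply hzn
    simp only [mem_iUnion, Finset.mem_erase]
    exact ⟨S, ⟨hST, hS⟩, hzS⟩

theorem tendsto_slope_of_differentiableAt {F : Type*} [NormedAddCommGroup F] [NormedSpace ℝ F]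
    {f : E 2 → F} {y : E 2} (h : DifferentiableAt ℝ f y) (v : E 2) :
    Tendsto (fun t : ℝ => t⁻¹ • (f (y + t • v) - f y)) (𝓝[>] 0) (𝓝 (fderiv ℝ f y v)) :=
  (h.hasFDerivAt.hasLineDerivAt v).tendsto_slope_zero_right

theorem tendsto_add_smul (y v : E 2) : Tendsto (fun t : ℝ => y + t • v) (𝓝[>] 0) (𝓝 y) := by
  have : Continuous fun t : ℝ => y + t • v := by fun_prop
  exact (this.tendsto' 0 y (by simp)).mono_left nhdsWithin_le_nhds

theorem IsMesh.fderiv_mem_vectorSpan (hM : IsMesh Ω 𝒯) (hχ : IsChart Ω U χ) {y : E 2} (hy : y ∈ U)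
    (hys : χ y ∉ skeleton 𝒯) {T : Finset (E d)} (hT : T ∈ 𝒯) (hyT : χ y ∈ tri T)
    (hd : DifferentiableAt ℝ χ y) (v : E 2) :
    fderiv ℝ χ y v ∈ vectorSpan ℝ (T : Set (E d)) := by
  have hcl : IsClosed (vectorSpan ℝ (T : Set (E d)) : Set (E d)) :=
    Submodule.closed_of_finiteDimensional _
  refine hcl.mem_of_tendsto (tendsto_slope_of_differentiableAt hd v) ?_
  filter_upwards [(tendsto_add_smul y v).eventually (hM.eventually_mem_tri hχ hy hys hT hyT)]
    with t ht
  exact Submodule.smul_mem _ _ (sub_mem_vectorSpan ht.2 hyT)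

theorem IsChart.fderiv_injective (hχ : IsChart Ω U χ) {y : E 2} (hy : y ∈ U)
    (hd : DifferentiableAt ℝ χ y) : Function.Injective (fderiv ℝ χ y) := by
  obtain ⟨L, hL0, hL⟩ := hχ.exists_pos
  rw [injective_iff_map_eq_zero]
  intro v hv
  have h1 := (tendsto_slope_of_differentiableAt hd v).norm.const_mul L
  have h2 : ∀ᶠ t : ℝ in 𝓝[>] 0, ‖v‖ ≤ L * ‖t⁻¹ • (χ (y + t • v) - χ y)‖ := by
    filter_upwards [(tendsto_add_smul y v).eventually (hχ.isOpen.mem_nhds hy),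
      self_mem_nhdsWithin] with t ht ht0
    have ht0' : (0 : ℝ) < t := ht0
    have := (hL _ ht _ hy).2
    rw [dist_eq_norm, dist_eq_norm, add_sub_cancel_left, norm_smul, Real.norm_of_nonneg ht0'.le]
      at this
    rw [norm_smul, Real.norm_of_nonneg (by positivity), ← mul_assoc, mul_comm L, mul_assoc,
      ← div_eq_inv_mul, le_div_iff₀ ht0']
    linarith
  have h3 := ge_of_tendsto h1 h2
  rw [hv, norm_zero, mul_zero] at h3
  exact norm_le_zero_iff.1 h3

/-- Near such a point the chart stays in one triangle, so the derivative maps into its plane; the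
lower Lipschitz bound makes it injective, and both dimensions are two. Hence every tangential vector
is in the range of the derivative. -/
theorem IsMesh.range_fderiv (hM : IsMesh Ω 𝒯) (hχ : IsChart Ω U χ) {y : E 2} (hy : y ∈ U)
    (hys : χ y ∉ skeleton 𝒯) {T : Finset (E d)} (hT : T ∈ 𝒯) (hyT : χ y ∈ tri T)
    (hd : DifferentiableAt ℝ χ y) :
    LinearMap.range (fderiv ℝ χ y : E 2 →ₗ[ℝ] E d) = vectorSpan ℝ (T : Set (E d)) := by
  refine Submodule.eq_of_le_of_finrank_eq ?_ ?_
  · rintro _ ⟨v, rfl⟩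
    exact hM.fderiv_mem_vectorSpan hχ hy hys hT hyT hd v
  · rw [LinearMap.finrank_range_of_inj (hχ.fderiv_injective hy hd), finrank_euclideanSpace_fin]
    have h := (hM.nondegenerate T hT).finrank_vectorSpan (n := 2) (by simp [hM.card_eq T hT])
    have hr : Set.range ((↑) : T → E d) = (T : Set (E d)) := Subtype.range_coe
    have h2 := congrArg (fun s => Module.finrank ℝ (vectorSpan ℝ s)) hr
    exact h.symm.trans h2

theorem exists_lipschitz_bound (𝒯 : Finset (Finset (E d))) (A : Finset (E d) → E d →ᵃ[ℝ] ℝ) :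
    ∃ M : ℝ, 0 ≤ M ∧ ∀ T ∈ 𝒯, ∀ x y, |A T x - A T y| ≤ M * ‖x - y‖ := by
  refine ⟨∑ T ∈ 𝒯, ‖LinearMap.toContinuousLinearMap (A T).linear‖,
    Finset.sum_nonneg fun T _ => norm_nonneg _, fun T hT x y => ?_⟩
  have h1 : A T x - A T y = LinearMap.toContinuousLinearMap (A T).linear (x - y) := by
    rw [LinearMap.coe_toContinuousLinearMap', ← vsub_eq_sub x y, AffineMap.linearMap_vsub,
      vsub_eq_sub]
  rw [h1, ← Real.norm_eq_abs]
  refine (ContinuousLinearMap.le_opNorm _ _).trans ?_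
  gcongr
  exact Finset.single_le_sum (f := fun T => ‖LinearMap.toContinuousLinearMap (A T).linear‖)
    (fun T _ => norm_nonneg _) hT

/-- The image of a straight segment may change triangles infinitely often, so no subdivision into
pieces is available. Continuity and a Lipschitz bound on each of the finitely many closed parameter
sets are enough by `abs_sub_le_of_closed_cover`. -/
theorem IsMesh.locallyLipschitzOn_comp (hM : IsMesh Ω 𝒯) (hχ : IsChart Ω U χ) {V : E d → ℝ}
    (hV : V ∈ S1 Ω 𝒯) : LocallyLipschitzOn U (fun y => V (χ y)) := by
  classical
  obtain ⟨A, hA⟩ := S1.exists_affine hV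
  obtain ⟨M, hM0, hMA⟩ := exists_lipschitz_bound 𝒯 A
  obtain ⟨L, hL0, hL⟩ := hχ.exists_pos
  have hVχ : ContinuousOn (fun y => V (χ y)) U := hV.1.comp hχ.continuousOn hχ.mapsTo
  intro y hy
  obtain ⟨ε, hε, hball⟩ := Metric.isOpen_iff.1 hχ.isOpen y hy
  refine ⟨(M * L).toNNReal, Metric.ball y ε,
    mem_nhdsWithin_of_mem_nhds (Metric.ball_mem_nhds y hε), ?_⟩
  refine LipschitzOnWith.of_dist_le_mul fun p hp q hq => ?_
  rw [Real.coe_toNNReal _ (by positivity), Real.dist_eq]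
  have hγU : ∀ t ∈ Icc (0 : ℝ) 1, q + t • (p - q) ∈ U := by
    intro t ht
    apply hball
    have := (convex_ball y ε).add_smul_sub_mem hq hp ht
    exact this
  have hγc : Continuous fun t : ℝ => q + t • (p - q) := by fun_prop
  have hχγ : ContinuousOn (fun t : ℝ => χ (q + t • (p - q))) (Icc 0 1) :=
    hχ.continuousOn.comp hγc.continuousOn hγU
  have key := abs_sub_le_of_closed_cover (f := fun t : ℝ => V (χ (q + t • (p - q))))
    (F := fun T => {t | χ (q + t • (p - q)) ∈ tri T}) (b := 1) (K := M * L * dist p q) 𝒯 0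
    zero_le_one (hVχ.comp hγc.continuousOn hγU) ?_ ?_ ?_
  · simpa using key
  · intro T _
    have := hχγ.preimage_isClosed_of_isClosed isClosed_Icc (isClosed_tri T)
    rwa [inter_comm] at this
  · intro t ht
    obtain ⟨T, hT, h⟩ := hM.exists_mem_tri (hχ.mapsTo (hγU t ht))
    simp only [mem_iUnion]
    exact ⟨T, hT, h⟩
  · rintro T hT s ⟨hs, hs1⟩ t ⟨ht, ht1⟩
    rw [hA T hT _ ⟨hs, hχ.mapsTo (hγU s hs1)⟩, hA T hT _ ⟨ht, hχ.mapsTo (hγU t ht1)⟩]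
    refine (hMA T hT _ _).trans ?_
    have h1 := (hL _ (hγU s hs1) _ (hγU t ht1)).1
    rw [dist_eq_norm, dist_eq_norm, add_sub_add_left_eq_sub, ← sub_smul, norm_smul,
      Real.norm_eq_abs] at h1
    calc M * ‖χ (q + s • (p - q)) - χ (q + t • (p - q))‖ ≤ M * (L * (|s - t| * dist p q)) := by
          rw [dist_eq_norm p q]
          gcongr
      _ = M * L * dist p q * |s - t| := by ring

/-- The restriction of `V ∘ χ` to the compact support of `φ` extends to a Lipschitz function on the
plane, for which integration by parts holds with the almost everywhere derivative. At almost every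
point with `φ ≠ 0` that extension coincides locally with an affine function composed with `χ`, and
the chain rule applies. -/
theorem IsMesh.hasWeakGrad (hM : IsMesh Ω 𝒯) (hχ : IsChart Ω U χ) {V : E d → ℝ}
    (hV : V ∈ S1 Ω 𝒯) {A : Finset (E d) → E d →ᵃ[ℝ] ℝ}
    (hA : ∀ T ∈ 𝒯, ∀ x ∈ tri T ∩ Ω, V x = A T x) {φ : E 2 → ℝ} (hφ : ContDiff ℝ ∞ φ)
    (hφs : HasCompactSupport φ) (hφU : tsupport φ ⊆ U) (v : E 2) :
    ∫ y in U, V (χ y) * fderiv ℝ φ y v =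
      - ∫ y in U, inner ℝ (meshGrad 𝒯 A (χ y)) (fderiv ℝ χ y v) * φ y := by
  obtain ⟨C, hC⟩ := ((hM.locallyLipschitzOn_comp hχ hV).mono hφU).exists_lipschitzOnWith_of_compact
    hφs.isCompact
  obtain ⟨f, hf, hfeq⟩ := hC.extend_real
  obtain ⟨C', hC'⟩ := ContDiff.lipschitzWith_of_hasCompactSupport hφs hφ (by simp)
  have key := hf.integral_lineDeriv_mul_eq (μ := volume) hC' hφs v
  have hφd : Differentiable ℝ φ := hφ.differentiable (by simp)
  have hφ0 : ∀ y, y ∉ tsupport φ → φ y = 0 := fun y hy => image_eq_zero_of_notMem_tsupport hy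
  have hDφ0 : ∀ y, y ∉ tsupport φ → fderiv ℝ φ y v = 0 := fun y hy => by
    have : fderiv ℝ φ y = 0 := by
      by_contra h
      exact hy (support_fderiv_subset ℝ h)
    simp [this]
  have e1 : ∫ y, lineDeriv ℝ φ y (-v) * f y = - ∫ y in U, V (χ y) * fderiv ℝ φ y v := by
    rw [← integral_neg, ← integral_indicator hχ.isOpen.measurableSet]
    congr 1
    ext y
    rw [(hφd y).lineDeriv_eq_fderiv, map_neg]
    by_cases hy : y ∈ tsupport φ
    · rw [indicator_of_mem (hφU hy), ← hfeq hy]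
      ring
    · rw [hDφ0 y hy]
      by_cases hyU : y ∈ U <;> simp [hyU, hDφ0 y hy]
  have e2 : ∫ y, lineDeriv ℝ f y v * φ y =
      ∫ y in U, inner ℝ (meshGrad 𝒯 A (χ y)) (fderiv ℝ χ y v) * φ y := by
    rw [← integral_indicator hχ.isOpen.measurableSet]
    refine integral_congr_ae ?_
    filter_upwards [hχ.ae_differentiableAt, hχ.ae_notMem_skeleton 𝒯] with y hd hs
    by_cases hy0 : φ y = 0
    · by_cases hyU : y ∈ U <;> simp [hyU, hy0]
    have hysupp : y ∈ Function.support φ := hy0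
    have hyU : y ∈ U := hφU (subset_tsupport φ hysupp)
    rw [indicator_of_mem hyU]
    congr 1
    obtain ⟨T, hT, hyT⟩ := hM.exists_mem_tri (hχ.mapsTo hyU)
    rw [hM.meshGrad_eq A hT hyT (hs hyU),
      inner_tangGrad T (A T) (hM.fderiv_mem_vectorSpan hχ hyU (hs hyU) hT hyT (hd hyU) v)]
    have hev : f =ᶠ[𝓝 y] fun z => A T (χ z) := by
      filter_upwards [(hφ.continuous.isOpen_support).mem_nhds hysupp,
        hM.eventually_mem_tri hχ hyU (hs hyU) hT hyT] with z hz hzT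
      rw [← hfeq (subset_tsupport φ hz)]
      exact hA T hT _ ⟨hzT.2, hχ.mapsTo hzT.1⟩
    rw [hev.lineDeriv_eq]
    have hAd : HasFDerivAt (A T) (LinearMap.toContinuousLinearMap (A T).linear) (χ y) := by
      have h0 : (A T : E d → ℝ) = fun x => LinearMap.toContinuousLinearMap (A T).linear x + A T 0 := by
        ext x
        exact congrFun (A T).decomp x
      rw [h0]
      exact (LinearMap.toContinuousLinearMap (A T).linear).hasFDerivAt.add_const _
    have hcomp := hAd.comp y (hd hyU).hasFDerivAt
    exact (hcomp.hasLineDerivAt v).lineDeriv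
  rw [← e2, key, e1, neg_neg]

end Chart

theorem S1.hasH1Gradient (hM : IsMesh Ω 𝒯) (hB : ResolvesBoundary Ω 𝒯) {V : E d → ℝ}
    (hV : V ∈ S1 Ω 𝒯) {A : Finset (E d) → E d →ᵃ[ℝ] ℝ}
    (hA : ∀ T ∈ 𝒯, ∀ x ∈ tri T ∩ Ω, V x = A T x) : HasH1Gradient Ω V (meshGrad 𝒯 A) where
  memLp := S1.memLp hM hB hV
  memLp_grad := hM.memLp_meshGrad A
  tangential U χ hχ := by
    rw [ae_restrict_iff' hχ.isOpen.measurableSet]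
    filter_upwards [hχ.ae_differentiableAt, hχ.ae_notMem_skeleton 𝒯] with y hd hs hyU
    obtain ⟨T, hT, hyT⟩ := hM.exists_mem_tri (hχ.mapsTo hyU)
    rw [hM.meshGrad_eq A hT hyT (hs hyU)]
    have h := tangGrad_mem T (A T)
    rw [← hM.range_fderiv hχ hyU (hs hyU) hT hyT (hd hyU)] at h
    obtain ⟨v, hv⟩ := h
    exact ⟨v, hv.symm⟩
  weak U χ hχ φ hφ hφs hφU v := hM.hasWeakGrad hχ hV hA hφ hφs hφU v

/-! ### Local approximation by the quasi-interpolant -/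

theorem abs_affine_sub_le {A : E d →ᵃ[ℝ] ℝ} {T : Finset (E d)} {m s : ℝ}
    (h : ∀ z ∈ T, |A z - m| ≤ s) {x : E d} (hx : x ∈ tri T) : |A x - m| ≤ s := by
  have hc : Convex ℝ {x | |A x - m| ≤ s} := by
    have : {x | |A x - m| ≤ s} = A ⁻¹' Icc (m - s) (m + s) := by
      ext x
      simp only [mem_ofPred_eq, mem_preimage, mem_Icc, abs_le]
      constructor <;> rintro ⟨h1, h2⟩ <;> constructor <;> linarith
    rw [this]
    exact (convex_Icc _ _).affine_preimage _
  exact convexHull_min (fun z hz => h z hz) hc hx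

theorem IsMesh.measureReal_tri_le (hM : IsMesh Ω 𝒯) {T : Finset (E d)} (hT : T ∈ 𝒯) :
    (μHE[2]).real (tri T) ≤ Metric.diam (tri T) ^ 2 * refArea := by
  obtain ⟨a, b, c, hab, hac, hbc, rfl⟩ := hM.exists_vertices hT
  rw [measureReal_tri hab hac hbc]
  have := refArea_pos
  gcongr
  exact parArea_le _ _ (dist_le_diam_tri (by simp) (by simp)) (dist_le_diam_tri (by simp) (by simp))

/-- The sum of the squared `L²` norms of `g` on the patches of the vertices of `T`. -/
noncomputable def patchSq (𝒯 : Finset (Finset (E d))) (g : E d → E d) (T : Finset (E d)) : ℝ :=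
  ∑ z ∈ T, ∑ S ∈ patch 𝒯 z, gradSq g S

theorem sum_patch_le_patchSq (g : E d → E d) {T : Finset (E d)} {z : E d} (hz : z ∈ T) :
    ∑ S ∈ patch 𝒯 z, gradSq g S ≤ patchSq 𝒯 g T :=
  Finset.single_le_sum (f := fun z => ∑ S ∈ patch 𝒯 z, gradSq g S)
    (fun _ _ => Finset.sum_nonneg fun _ _ => gradSq_nonneg g _) hz

theorem patchSq_nonneg (g : E d → E d) (T : Finset (E d)) : 0 ≤ patchSq 𝒯 g T :=
  Finset.sum_nonneg fun _ _ => Finset.sum_nonneg fun _ _ => gradSq_nonneg g _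

theorem IsMesh.gradSq_le_patchSq (hM : IsMesh Ω 𝒯) (g : E d → E d) {T : Finset (E d)}
    (hT : T ∈ 𝒯) : gradSq g T ≤ patchSq 𝒯 g T := by
  obtain ⟨z, hz, -⟩ := hM.exists_mem_ne hT 0
  refine le_trans ?_ (sum_patch_le_patchSq g hz)
  exact Finset.single_le_sum (f := gradSq g) (fun _ _ => gradSq_nonneg g _)
    (mem_patch.2 ⟨hT, hz⟩)

theorem sum_sum_patch (f : E d → Finset (E d) → ℝ) :
    ∑ T ∈ 𝒯, ∑ z ∈ T, f z T =
      ∑ z ∈ (open Classical in 𝒯.biUnion id), ∑ T ∈ patch 𝒯 z, f z T := by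
  classical
  refine Finset.sum_comm' fun T z => ?_
  simp only [mem_patch, Finset.mem_biUnion, id]
  constructor
  · rintro ⟨h1, h2⟩
    exact ⟨⟨h1, h2⟩, T, h1, h2⟩
  · exact fun h => h.1

/-- Exchanging sums, the patch sum of a node is counted once for each triangle at the node, at most
`valence γ` times; afterwards each triangle is counted for its three vertices. -/
theorem IsMeshedDomain.sum_patchSq_le {γ : ℝ} (hD : IsMeshedDomain Ω 𝒯)
    (hS : IsShapeRegular γ 𝒯) (g : E d → E d) :
    ∑ T ∈ 𝒯, patchSq 𝒯 g T ≤ 3 * valence γ * ∑ T ∈ 𝒯, gradSq g T := by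
  classical
  have h1 : ∑ T ∈ 𝒯, ∑ z ∈ T, valence γ * gradSq g T = 3 * valence γ * ∑ T ∈ 𝒯, gradSq g T := by
    rw [Finset.mul_sum]
    refine Finset.sum_congr rfl fun T hT => ?_
    rw [Finset.sum_const, hD.1.card_eq T hT, nsmul_eq_mul]
    push_cast
    ring
  rw [← h1]
  simp only [patchSq]
  rw [sum_sum_patch (fun z _ => ∑ S ∈ patch 𝒯 z, gradSq g S),
    sum_sum_patch (fun _ T => valence γ * gradSq g T)]
  refine Finset.sum_le_sum fun z hz => ?_
  obtain ⟨T, hT, hzT⟩ := Finset.mem_biUnion.1 hz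
  rw [Finset.sum_const, nsmul_eq_mul, ← Finset.mul_sum]
  exact mul_le_mul_of_nonneg_right (hD.card_patch_le hS hT hzT)
    (Finset.sum_nonneg fun _ _ => gradSq_nonneg g _)

/-- The first summand is the Poincaré part `u - triAvg T u`, the second the distance of the nodal
values from that mean; each is doubled by splitting the square of a sum. -/
noncomputable def approxConst (γ : ℝ) : ℝ :=
  8 * poincareConst / refArea + 2 * refArea * (valence γ ^ 2 * jumpConst γ)

theorem approxConst_nonneg (γ : ℝ) : 0 ≤ approxConst γ := by
  have := poincareConst_nonneg
  have := refArea_pos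
  have := jumpConst_nonneg γ
  unfold approxConst
  positivity

theorem HasH1Gradient.integral_sub_triAvg_sq_le_diam (hM : IsMesh Ω 𝒯) (hB : ResolvesBoundary Ω 𝒯)
    {u : E d → ℝ} {g : E d → E d} (hu : HasH1Gradient Ω u g) {T : Finset (E d)} (hT : T ∈ 𝒯) :
    refArea * ∫ x in tri T, (u x - triAvg T u) ^ 2 ∂μHE[2] ≤
      4 * poincareConst * Metric.diam (tri T) ^ 2 * gradSq g T := by
  obtain ⟨a, b, c, hab, hac, hbc, rfl⟩ := hM.exists_vertices hT
  exact hu.integral_sub_triAvg_sq_le hM hB hT hab hac hbc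
    (dist_le_diam_tri (by simp) (by simp)) (dist_le_diam_tri (by simp) (by simp))

theorem HasH1Gradient.integral_sub_quasiInterpolant_sq_le {γ : ℝ} (hD : IsMeshedDomain Ω 𝒯)
    (hS : IsShapeRegular γ 𝒯) {u : E d → ℝ} {g : E d → E d} (hu : HasH1Gradient Ω u g)
    {T : Finset (E d)} (hT : T ∈ 𝒯) :
    ∫ x in tri T, (u x - interp T (quasiNodal Ω 𝒯 u T) x) ^ 2 ∂μHE[2] ≤
      Metric.diam (tri T) ^ 2 * (approxConst γ * patchSq 𝒯 g T) := by
  have hM := hD.1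
  have := hM.isFiniteMeasure_tri hT
  have hv := refArea_pos
  have hJ := jumpConst_nonneg γ
  have hK := poincareConst_nonneg
  have hp := patchSq_nonneg (𝒯 := 𝒯) g T
  set Y := valence γ ^ 2 * (jumpConst γ * patchSq 𝒯 g T) with hY
  have hY0 : 0 ≤ Y := by positivity
  have hnode : ∀ z ∈ T, |interp T (quasiNodal Ω 𝒯 u T) z - triAvg T u| ≤ Real.sqrt Y := by
    intro z hz
    rw [interp_apply_node (hM.nondegenerate T hT) _ hz]
    refine Real.abs_le_sqrt ((hu.quasiNodal_sub_sq_le hD hS hT hz).trans ?_)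
    have := sum_patch_le_patchSq (𝒯 := 𝒯) g hz
    rw [hY]
    gcongr
  have huT : MemLp u 2 ((μHE[2]).restrict (tri T)) :=
    hu.memLp.mono_measure (hM.restrict_tri_le hD.2.1 hT)
  have hI := memLp_affine (p := 2) hM hT (interp T (quasiNodal Ω 𝒯 u T))
  have h1 : Integrable (fun x => (u x - triAvg T u) ^ 2) ((μHE[2]).restrict (tri T)) :=
    (huT.sub (memLp_const _)).integrable_sq
  have h2 : ∫ x in tri T, (u x - interp T (quasiNodal Ω 𝒯 u T) x) ^ 2 ∂μHE[2] ≤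
      ∫ x in tri T, (2 * (u x - triAvg T u) ^ 2 + 2 * Y) ∂μHE[2] := by
    refine setIntegral_mono_on (huT.sub hI).integrable_sq
      ((h1.const_mul 2).add (integrable_const _)) (isClosed_tri T).measurableSet fun x hx => ?_
    have h3 := abs_affine_sub_le hnode hx
    have h4 := sq_le_sq' (neg_le_of_abs_le h3) (le_of_abs_le h3)
    rw [Real.sq_sqrt hY0] at h4
    nlinarith [sq_nonneg (u x - triAvg T u + (interp T (quasiNodal Ω 𝒯 u T) x - triAvg T u))]
  rw [integral_add (h1.const_mul 2) (integrable_const _), integral_const_mul, integral_const,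
    smul_eq_mul, measureReal_restrict_apply_univ] at h2
  have h5 := hu.integral_sub_triAvg_sq_le_diam hM hD.2.1 hT
  have h6 : 4 * poincareConst * Metric.diam (tri T) ^ 2 * gradSq g T ≤
      4 * poincareConst * Metric.diam (tri T) ^ 2 * patchSq 𝒯 g T := by
    have := hM.gradSq_le_patchSq g hT
    gcongr
  have h7 : ∫ x in tri T, (u x - triAvg T u) ^ 2 ∂μHE[2] ≤
      4 * poincareConst * Metric.diam (tri T) ^ 2 * patchSq 𝒯 g T / refArea := by
    rw [le_div_iff₀ hv, mul_comm]
    exact h5.trans h6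
  have h8 : (μHE[2]).real (tri T) * (2 * Y) ≤ Metric.diam (tri T) ^ 2 * refArea * (2 * Y) := by
    have := hM.measureReal_tri_le hT
    gcongr
  calc _ ≤ 2 * (4 * poincareConst * Metric.diam (tri T) ^ 2 * patchSq 𝒯 g T / refArea) +
        Metric.diam (tri T) ^ 2 * refArea * (2 * Y) := by linarith
    _ = _ := by
      rw [hY, approxConst]
      ring

/-- The part of the reference triangle near the vertex at the origin. -/
def refCorner : Set (E 2) := refOpen ∩ {y | y 0 + y 1 < 1 / 4}

/-- The relative area of the corner times `1 / 4`: in the corner at the vertex where `|A|` is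
largest, an affine function keeps at least half of that value. -/
noncomputable def massConst : ℝ := volume.real refCorner / (4 * refArea)

theorem isOpen_refCorner : IsOpen refCorner :=
  isOpen_refOpen.inter (isOpen_lt ((continuous_coord 0).add (continuous_coord 1)) continuous_const)

theorem volume_refCorner_lt_top : volume refCorner < ⊤ :=
  (measure_mono (inter_subset_left.trans refOpen_subset)).trans_lt volume_refTri_lt_top

theorem massConst_pos : 0 < massConst := by
  have h1 := refArea_pos
  have h2 : 0 < volume.real refCorner := by
    refine ENNReal.toReal_pos (isOpen_refCorner.measure_pos _ ⟨!₂[1/16, 1/16], ?_⟩).ne'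
      volume_refCorner_lt_top.ne
    norm_num [refCorner, refOpen]
  unfold massConst
  positivity

theorem IsMesh.le_integral_affine_sq (hM : IsMesh Ω 𝒯) {T : Finset (E d)} (hT : T ∈ 𝒯)
    (A : E d →ᵃ[ℝ] ℝ) {z : E d} (hz : z ∈ T) :
    (μHE[2]).real (tri T) * massConst * A z ^ 2 ≤ ∫ x in tri T, A x ^ 2 ∂μHE[2] := by
  obtain ⟨a, ha, hmax⟩ := T.exists_max_image (fun z => |A z|) ⟨z, hz⟩
  obtain ⟨b, hb, hba⟩ := hM.exists_mem_ne hT a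
  obtain ⟨c, hac, hbc, rfl⟩ := hM.exists_third hT ha hb hba.symm
  have hab := hba.symm
  have hl := hM.linearIndependent hT hab hac hbc
  have hv := refArea_pos
  have hDp := parArea_pos hl
  have hAz : A z ^ 2 ≤ A a ^ 2 := sq_le_sq.2 (hmax z hz)
  have hAb := hmax b (by simp)
  have hAc := hmax c (by simp)
  have hint := (memLp_tri_comp hab hac hbc hl (memLp_affine (p := 2) hM hT A)).integrable_sq
  have h1 : ∫ y in refCorner, A a ^ 2 / 4 ≤
      ∫ y in refCorner, A (para a (b - a) (c - a) y) ^ 2 := by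
    have hfin : IsFiniteMeasure (volume.restrict refCorner) :=
      ⟨by rw [Measure.restrict_apply_univ]; exact volume_refCorner_lt_top⟩
    refine setIntegral_mono_on (integrable_const _)
      (hint.mono_measure (Measure.restrict_mono inter_subset_left le_rfl))
      isOpen_refCorner.measurableSet fun y hy => ?_
    obtain ⟨⟨hy0, hy1, -⟩, hy2⟩ := hy
    simp only [mem_ofPred_eq] at hy2
    rw [affine_para]
    -- The vertex values differ from `A a` by at most `2 * |A a|`, and `y 0 + y 1 < 1 / 4`.
    have h0 : |y 0 * (A b - A a) + y 1 * (A c - A a)| ≤ |A a| / 2 := by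
      have hb' : |A b - A a| ≤ 2 * |A a| := (abs_sub _ _).trans (by linarith)
      have hc' : |A c - A a| ≤ 2 * |A a| := (abs_sub _ _).trans (by linarith)
      refine (abs_add_le _ _).trans ?_
      rw [abs_mul, abs_mul, abs_of_pos hy0, abs_of_pos hy1]
      nlinarith [abs_nonneg (A a)]
    have h2 : |A a| / 2 ≤ |A a + (y 0 * (A b - A a) + y 1 * (A c - A a))| := by
      have := abs_sub_abs_le_abs_sub (A a) (-(y 0 * (A b - A a) + y 1 * (A c - A a)))
      rw [abs_neg, sub_neg_eq_add] at this
      linarith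
    have h3 : (|A a| / 2) ^ 2 ≤ |A a + (y 0 * (A b - A a) + y 1 * (A c - A a))| ^ 2 := by
      gcongr
    rw [sq_abs, div_pow, sq_abs] at h3
    linarith
  have h2 : ∫ y in refCorner, A (para a (b - a) (c - a) y) ^ 2 ≤
      ∫ y in refOpen, A (para a (b - a) (c - a) y) ^ 2 :=
    setIntegral_mono_set hint (ae_of_all _ fun _ => sq_nonneg _) inter_subset_left.eventuallyLE
  rw [setIntegral_const, smul_eq_mul] at h1
  rw [setIntegral_tri hab hac hbc hl, measureReal_tri hab hac hbc]
  have hmc : 0 ≤ volume.real refCorner := measureReal_nonneg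
  calc _ = parArea (b - a) (c - a) * (volume.real refCorner * (A z ^ 2 / 4)) := by
        rw [massConst]
        field_simp
    _ ≤ parArea (b - a) (c - a) * (volume.real refCorner * (A a ^ 2 / 4)) := by gcongr
    _ ≤ _ := by
      gcongr
      exact h1.trans h2

/-! ### Mass matrices as integral forms, inverse estimate and energy argument -/

theorem dotProduct_massMatrix_mulVec (hM : IsMesh Ω 𝒯) {T : Finset (E d)} (hT : T ∈ 𝒯)
    (c e : E d → ℝ) :
    (fun z : T => c z) ⬝ᵥ Matrix.mulVec (massMatrix T) (fun z : T => e z) =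
      ∫ x in tri T, interp T c x * interp T e x ∂μHE[2] := by
  have hint : ∀ i j : T, Integrable (fun x => c i * e j * (hat T i x * hat T j x))
      ((μHE[2]).restrict (tri T)) := fun i j =>
    (MemLp.integrable_mul (memLp_affine (p := 2) hM hT (hat T i))
      (memLp_affine (p := 2) hM hT (hat T j))).const_mul _
  have h1 : ∀ x, interp T c x * interp T e x =
      ∑ i : T, ∑ j : T, c i * e j * (hat T i x * hat T j x) := by
    intro x
    rw [interp_apply, interp_apply, ← Finset.sum_coe_sort T, ← Finset.sum_coe_sort T,
      Finset.sum_mul_sum]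
    exact Finset.sum_congr rfl fun i _ => Finset.sum_congr rfl fun j _ => by ring
  simp_rw [h1]
  rw [integral_finsetSum _ fun i _ => integrable_finsetSum _ fun j _ => hint i j]
  simp only [dotProduct, Matrix.mulVec, massMatrix, Matrix.of_apply]
  refine Finset.sum_congr rfl fun i _ => ?_
  rw [integral_finsetSum _ fun j _ => hint i j, Finset.mul_sum]
  refine Finset.sum_congr rfl fun j _ => ?_
  rw [integral_const_mul]
  ring

theorem scalingMatrix_sq_mulVec (δ : E d → ℝ) (T : Finset (E d)) (w : T → ℝ) :
    (open Classical in Matrix.mulVec (scalingMatrix δ T ^ 2) w) =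
      fun z : T => (Metric.diam (tri T) / δ z) ^ 2 * w z := by
  ext z
  rw [pow_two, ← Matrix.mulVec_mulVec, scalingMatrix, Matrix.mulVec_diagonal,
    Matrix.mulVec_diagonal]
  ring

theorem dotProduct_scalingMatrix_sq_mulVec (δ : E d → ℝ) (T : Finset (E d)) (v w : T → ℝ) :
    v ⬝ᵥ (open Classical in Matrix.mulVec (scalingMatrix δ T ^ 2) w) =
      (fun z : T => (Metric.diam (tri T) / δ z) ^ 2 * v z) ⬝ᵥ w := by
  rw [scalingMatrix_sq_mulVec]
  simp only [dotProduct]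
  exact Finset.sum_congr rfl fun z _ => by ring

/-- The squared scaling matrix multiplies the nodal value at `z` by `diam² / δ z ^ 2`, so the matrix
hypotheses become relations between `A` and the affine function with nodal values `A z / δ z ^ 2`.
-/
theorem IsMesh.integral_affine_sq_le_of_massMatrixBounds (hM : IsMesh Ω 𝒯) {T : Finset (E d)}
    (hT : T ∈ 𝒯) {C₇ C₈ : ℝ} (hC₇ : 0 < C₇) {δ : E d → ℝ} (h : MassMatrixBounds C₇ C₈ δ T)
    (A : E d →ᵃ[ℝ] ℝ) :
    ∫ x in tri T, A x ^ 2 ∂μHE[2] ≤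
      C₈ * (Metric.diam (tri T) ^ 2 *
        ∫ x in tri T, interp T (fun z => A z / δ z ^ 2) x * A x ∂μHE[2]) ∧
    Metric.diam (tri T) ^ 4 * ∫ x in tri T, interp T (fun z => A z / δ z ^ 2) x ^ 2 ∂μHE[2] ≤
      C₇ * ∫ x in tri T, A x ^ 2 ∂μHE[2] := by
  classical
  set r := Metric.diam (tri T) with hr
  obtain ⟨h1, h2⟩ := h fun z => A z
  rw [mul_assoc, ← Matrix.mulVec_mulVec, ← Matrix.mulVec_mulVec,
    dotProduct_scalingMatrix_sq_mulVec, scalingMatrix_sq_mulVec,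
    dotProduct_massMatrix_mulVec hM hT (fun z => (r / δ z) ^ 2 * A z)
      (fun z => (r / δ z) ^ 2 * A z), dotProduct_massMatrix_mulVec hM hT A A] at h1
  rw [← Matrix.mulVec_mulVec, dotProduct_scalingMatrix_sq_mulVec,
    dotProduct_massMatrix_mulVec hM hT (fun z => (r / δ z) ^ 2 * A z) A,
    dotProduct_massMatrix_mulVec hM hT A A] at h2
  have hI : ∀ x, interp T (fun z => (r / δ z) ^ 2 * A z) x =
      r ^ 2 * interp T (fun z => A z / δ z ^ 2) x := by
    intro x
    rw [interp_apply, interp_apply, Finset.mul_sum]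
    exact Finset.sum_congr rfl fun z _ => by ring
  have e1 : ∫ x in tri T, interp T A x * interp T A x ∂μHE[2] = ∫ x in tri T, A x ^ 2 ∂μHE[2] :=
    setIntegral_congr_fun (isClosed_tri T).measurableSet fun x hx => by
      simp only [hM.interp_eq hT hx, pow_two]
  have e2 : ∫ x in tri T, interp T (fun z => (r / δ z) ^ 2 * A z) x * interp T A x ∂μHE[2] =
      r ^ 2 * ∫ x in tri T, interp T (fun z => A z / δ z ^ 2) x * A x ∂μHE[2] := by
    rw [← integral_const_mul]
    refine setIntegral_congr_fun (isClosed_tri T).measurableSet fun x hx => ?_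
    simp only [hM.interp_eq hT hx, hI]
    ring
  have e3 : ∫ x in tri T, interp T (fun z => (r / δ z) ^ 2 * A z) x *
        interp T (fun z => (r / δ z) ^ 2 * A z) x ∂μHE[2] =
      r ^ 4 * ∫ x in tri T, interp T (fun z => A z / δ z ^ 2) x ^ 2 ∂μHE[2] := by
    rw [← integral_const_mul]
    refine setIntegral_congr_fun (isClosed_tri T).measurableSet fun x hx => ?_
    simp only [hI]
    ring
  rw [e1, e2] at h2
  rw [e1, e3, inv_mul_le_iff₀ hC₇] at h1
  exact ⟨h2, h1⟩

theorem vectorSpan_le_range_edgeMap (a b c : E d) :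
    vectorSpan ℝ ({a, b, c} : Set (E d)) ≤
      LinearMap.range (edgeMap (b - a) (c - a) : E 2 →ₗ[ℝ] E d) := by
  rw [vectorSpan_eq_span_vsub_set_right ℝ (show a ∈ ({a, b, c} : Set (E d)) by simp),
    Submodule.span_le]
  rintro _ ⟨z, hz, rfl⟩
  rcases hz with rfl | rfl | rfl
  · exact ⟨0, by simp⟩
  · exact ⟨!₂[1, 0], by simp⟩
  · exact ⟨!₂[0, 1], by simp⟩

/-- The inverse estimate, without inverting the edge map: if the gradient `G` is the image of `v`,
then `‖G‖ ^ 2` is a combination of vertex differences and at most `2 * ‖v‖ * s`, while `D * ‖v‖ ≤ 2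
* r * ‖G‖`. Hence `D * ‖G‖ ≤ 4 * r * s`, and shape regularity removes `r ^ 2 / D`. -/
theorem IsMesh.measureReal_tri_mul_norm_tangGrad_sq_le (hM : IsMesh Ω 𝒯) {γ : ℝ}
    (hS : IsShapeRegular γ 𝒯) {T : Finset (E d)} (hT : T ∈ 𝒯) {A : E d →ᵃ[ℝ] ℝ} {s : ℝ}
    (hA : ∀ y ∈ T, ∀ z ∈ T, |A y - A z| ≤ s) :
    (μHE[2]).real (tri T) * ‖tangGrad T A‖ ^ 2 ≤ 16 * |γ| * refArea ^ 2 * s ^ 2 := by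
  have hsh := hS.diam_sq_le T hT
  have hγ := hM.gamma_pos hS hT
  obtain ⟨a, b, c, hab, hac, hbc, rfl⟩ := hM.exists_vertices hT
  have hl := hM.linearIndependent hT hab hac hbc
  have hv := refArea_pos
  have hD := parArea_pos hl
  set G := tangGrad {a, b, c} A with hG
  set r := Metric.diam (tri {a, b, c}) with hr
  set D := parArea (b - a) (c - a) with hDdef
  have hr0 : 0 < r := hM.diam_pos hT
  have hs0 : 0 ≤ s := (abs_nonneg _).trans (hA a (by simp) a (by simp))
  have hGm : G ∈ vectorSpan ℝ ({a, b, c} : Set (E d)) := by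
    simpa using tangGrad_mem {a, b, c} A
  obtain ⟨v, hv'⟩ := vectorSpan_le_range_edgeMap a b c hGm
  have hvG : edgeMap (b - a) (c - a) v = G := hv'
  have h1 : ‖G‖ ^ 2 = v 0 * (A b - A a) + v 1 * (A c - A a) := by
    have h2 : ‖G‖ ^ 2 = A.linear G := by
      rw [← inner_tangGrad {a, b, c} A (tangGrad_mem _ A), real_inner_self_eq_norm_sq]
    have h3 : ∀ z, A.linear (z - a) = A z - A a := fun z => by
      rw [← vsub_eq_sub z a, A.linearMap_vsub, vsub_eq_sub]
    rw [h2, ← hvG, edgeMap_apply, map_add, map_smul, map_smul, h3, h3, smul_eq_mul, smul_eq_mul]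
  have h2 : ‖G‖ ^ 2 ≤ 2 * ‖v‖ * s := by
    rw [h1]
    have hb := mul_le_mul (abs_coord_le_norm v 0) (hA b (by simp) a (by simp)) (abs_nonneg _)
      (norm_nonneg _)
    have hc := mul_le_mul (abs_coord_le_norm v 1) (hA c (by simp) a (by simp)) (abs_nonneg _)
      (norm_nonneg _)
    rw [← abs_mul] at hb hc
    have := le_abs_self (v 0 * (A b - A a))
    have := le_abs_self (v 1 * (A c - A a))
    linarith
  have h3 : D * ‖v‖ ≤ 2 * r * ‖G‖ := by
    rw [← hvG]
    exact parArea_mul_norm_le _ _ (dist_le_diam_tri (by simp) (by simp))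
      (dist_le_diam_tri (by simp) (by simp)) v
  have h4 : D * ‖G‖ ≤ 4 * r * s := by
    rcases (norm_nonneg G).eq_or_lt with h0 | h0
    · rw [← h0, mul_zero]
      positivity
    · refine le_of_mul_le_mul_right ?_ h0
      calc D * ‖G‖ * ‖G‖ = D * ‖G‖ ^ 2 := by ring
        _ ≤ D * (2 * ‖v‖ * s) := by gcongr
        _ = 2 * s * (D * ‖v‖) := by ring
        _ ≤ 2 * s * (2 * r * ‖G‖) := by gcongr
        _ = _ := by ring
  rw [measureReal_tri hab hac hbc] at hsh ⊢
  rw [abs_of_pos hγ]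
  refine le_of_mul_le_mul_left ?_ hD
  calc D * (D * refArea * ‖G‖ ^ 2) = refArea * (D * ‖G‖) ^ 2 := by ring
    _ ≤ refArea * (4 * r * s) ^ 2 := by gcongr
    _ = 16 * refArea * s ^ 2 * r ^ 2 := by ring
    _ ≤ 16 * refArea * s ^ 2 * (γ * (D * refArea)) := by gcongr
    _ = _ := by ring

/-- The energy argument: the `L²` projection differs from any other finite element function `J`,
in the norm weighted by the inverse mesh width, by at most a multiple of `u - J`. -/
theorem IsL2Projection.sum_integral_sub_sq_le (hM : IsMesh Ω 𝒯) (hB : ResolvesBoundary Ω 𝒯)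
    {C₇ C₈ : ℝ} (hC₇ : 0 < C₇) (hC₈ : 0 < C₈) {δ : E d → ℝ}
    (hδ : ∀ T ∈ 𝒯, MassMatrixBounds C₇ C₈ δ T) {u P J : E d → ℝ}
    (hu : MemLp u 2 ((μHE[2]).restrict Ω)) (hP : IsL2Projection Ω 𝒯 u P)
    {AP AJ : Finset (E d) → E d →ᵃ[ℝ] ℝ} (hAP : ∀ T ∈ 𝒯, ∀ x ∈ tri T ∩ Ω, P x = AP T x)
    (hAJ : ∀ T ∈ 𝒯, ∀ x ∈ tri T ∩ Ω, J x = AJ T x) :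
    ∑ T ∈ 𝒯, (∫ x in tri T, (AP T x - AJ T x) ^ 2 ∂μHE[2]) / Metric.diam (tri T) ^ 2 ≤
      C₈ ^ 2 * C₇ *
        ∑ T ∈ 𝒯, (∫ x in tri T, (u x - AJ T x) ^ 2 ∂μHE[2]) / Metric.diam (tri T) ^ 2 := by
  have hW : ∀ T ∈ 𝒯, ∀ x ∈ tri T ∩ Ω, (P - J) x = (AP T - AJ T) x := by
    intro T hT x hx
    simp [hAP T hT x hx, hAJ T hT x hx]
  -- The decisive test function. The nodal values of `P - J` are consistent, and dividing by `δ z ^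
  -- 2`, which depends on the node alone, keeps them so.
  obtain ⟨V, hV, hVB⟩ := hM.exists_mem_S1 hB (fun T z => (AP T - AJ T) z / δ z ^ 2)
    (fun z hz T hT T' hT' hzT hzT' => by
      rw [← hW T hT z ⟨mem_tri_of_mem hzT, hz⟩, ← hW T' hT' z ⟨mem_tri_of_mem hzT', hz⟩])
    (fun T hT T' hT' y z _ hyT hzT hyT' hzT' hseg => by
      rw [IsMesh.nodal_eq_of_edge hW hT hT' hyT hzT hyT' hzT' hseg])
  set B : Finset (E d) → E d →ᵃ[ℝ] ℝ :=
    fun T => interp T fun z => (AP T - AJ T) z / δ z ^ 2 with hBdef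
  have huT : ∀ T ∈ 𝒯, MemLp u 2 ((μHE[2]).restrict (tri T)) := fun T hT =>
    hu.mono_measure (hM.restrict_tri_le hB hT)
  have hLB : ∀ T ∈ 𝒯, MemLp (B T) 2 ((μHE[2]).restrict (tri T)) := fun T hT =>
    memLp_affine hM hT _
  have hLW : ∀ T ∈ 𝒯, MemLp (AP T - AJ T) 2 ((μHE[2]).restrict (tri T)) := fun T hT =>
    memLp_affine hM hT _
  have hLu : ∀ T ∈ 𝒯, MemLp (fun x => u x - AJ T x) 2 ((μHE[2]).restrict (tri T)) := fun T hT =>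
    (huT T hT).sub (memLp_affine hM hT _)
  have hIu : ∀ T ∈ 𝒯, Integrable (fun x => B T x * (u x - AJ T x)) ((μHE[2]).restrict (tri T)) :=
    fun T hT => MemLp.integrable_mul (hLB T hT) (hLu T hT)
  have hIW : ∀ T ∈ 𝒯, Integrable (fun x => B T x * (AP T - AJ T) x)
      ((μHE[2]).restrict (tri T)) :=
    fun T hT => MemLp.integrable_mul (hLB T hT) (hLW T hT)
  have horth : ∑ T ∈ 𝒯, ((∫ x in tri T, B T x * (u x - AJ T x) ∂μHE[2]) -
      ∫ x in tri T, B T x * (AP T - AJ T) x ∂μHE[2]) = 0 := by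
    have h0 := hP.2 V hV
    rw [hM.setIntegral_eq_sum (f := fun x => V x * (u x - P x)) hB
      (MemLp.integrable_mul (S1.memLp (p := 2) hM hB hV) (hu.sub (S1.memLp hM hB hP.1)))] at h0
    rw [← h0]
    refine Finset.sum_congr rfl fun T hT => ?_
    rw [← integral_sub (hIu T hT) (hIW T hT)]
    refine integral_congr_ae ?_
    filter_upwards [hM.ae_tri hB hT] with x hx
    rw [show V x = B T x from hVB T hT x hx, hAP T hT x hx, AffineMap.coe_sub, Pi.sub_apply]
    ring
  rw [Finset.sum_sub_distrib, sub_eq_zero] at horth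
  have hT : ∀ T ∈ 𝒯, (∫ x in tri T, (AP T x - AJ T x) ^ 2 ∂μHE[2]) / Metric.diam (tri T) ^ 2 ≤
      C₈ * ∫ x in tri T, B T x * (AP T - AJ T) x ∂μHE[2] := by
    intro T hT
    have hd := hM.diam_pos hT
    have := (hM.integral_affine_sq_le_of_massMatrixBounds hT hC₇ (hδ T hT) (AP T - AJ T)).1
    rw [div_le_iff₀ (by positivity)]
    refine this.trans (le_of_eq ?_)
    ring
  -- Young's inequality weighted so that, by the lower mass matrix bound, the test function
  -- contributes exactly half of the left side, which is then absorbed.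
  have hY : ∀ T ∈ 𝒯, C₈ * ∫ x in tri T, B T x * (u x - AJ T x) ∂μHE[2] ≤
      1 / 2 * ((∫ x in tri T, (AP T x - AJ T x) ^ 2 ∂μHE[2]) / Metric.diam (tri T) ^ 2) +
      C₈ ^ 2 * C₇ / 2 *
        ((∫ x in tri T, (u x - AJ T x) ^ 2 ∂μHE[2]) / Metric.diam (tri T) ^ 2) := by
    intro T hT
    set r := Metric.diam (tri T) with hr
    have hd : 0 < r := hM.diam_pos hT
    have h1 : r ^ 4 * ∫ x in tri T, B T x ^ 2 ∂μHE[2] ≤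
        C₇ * ∫ x in tri T, (AP T x - AJ T x) ^ 2 ∂μHE[2] :=
      (hM.integral_affine_sq_le_of_massMatrixBounds hT hC₇ (hδ T hT) (AP T - AJ T)).2
    have h2 : r ^ 2 / C₇ * ∫ x in tri T, B T x ^ 2 ∂μHE[2] ≤
        (∫ x in tri T, (AP T x - AJ T x) ^ 2 ∂μHE[2]) / r ^ 2 := by
      rw [le_div_iff₀ (by positivity), div_mul_eq_mul_div, div_mul_eq_mul_div,
        div_le_iff₀ hC₇]
      calc _ = r ^ 4 * ∫ x in tri T, B T x ^ 2 ∂μHE[2] := by ring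
        _ ≤ _ := h1
        _ = _ := by ring
    have h3 : C₈ * ∫ x in tri T, B T x * (u x - AJ T x) ∂μHE[2] ≤
        ∫ x in tri T, (r ^ 2 / (2 * C₇) * B T x ^ 2 +
          C₈ ^ 2 * C₇ / (2 * r ^ 2) * (u x - AJ T x) ^ 2) ∂μHE[2] := by
      rw [← integral_const_mul]
      refine integral_mono ((hIu T hT).const_mul _)
        (((hLB T hT).integrable_sq.const_mul _).add ((hLu T hT).integrable_sq.const_mul _))
        fun x => ?_
      have h4 : r ^ 2 / (2 * C₇) * B T x ^ 2 + C₈ ^ 2 * C₇ / (2 * r ^ 2) * (u x - AJ T x) ^ 2 -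
          C₈ * (B T x * (u x - AJ T x)) =
          (r ^ 2 * B T x - C₈ * C₇ * (u x - AJ T x)) ^ 2 / (2 * C₇ * r ^ 2) := by
        field_simp
        ring
      have h5 : 0 ≤ (r ^ 2 * B T x - C₈ * C₇ * (u x - AJ T x)) ^ 2 / (2 * C₇ * r ^ 2) := by
        positivity
      linarith
    rw [integral_add ((hLB T hT).integrable_sq.const_mul _)
      ((hLu T hT).integrable_sq.const_mul _), integral_const_mul, integral_const_mul] at h3
    refine h3.trans ?_
    refine add_le_add ?_ (le_of_eq ?_)
    · calc _ = 1 / 2 * (r ^ 2 / C₇ * ∫ x in tri T, B T x ^ 2 ∂μHE[2]) := by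
            field_simp
        _ ≤ _ := by gcongr
    · field_simp
  have h1 := Finset.sum_le_sum hT
  have h2 := Finset.sum_le_sum hY
  rw [← Finset.mul_sum, ← horth] at h1
  rw [← Finset.mul_sum, Finset.sum_add_distrib, ← Finset.mul_sum, ← Finset.mul_sum] at h2
  linarith

/-! ### Assembly of the stability estimate -/

theorem sub_add_sub_sq_le (p q r s : ℝ) :
    (p - q + r - s) ^ 2 ≤ 4 * (p ^ 2 + q ^ 2 + r ^ 2 + s ^ 2) := by
  nlinarith [sq_nonneg (p + q), sq_nonneg (p - r), sq_nonneg (p + s), sq_nonneg (q + r),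
    sq_nonneg (q - s), sq_nonneg (r + s)]

/-- A gradient only sees differences of nodal values. These split into nodal values of `A - I`,
bounded through the mass estimate by the integral term, and deviations of `I` from the mean of `u`,
bounded by the jumps. -/
theorem IsMeshedDomain.measureReal_tri_mul_norm_tangGrad_sq_le {γ : ℝ} (hD : IsMeshedDomain Ω 𝒯)
    (hS : IsShapeRegular γ 𝒯) {u : E d → ℝ} {g : E d → E d} (hu : HasH1Gradient Ω u g)
    {T : Finset (E d)} (hT : T ∈ 𝒯) (A : E d →ᵃ[ℝ] ℝ) :
    (μHE[2]).real (tri T) * ‖tangGrad T A‖ ^ 2 ≤ 128 * |γ| * refArea ^ 2 *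
      (|γ| / massConst * ((∫ x in tri T, (A x - interp T (quasiNodal Ω 𝒯 u T) x) ^ 2 ∂μHE[2]) /
        Metric.diam (tri T) ^ 2) + valence γ ^ 2 * jumpConst γ * patchSq 𝒯 g T) := by
  have hM := hD.1
  have hγ := hM.gamma_pos hS hT
  have hκ := massConst_pos
  have hd := hM.diam_pos hT
  have hp := patchSq_nonneg (𝒯 := 𝒯) g T
  have hJ := jumpConst_nonneg γ
  set I := interp T (quasiNodal Ω 𝒯 u T) with hI
  set X := γ / massConst * ((∫ x in tri T, (A x - I x) ^ 2 ∂μHE[2]) / Metric.diam (tri T) ^ 2)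
    with hX
  set Y := valence γ ^ 2 * jumpConst γ * patchSq 𝒯 g T with hY
  have hint : 0 ≤ ∫ x in tri T, (A x - I x) ^ 2 ∂μHE[2] := integral_nonneg fun _ => sq_nonneg _
  have hX0 : 0 ≤ X := by positivity
  have hY0 : 0 ≤ Y := by positivity
  have h1 : ∀ z ∈ T, (A z - I z) ^ 2 ≤ X := by
    intro z hz
    have h2 : (μHE[2]).real (tri T) * massConst * (A z - I z) ^ 2 ≤
        ∫ x in tri T, (A x - I x) ^ 2 ∂μHE[2] := hM.le_integral_affine_sq hT (A - I) hz
    rw [hX, div_mul_div_comm, le_div_iff₀ (by positivity)]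
    calc (A z - I z) ^ 2 * (massConst * Metric.diam (tri T) ^ 2)
        ≤ (A z - I z) ^ 2 * (massConst * (γ * (μHE[2]).real (tri T))) := by
          have := hS.diam_sq_le T hT
          gcongr
      _ = γ * ((μHE[2]).real (tri T) * massConst * (A z - I z) ^ 2) := by ring
      _ ≤ _ := by gcongr
  have h2 : ∀ z ∈ T, (I z - triAvg T u) ^ 2 ≤ Y := by
    intro z hz
    rw [hI, interp_apply_node (hM.nondegenerate T hT) _ hz]
    refine (hu.quasiNodal_sub_sq_le hD hS hT hz).trans ?_
    have := sum_patch_le_patchSq (𝒯 := 𝒯) g hz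
    rw [hY, mul_assoc]
    gcongr
  have h3 : ∀ y ∈ T, ∀ z ∈ T, |A y - A z| ≤ Real.sqrt (8 * (X + Y)) := by
    intro y hy z hz
    refine Real.abs_le_sqrt ?_
    have e : A y - A z = (A y - I y) - (A z - I z) + (I y - triAvg T u) - (I z - triAvg T u) := by
      ring
    rw [e]
    refine (sub_add_sub_sq_le _ _ _ _).trans ?_
    linarith [h1 y hy, h1 z hz, h2 y hy, h2 z hz]
  have h4 := hM.measureReal_tri_mul_norm_tangGrad_sq_le hS hT h3
  rw [Real.sq_sqrt (by positivity)] at h4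
  rw [abs_of_pos hγ] at h4 ⊢
  refine h4.trans (le_of_eq ?_)
  ring

/-- The inverse estimate gives the prefactor, the energy argument `C₈ ^ 2 * C₇`, the
quasi-interpolant the constants multiplied by it and added to it, and the overlap of the patches the
last factor. -/
noncomputable def stabilityConst (γ C₇ C₈ : ℝ) : ℝ :=
  128 * |γ| * refArea ^ 2 *
    (|γ| / massConst * (C₈ ^ 2 * C₇ * approxConst γ) + valence γ ^ 2 * jumpConst γ) *
    (3 * valence γ)

theorem IsL2Projection.sum_norm_tangGrad_sq_le {γ C₇ C₈ : ℝ} (hD : IsMeshedDomain Ω 𝒯)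
    (hS : IsShapeRegular γ 𝒯) (hC₇ : 0 < C₇) (hC₈ : 0 < C₈) {δ : E d → ℝ}
    (hδ : ∀ T ∈ 𝒯, MassMatrixBounds C₇ C₈ δ T) {u P : E d → ℝ} {g : E d → E d}
    (hu : HasH1Gradient Ω u g) (hP : IsL2Projection Ω 𝒯 u P)
    {A : Finset (E d) → E d →ᵃ[ℝ] ℝ} (hA : ∀ T ∈ 𝒯, ∀ x ∈ tri T ∩ Ω, P x = A T x) :
    ∑ T ∈ 𝒯, (μHE[2]).real (tri T) * ‖tangGrad T (A T)‖ ^ 2 ≤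
      stabilityConst γ C₇ C₈ * ∑ T ∈ 𝒯, gradSq g T := by
  have hM := hD.1
  have hκ := massConst_pos
  have hC1 := approxConst_nonneg γ
  have hJ := jumpConst_nonneg γ
  -- The energy argument only needs `J` as one function with affine representatives, since this
  -- already makes the nodal values of the difference consistent.
  obtain ⟨J, -, hJA⟩ := hD.exists_quasiInterpolant u
  have h1 := Finset.sum_le_sum fun T hT =>
    hD.measureReal_tri_mul_norm_tangGrad_sq_le hS hu hT (A T)
  rw [← Finset.mul_sum, Finset.sum_add_distrib, ← Finset.mul_sum, ← Finset.mul_sum] at h1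
  have h2 := hP.sum_integral_sub_sq_le hM hD.2.1 hC₇ hC₈ hδ hu.memLp hA hJA
  have h3 : ∑ T ∈ 𝒯, (∫ x in tri T, (u x - interp T (quasiNodal Ω 𝒯 u T) x) ^ 2 ∂μHE[2]) /
      Metric.diam (tri T) ^ 2 ≤ approxConst γ * ∑ T ∈ 𝒯, patchSq 𝒯 g T := by
    rw [Finset.mul_sum]
    refine Finset.sum_le_sum fun T hT => ?_
    have hd := hM.diam_pos hT
    rw [div_le_iff₀' (by positivity)]
    exact hu.integral_sub_quasiInterpolant_sq_le hD hS hT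
  have h4 := hD.sum_patchSq_le hS g
  refine h1.trans ?_
  calc _ ≤ 128 * |γ| * refArea ^ 2 *
        (|γ| / massConst * (C₈ ^ 2 * C₇ * (approxConst γ * ∑ T ∈ 𝒯, patchSq 𝒯 g T)) +
          valence γ ^ 2 * jumpConst γ * ∑ T ∈ 𝒯, patchSq 𝒯 g T) := by
        gcongr
        exact h2.trans (by gcongr)
    _ = 128 * |γ| * refArea ^ 2 *
        (|γ| / massConst * (C₈ ^ 2 * C₇ * approxConst γ) + valence γ ^ 2 * jumpConst γ) *
          ∑ T ∈ 𝒯, patchSq 𝒯 g T := by ring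
    _ ≤ 128 * |γ| * refArea ^ 2 *
        (|γ| / massConst * (C₈ ^ 2 * C₇ * approxConst γ) + valence γ ^ 2 * jumpConst γ) *
          (3 * valence γ * ∑ T ∈ 𝒯, gradSq g T) := by gcongr
    _ = _ := by
      rw [stabilityConst]
      ring

theorem eLpNorm_two_eq {X F : Type*} [MeasurableSpace X] [NormedAddCommGroup F] {μ : Measure X}
    {f : X → F} (hf : MemLp f 2 μ) :
    eLpNorm f 2 μ = ENNReal.ofReal (Real.sqrt (∫ x, ‖f x‖ ^ 2 ∂μ)) := by
  rw [hf.eLpNorm_eq_integral_rpow_norm two_ne_zero ENNReal.ofNat_ne_top, Real.sqrt_eq_rpow]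
  norm_num

theorem IsMesh.integral_norm_meshGrad_sq (hM : IsMesh Ω 𝒯) (hB : ResolvesBoundary Ω 𝒯)
    (A : Finset (E d) → E d →ᵃ[ℝ] ℝ) :
    ∫ x in Ω, ‖meshGrad 𝒯 A x‖ ^ 2 ∂μHE[2] =
      ∑ T ∈ 𝒯, (μHE[2]).real (tri T) * ‖tangGrad T (A T)‖ ^ 2 := by
  rw [hM.setIntegral_eq_sum hB ((hM.memLp_meshGrad A).integrable_norm_pow two_ne_zero)]
  refine Finset.sum_congr rfl fun T hT => ?_
  rw [← smul_eq_mul, ← setIntegral_const]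
  refine integral_congr_ae ?_
  rw [Filter.EventuallyEq, ae_restrict_iff' (isClosed_tri T).measurableSet]
  filter_upwards [measure_eq_zero_iff_ae_notMem.1 (measure_skeleton 𝒯)] with x hx hxT
  rw [hM.meshGrad_eq A hT hxT hx]

theorem eLpNorm_le_of_integral_le {F G : Type*} [NormedAddCommGroup F]
    [NormedAddCommGroup G] {X : Type*} [MeasurableSpace X] {μ : Measure X} {f : X → F} {g : X → G}
    (hf : MemLp f 2 μ) (hg : MemLp g 2 μ) {C : ℝ}
    (h : ∫ x, ‖f x‖ ^ 2 ∂μ ≤ C * ∫ x, ‖g x‖ ^ 2 ∂μ) :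
    eLpNorm f 2 μ ≤ ENNReal.ofReal (Real.sqrt C) * eLpNorm g 2 μ := by
  rw [eLpNorm_two_eq hf, eLpNorm_two_eq hg, ← ENNReal.ofReal_mul (Real.sqrt_nonneg _),
    ← Real.sqrt_mul' _ (integral_nonneg fun _ => by positivity)]
  exact ENNReal.ofReal_le_ofReal (Real.sqrt_le_sqrt h)

end P1FEM

theorem lemma22 (γ C₇ C₈ : ℝ) (hC₇ : 0 < C₇) (hC₈ : 0 < C₈) :
    ∃ C₂ : ℝ, 0 < C₂ ∧
      ∀ (d : ℕ) (Ω : Set (P1FEM.E d)) (𝒯 : Finset (Finset (P1FEM.E d))) (δ : P1FEM.E d → ℝ),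
        P1FEM.IsMeshedDomain Ω 𝒯 →
        P1FEM.IsShapeRegular γ 𝒯 →
        (∀ T ∈ 𝒯, ∀ z ∈ T, 0 < δ z) →
        (∀ T ∈ 𝒯, P1FEM.MassMatrixBounds C₇ C₈ δ T) →
        ∀ (u : P1FEM.E d → ℝ) (g : P1FEM.E d → P1FEM.E d), P1FEM.HasH1Gradient Ω u g →
          (∃ P, P1FEM.IsL2Projection Ω 𝒯 u P) ∧
          ∀ P, P1FEM.IsL2Projection Ω 𝒯 u P →
            ∃ gP, P1FEM.HasH1Gradient Ω P gP ∧
              eLpNorm gP 2 ((MeasureTheory.Measure.euclideanHausdorffMeasure 2).restrict Ω) ≤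
                ENNReal.ofReal C₂ *
                  eLpNorm g 2 ((MeasureTheory.Measure.euclideanHausdorffMeasure 2).restrict Ω) := by
  -- Adding `1` makes the constant positive for every `γ`; the stability constant itself vanishes at
  -- `γ = 0`.
  refine ⟨Real.sqrt (P1FEM.stabilityConst γ C₇ C₈) + 1, by positivity,
    fun d Ω 𝒯 δ hD hS _ hδ u g hu =>
      ⟨P1FEM.exists_isL2Projection hD.1 hD.2.1 hu.memLp, fun P hP => ?_⟩⟩
  obtain ⟨A, hA⟩ := P1FEM.S1.exists_affine hP.1
  refine ⟨P1FEM.meshGrad 𝒯 A, P1FEM.S1.hasH1Gradient hD.1 hD.2.1 hP.1 hA, ?_⟩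
  refine (P1FEM.eLpNorm_le_of_integral_le (C := P1FEM.stabilityConst γ C₇ C₈)
    (hD.1.memLp_meshGrad A) hu.memLp_grad ?_).trans ?_
  · rw [hD.1.integral_norm_meshGrad_sq hD.2.1,
      hD.1.setIntegral_eq_sum hD.2.1 (hu.memLp_grad.integrable_norm_pow two_ne_zero)]
    exact hP.sum_norm_tangGrad_sq_le hD hS hC₇ hC₈ hδ hu hA
  · gcongr
    linarith
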